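/- **Theorem 7.4 (soundness and completeness of CL18).** A cirquent is valid if and only if it is provable in CL18. The notions are as follows. *Games.* There are two players, the machine $\top$ and the environment $\bot$; $\overline\wp$ is the adversary of $\wp$. A move is a finite string over a fixed finite keyboard alphabet, a labmove is a move labelled with a player, a run is a finite or infinite sequence of labmoves, and a position is a finite run. A game $G$ consists of a nonempty set of (legal) runs that is prefix-closed and limit-closed (an infinite run all of whose finite initial segments are legal is legal), and a function assigning to each legal run its winner. A run is $\wp$-legal if it is legal or the last move of its shortest illegal initial segment is $\overline\wp$-labelled. It is $\wp$-won if it is legal and its winner is $\wp$, or if it is not $\overline\wp$-legal. A run $\Upsilon$ is a $\wp$-delay of $\Gamma$ if for both players $\wp'$ the subsequences of $\wp'$-labelled moves of $\Upsilon$ and $\Gamma$ coincide and, for all $n,k\ge 1$, whenever the $n$th $\wp$-labelled move is later than the $k$th $\overline\wp$-labelled move in $\Gamma$, so it is in $\Upsilon$. $G$ is static if for each $\wp$, every $\wp$-delay of a $\wp$-legal (resp. $\wp$-won) run of $G$ is again $\wp$-legal (resp. $\wp$-won). The game $\neg G$ is $G$ with the two players interchanged. *Machines.* An HPM is a deterministic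 Turing machine with finitely many states, finitely many read/write work tapes over a finite alphabet, a read-only run tape that at any time spells the current position, and the capability of making moves, which it constructs symbol by symbol. In every clock cycle the environment makes an arbitrary finite number (possibly zero) of moves, and the machine performs one transition, in which it may make one move. An HPM solves $G$ if, no matter what moves the environment makes and when, the run incrementally spelled on the run tape is $\top$-won. *Cirquents.* Letters and clusters are indexed by $0,1,2,\dots$. Literals are $P^a$ (positive) and $\neg P^a$ (negative), with $P$ a letter and $a$ a cluster. Cirquents are built from $\top$, $\bot$ and the literals by $A\vee B$, $A\wedge B$, $A\sqcap^c B$ and $A\sqcup^c B$, with $c$ a cluster. *Semantics.* An interpretation ${}^*$ assigns a static game $P^*$ to every letter $P$; put $(P^a)^*=P^*$ and $(\neg P^a)^*=\neg(P^*)$. For a run $\Gamma$ and a literal $L$, $\Gamma^{L.}$ results from $\Gamma$ by keeping only the labmoves of the form $\wp L.\alpha$ and replacing each of them by $\wp\alpha$. A run $\Gamma$ is a legal run of the game $C^*$ if each of its labmoves has the form $\wp L.\alpha$ with $L$ a literal, or is $\bot\sqcap^c.i$ or $\top\sqcup^c.i$ with $c$ a cluster and $i\in\{0,1\}$; $\Gamma^{L.}$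 is a legal run of $L^*$ for every literal $L$; and for each cluster $c$, $\Gamma$ contains at most one labmove $\bot\sqcap^c.i$ and at most one labmove $\top\sqcup^c.i$. A legal run $\Gamma$ of $C^*$ is won by $\top$ iff: $C=\top$; or $C$ is a literal $L$ and $\Gamma^{L.}$ is won by $\top$ in $L^*$; or $C=A_0\wedge A_1$ (resp. $A_0\vee A_1$) and $\Gamma$ is won by $\top$ in both (resp. at least one) of $A_0^*,A_1^*$; or $C=A_0\sqcap^c A_1$ and either $\Gamma$ contains $\bot\sqcap^c.i$ for some $i$ and is won by $\top$ in $A_i^*$, or $\Gamma$ contains no such labmove; or $C=A_0\sqcup^c A_1$, $\Gamma$ contains $\top\sqcup^c.i$ for some $i$, and $\Gamma$ is won by $\top$ in $A_i^*$. A cirquent $C$ is *valid* if there is one HPM that solves $C^*$ for every interpretation ${}^*$. *The calculus CL18.* A letter $Q$ is pseudoelementary in $C$ if it occurs in $C$ and there is at most one $a$ such that $Q^a$ occurs in $C$ and at most one $b$ such that $\neg Q^b$ occurs in $C$ (each possibly many times); other letters occurring in $C$ are non-pseudoelementary in $C$. A cirquent is *provable* if it is the root of a finite tree of cirquents whose leaves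 are $\top$ and in which each other node follows from its children by one of the following rules, written premise(s) $\leadsto$ conclusion. Here $X[A_1,\dots,A_k]$ is a cirquent together with subcirquents $A_1,\dots,A_k$, and $X[B_1,\dots,B_k]$ results from it by replacing all occurrences of $A_1,\dots,A_k$ by $B_1,\dots,B_k$, respectively; likewise for $Y$. - Commutativity: $X[B\vee A]\leadsto X[A\vee B]$; $X[B\wedge A]\leadsto X[A\wedge B]$. - Associativity: $X[A\vee(B\vee C)]\leadsto X[(A\vee B)\vee C]$; $X[A\wedge(B\wedge C)]\leadsto X[(A\wedge B)\wedge C]$. - Identity: $X[A]\leadsto X[A\vee\bot]$; $X[A]\leadsto X[A\wedge\top]$. - Domination: $X[\top]\leadsto X[A\vee\top]$; $X[\bot]\leadsto X[A\wedge\bot]$. - Distribution: $X[(A\vee C)\wedge(B\vee C)]\leadsto X[(A\wedge B)\vee C]$; $X[(A\vee C)\sqcap^c(B\vee C)]\leadsto X[(A\sqcap^c B)\vee C]$. - Cleansing: $X[Y[A]\sqcap^c C]\leadsto X[Y[A\sqcap^c B]\sqcap^c C]$; $X[C\sqcap^c Y[B]]\leadsto X[C\sqcap^c Y[A\sqcap^c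 B]]$. - Splitting: $A,\,B\leadsto A\sqcap^c B$, where $\sqcap^c$ occurs in neither premise. - Trivialization: $X[\top]\leadsto X[Q^a\vee\neg Q^b]$, where $Q$ is pseudoelementary in the conclusion. - Quadrilemma: $X\bigl[\bigl((A\wedge(C\sqcap^b D))\sqcap^a(B\wedge(C\sqcap^b D))\bigr)\sqcap^c\bigl(((A\sqcap^a B)\wedge C)\sqcap^b((A\sqcap^a B)\wedge D)\bigr)\bigr]\leadsto X[(A\sqcap^a B)\wedge(C\sqcap^b D)]$, where $\sqcap^c$ does not occur in the conclusion. - Left (resp. Right) Choosing: from the cirquent obtained from $X$ by replacing every subcirquent of the form $A\sqcup^c B$ (nested ones included) by $A$ (resp. by $B$), infer $X$. - Matching: $X[Q^c,\neg Q^d]\leadsto X[P^a,\neg P^b]$, where $P$ is non-pseudoelementary in the conclusion and $Q$ is a letter not occurring in the conclusion. -/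

import Mathlib

namespace CL18

/-! ## Players, moves, runs -/

/-- The two players: the machine `⊤` and the environment `⊥`. -/
inductive Player where
  | machine
  | environment
  deriving DecidableEq

/-- The adversary of a player. -/
def Player.opp : Player → Player
  | .machine => .environment
  | .environment => .machine

/-- The keyboard alphabet: a finite alphabet with decimal digits, Latin letters, and the
punctuation marks `.`, `^`, `¬`, `⊓`, `⊔`. -/
inductive Key where
  | digit (d : Fin 10)
  | latin (l : Fin 26)
  | dot
  | caret
  | neg
  | chand
  | chor
  deriving DecidableEq

/-- A move is a finite string over the keyboard alphabet. -/
abbrev Move := List Key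

/-- A labmove is a move labelled with the player who makes it. -/
abbrev Labmove := Player × Move

/-- A run is a finite or infinite sequence of labmoves. -/
abbrev Run := Stream'.Seq Labmove

/-- A position is a finite run. -/
abbrev Position := List Labmove

/-- The finite or infinite sequence approximated by a growing chain of finite lists: its `n`th item
is the `n`th item of the members of the chain that are long enough to have one. -/
noncomputable def limit {α : Type} (f : ℕ → List α) : Stream'.Seq α :=
  open Classical in
  ⟨fun n => if h : ∃ b t, (f t)[n]? = some b then some h.choose else none, by
    intro n hn
    have h0 : ¬ ∃ b t, (f t)[n]? = some b := by
      intro h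
      exact absurd ((dif_pos h).symm.trans hn) (by simp)
    refine dif_neg ?_
    rintro ⟨b, t, hb⟩
    have hlen : n + 1 < (f t).length := (List.getElem?_eq_some_iff.mp hb).1
    exact h0 ⟨(f t)[n]'(by omega), t, List.getElem?_eq_getElem _⟩⟩

/-- The subsequence of a finite or infinite sequence obtained by deleting the items on which `f`
returns `none` and replacing every other item `a` by `b`, where `f a = some b`. -/
noncomputable def sift {α β : Type} (f : α → Option β) (s : Stream'.Seq α) : Stream'.Seq β :=
  limit fun m => (s.take m).filterMap f

/-- Interchange of the two labels throughout a run. -/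
def Run.bar (Γ : Run) : Run :=
  Stream'.Seq.map (fun x => (x.1.opp, x.2)) Γ

/-! ## Games -/

/-- A game: a nonempty, prefix-closed and limit-closed set of legal runs, and an assignment of a
winner to every legal run (the values of `win` at other runs are never used). -/
structure Game where
  legal : Set Run
  win : Run → Player
  nonempty : legal.Nonempty
  prefix_closed : ∀ Γ ∈ legal, ∀ n : ℕ, (Stream'.Seq.ofList (Γ.take n) : Run) ∈ legal
  limit_closed : ∀ Γ : Run, ¬ Γ.Terminates →
    (∀ n : ℕ, (Stream'.Seq.ofList (Γ.take n) : Run) ∈ legal) → Γ ∈ legal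

/-- `Γ` is a `p`-legal run of `G`: either `Γ` is legal, or the last move of its shortest illegal
initial segment is labelled with the adversary of `p`. -/
def Game.LegalFor (G : Game) (p : Player) (Γ : Run) : Prop :=
  Γ ∈ G.legal ∨
    ∃ (n : ℕ) (α : Move), Stream'.Seq.ofList (Γ.take n) ∈ G.legal ∧
      Stream'.Seq.ofList (Γ.take (n + 1)) ∉ G.legal ∧ Γ.get? n = some (p.opp, α)

/-- `Γ` is a `p`-won run of `G`: a legal run won by `p`, or an illegal run in which the adversary of
`p` has made the first illegal move. -/
def Game.WonBy (G : Game) (p : Player) (Γ : Run) : Prop :=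
  (Γ ∈ G.legal ∧ G.win Γ = p) ∨ ¬ G.LegalFor p.opp Γ

/-- The subsequence of the moves made by `p`. -/
noncomputable def Run.movesOf (Γ : Run) (p : Player) : Stream'.Seq Move :=
  sift (fun x : Labmove => if x.1 = p then some x.2 else none) Γ

/-- The `n`th (counting from zero) `p`-labelled move of `Γ` stands at place `i` of `Γ`. -/
def Run.NthAt (Γ : Run) (p : Player) (n i : ℕ) : Prop :=
  (∃ α : Move, Γ.get? i = some (p, α)) ∧
    ((Γ.take i).filter fun x : Labmove => decide (x.1 = p)).length = n

/-- `Υ` is a `p`-delay of `Γ`. -/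
def IsDelay (p : Player) (Υ Γ : Run) : Prop :=
  (∀ q : Player, Υ.movesOf q = Γ.movesOf q) ∧
    ∀ n k i j i' j' : ℕ, Γ.NthAt p n i → Γ.NthAt p.opp k j → j < i →
      Υ.NthAt p n i' → Υ.NthAt p.opp k j' → j' < i'

/-- Static games. -/
def Game.Static (G : Game) : Prop :=
  ∀ (p : Player) (Υ Γ : Run), IsDelay p Υ Γ →
    (G.LegalFor p Γ → G.LegalFor p Υ) ∧ (G.WonBy p Γ → G.WonBy p Υ)

/-! ### Facts about runs needed to see that the constructions below yield games -/

theorem take_prefix_take {α : Type} (s : Stream'.Seq α) {m n : ℕ} (h : m ≤ n) :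
    s.take m <+: s.take n := by
  rw [List.prefix_iff_getElem?]
  intro i hi
  have h1 : (s.take m)[i]? = some (s.take m)[i] := List.getElem?_eq_getElem hi
  have h2 : i < m := lt_of_lt_of_le hi Stream'.Seq.length_take_le
  rw [← h1, Stream'.Seq.getElem?_take, Stream'.Seq.getElem?_take, if_pos h2, if_pos (by omega)]

theorem prefix_get {α : Type} {l l' : List α} (h : l <+: l') {n : ℕ} {b : α}
    (hb : l[n]? = some b) : l'[n]? = some b := by
  obtain ⟨t, rfl⟩ := h
  obtain ⟨hn, _⟩ := List.getElem?_eq_some_iff.mp hb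
  rw [List.getElem?_append_left hn, hb]

theorem get?_limit_eq_some {α : Type} {f : ℕ → List α}
    (hf : ∀ m n, m ≤ n → f m <+: f n) (n : ℕ) (b : α) :
    (limit f).get? n = some b ↔ ∃ t, (f t)[n]? = some b := by
  classical
  have key : ∀ b b' t t', (f t)[n]? = some b → (f t')[n]? = some b' → b = b' := by
    intro b b' t t' h h'
    have h1 := prefix_get (hf t (max t t') (le_max_left _ _)) h
    have h2 := prefix_get (hf t' (max t t') (le_max_right _ _)) h'
    rw [h1] at h2
    exact Option.some.inj h2
  have hval : (limit f).get? n =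
      if h : ∃ b t, (f t)[n]? = some b then some h.choose else none := rfl
  rw [hval]
  constructor
  · intro h
    split_ifs at h with hex
    obtain ⟨t, ht⟩ := hex.choose_spec
    exact ⟨t, by rw [ht, h]⟩
  · rintro ⟨t, ht⟩
    have hex : ∃ b t, (f t)[n]? = some b := ⟨b, t, ht⟩
    rw [dif_pos hex]
    obtain ⟨t', ht'⟩ := hex.choose_spec
    rw [key _ _ _ _ ht' ht]

theorem get?_sift_eq_some {α β : Type} (f : α → Option β) (s : Stream'.Seq α) (n : ℕ) (b : β) :
    (sift f s).get? n = some b ↔ ∃ t, ((s.take t).filterMap f)[n]? = some b :=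
  get?_limit_eq_some (fun _ _ h => (take_prefix_take s h).filterMap f) n b

theorem take_ofList {α : Type} (l : List α) (n : ℕ) :
    (Stream'.Seq.ofList l).take n = l.take n := by
  apply List.ext_getElem?
  intro i
  rw [Stream'.Seq.getElem?_take, List.getElem?_take, Stream'.Seq.ofList_get?]

theorem sift_ofList {α β : Type} (f : α → Option β) (l : List α) :
    sift f (Stream'.Seq.ofList l) = Stream'.Seq.ofList (l.filterMap f) := by
  ext n b
  simp only [get?_sift_eq_some, take_ofList, Stream'.Seq.ofList_get?]
  constructor
  · rintro ⟨t, ht⟩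
    exact prefix_get ((List.take_prefix t l).filterMap f) ht
  · intro h
    exact ⟨l.length, by rwa [List.take_length]⟩

theorem ofList_take_of_prefix {α : Type} {l : List α} {s : Stream'.Seq α}
    (h : ∀ n b, l[n]? = some b → s.get? n = some b) : s.take l.length = l := by
  apply List.ext_getElem?
  intro i
  rw [Stream'.Seq.getElem?_take]
  split_ifs with hi
  · exact (h i _ (List.getElem?_eq_getElem hi)).trans (List.getElem?_eq_getElem hi).symm
  · exact (List.getElem?_eq_none (by omega)).symm

/-- An initial segment of `s` is sifted to an initial segment of what `s` is sifted to. -/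
theorem exists_take_sift {α β : Type} (f : α → Option β) (s : Stream'.Seq α) (n : ℕ) :
    ∃ k, (sift f s).take k = (s.take n).filterMap f :=
  ⟨_, ofList_take_of_prefix fun i b hb => (get?_sift_eq_some f s i b).mpr ⟨n, hb⟩⟩

/-- An initial segment of a sifted sequence is an initial segment of a sifted initial segment. -/
theorem exists_take_take {α β : Type} (f : α → Option β) (s : Stream'.Seq α) (k : ℕ) :
    ∃ n, (sift f s).take k = ((s.take n).filterMap f).take k := by
  induction k with
  | zero => exact ⟨0, by simp⟩
  | succ k ih =>
    obtain ⟨n, hn⟩ := ih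
    rcases hk : (sift f s).get? k with _ | b
    · refine ⟨n, ?_⟩
      apply List.ext_getElem?
      intro i
      rw [Stream'.Seq.getElem?_take, List.getElem?_take]
      have hi := congrArg (fun l => l[i]?) hn
      simp only [Stream'.Seq.getElem?_take, List.getElem?_take] at hi
      split_ifs with h
      · rcases Nat.lt_succ_iff_lt_or_eq.mp h with h' | rfl
        · rwa [if_pos h', if_pos h'] at hi
        · rw [hk]
          symm
          by_contra hne
          obtain ⟨c, hc⟩ := Option.ne_none_iff_exists'.mp hne
          rw [(get?_sift_eq_some f s i c).mpr ⟨n, hc⟩] at hk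
          cases hk
      · rfl
    · obtain ⟨t, ht⟩ := (get?_sift_eq_some f s k b).mp hk
      refine ⟨t, ?_⟩
      obtain ⟨hlt, _⟩ := List.getElem?_eq_some_iff.mp ht
      apply List.ext_getElem?
      intro i
      rw [Stream'.Seq.getElem?_take, List.getElem?_take]
      split_ifs with h
      · have hi : i < ((s.take t).filterMap f).length := by omega
        rw [List.getElem?_eq_getElem hi]
        exact (get?_sift_eq_some f s i _).mpr ⟨t, List.getElem?_eq_getElem hi⟩
      · rfl

theorem bar_take (Γ : Run) (n : ℕ) :
    Γ.bar.take n = (Γ.take n).map fun x => (x.1.opp, x.2) := by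
  apply List.ext_getElem?
  intro i
  rw [List.getElem?_map, Stream'.Seq.getElem?_take, Stream'.Seq.getElem?_take, Run.bar,
    Stream'.Seq.map_get?]
  split_ifs <;> rfl

theorem bar_ofList (l : Position) :
    Run.bar (Stream'.Seq.ofList l) = Stream'.Seq.ofList (l.map fun x => (x.1.opp, x.2)) := by
  ext n b
  rw [Run.bar, Stream'.Seq.map_get?, Stream'.Seq.ofList_get?, Stream'.Seq.ofList_get?,
    List.getElem?_map]

theorem bar_ofList_take (Γ : Run) (n : ℕ) :
    Run.bar (Stream'.Seq.ofList (Γ.take n)) = Stream'.Seq.ofList (Γ.bar.take n) := by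
  rw [bar_ofList, bar_take]

theorem bar_bar (Γ : Run) : Γ.bar.bar = Γ := by
  have h : (fun x : Labmove => (x.1.opp, x.2)) ∘ (fun x : Labmove => (x.1.opp, x.2)) = id := by
    funext ⟨p, α⟩
    cases p <;> rfl
  rw [Run.bar, Run.bar, ← Stream'.Seq.map_comp, h, Stream'.Seq.map_id]

theorem Game.empty_legal (G : Game) : (Stream'.Seq.ofList [] : Run) ∈ G.legal := by
  obtain ⟨Γ, hΓ⟩ := G.nonempty
  simpa using G.prefix_closed Γ hΓ 0

/-- Sifting a legal run initial segment by initial segment: prefix-closure. -/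
theorem Game.sift_take_legal (G : Game) (f : Labmove → Option Labmove) (Γ : Run) (n : ℕ)
    (h : sift f Γ ∈ G.legal) : sift f (Stream'.Seq.ofList (Γ.take n)) ∈ G.legal := by
  obtain ⟨k, hk⟩ := exists_take_sift f Γ n
  rw [sift_ofList, ← hk]
  exact G.prefix_closed _ h k

/-- Sifting a run all of whose sifted initial segments are legal: limit-closure. -/
theorem Game.sift_legal (G : Game) (f : Labmove → Option Labmove) (Γ : Run)
    (h : ∀ n : ℕ, sift f (Stream'.Seq.ofList (Γ.take n)) ∈ G.legal) : sift f Γ ∈ G.legal := by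
  have hpre : ∀ k : ℕ, (Stream'.Seq.ofList ((sift f Γ).take k) : Run) ∈ G.legal := by
    intro k
    obtain ⟨n, hn⟩ := exists_take_take f Γ k
    rw [hn, ← take_ofList]
    refine G.prefix_closed _ ?_ k
    rw [← sift_ofList]
    exact h n
  by_cases ht : (sift f Γ).Terminates
  · obtain ⟨k, hk⟩ := ht
    have heq : Stream'.Seq.ofList ((sift f Γ).take k) = sift f Γ := by
      apply Stream'.Seq.ext
      intro i
      rw [Stream'.Seq.ofList_get?, Stream'.Seq.getElem?_take]
      split_ifs with hi
      · rfl
      · exact (Stream'.Seq.terminated_stable _ (Nat.le_of_not_lt hi) hk).symm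
    rw [← heq]
    exact hpre k
  · exact G.limit_closed _ ht hpre

/-! ### Negation -/

/-- The negation of a game: the two players are interchanged. -/
def Game.neg (G : Game) : Game where
  legal := {Γ | Γ.bar ∈ G.legal}
  win Γ := (G.win Γ.bar).opp
  nonempty := by
    obtain ⟨Γ, hΓ⟩ := G.nonempty
    exact ⟨Γ.bar, by rwa [Set.mem_ofPred_eq, bar_bar]⟩
  prefix_closed Γ hΓ n := by
    rw [Set.mem_ofPred_eq, bar_ofList_take]
    exact G.prefix_closed _ hΓ n
  limit_closed Γ hΓ h := by
    refine G.limit_closed _ (fun hb => hΓ (Stream'.Seq.terminates_map_iff.mp hb)) fun n => ?_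
    rw [← bar_ofList_take]
    exact h n

/-! ## Hard-play machines -/

/-- Symbols on the run tape: labels and keys. -/
abbrev RunSymbol := Player ⊕ Key

/-- The string by which a position is spelled on the run tape. -/
def spell (Φ : Position) : List RunSymbol :=
  Φ.flatMap fun x => Sum.inl x.1 :: x.2.map Sum.inr

/-- What a machine may do about its moves in a transition: nothing, append a key to the move it is
constructing, or make the move constructed so far (and start constructing a new one). -/
inductive MoveAction where
  | idle
  | type (k : Key)
  | submit

/-- A hard-play machine: a deterministic multi-tape Turing machine with a fixed finite number of
read/write work tapes, a read-only run tape, and the capability of making moves. The program maps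
the current state, the run tape symbol scanned (`none` is the blank) and the work tape symbols
scanned to the next state, the direction in which to move the run tape head (`none`: stay), the
symbol to write and the direction in which to move the head on every work tape, and a
`MoveAction`. -/
structure HPM where
  State : Type
  [stateFinite : Finite State]
  start : State
  WorkSymbol : Type
  [workSymbolFinite : Finite WorkSymbol]
  /-- The default symbol is the blank. -/
  [workSymbolInhabited : Inhabited WorkSymbol]
  tapes : ℕ
  program : State → Option RunSymbol → (Fin tapes → WorkSymbol) →
    State × Option Turing.Dir × (Fin tapes → WorkSymbol × Option Turing.Dir) × MoveAction

attribute [instance] HPM.stateFinite HPM.workSymbolFinite HPM.workSymbolInhabited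

/-- An instantaneous description of a machine together with the current position of the play.
The run tape has a leftmost cell, at which `runHead` is `0`; the work tapes are two-way infinite. -/
structure HPM.Config (H : HPM) where
  state : H.State
  runHead : ℕ
  work : Fin H.tapes → Turing.Tape H.WorkSymbol
  buffer : Move
  position : Position

/-- At the start all tapes are blank and no moves have been made. -/
def HPM.init (H : HPM) : H.Config where
  state := H.start
  runHead := 0
  work _ := default
  buffer := []
  position := []

/-- Moving the head of the run tape; at the leftmost cell a move to the left has no effect. -/
def moveRunHead : Option Turing.Dir → ℕ → ℕ
  | none, n => n
  | some Turing.Dir.left, n => n - 1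
  | some Turing.Dir.right, n => n + 1

/-- Moving the head of a work tape. -/
def moveWorkHead {Γ : Type} [Inhabited Γ] : Option Turing.Dir → Turing.Tape Γ → Turing.Tape Γ
  | none, T => T
  | some d, T => T.move d

/-- One clock cycle: first the environment makes the (finitely many, possibly zero) moves `e`, and
the run tape is updated; then the machine performs one transition. -/
def HPM.step (H : HPM) (e : List Move) (c : H.Config) : H.Config :=
  let Φ : Position := c.position ++ e.map fun α => (Player.environment, α)
  let r := H.program c.state (spell Φ)[c.runHead]? fun i => (c.work i).head
  { state := r.1
    runHead := moveRunHead r.2.1 c.runHead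
    work := fun i => moveWorkHead (r.2.2.1 i).2 ((c.work i).write (r.2.2.1 i).1)
    buffer :=
      match r.2.2.2 with
      | .idle => c.buffer
      | .type k => c.buffer ++ [k]
      | .submit => []
    position :=
      match r.2.2.2 with
      | .submit => Φ ++ [(Player.machine, c.buffer)]
      | _ => Φ }

/-- The configuration after `t` clock cycles, when the environment makes the moves `env s` in
clock cycle `s`. -/
def HPM.configAt (H : HPM) (env : ℕ → List Move) : ℕ → H.Config
  | 0 => H.init
  | t + 1 => H.step (env t) (H.configAt env t)

/-- The run incrementally spelled on the run tape. -/
noncomputable def HPM.run (H : HPM) (env : ℕ → List Move) : Run :=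
  limit fun t => (H.configAt env t).position

/-- `H` is a solution of `G`: no matter what moves the environment makes and when, the run
generated is won by the machine. -/
def HPM.Solves (H : HPM) (G : Game) : Prop :=
  ∀ env : ℕ → List Move, G.WonBy Player.machine (H.run env)

/-! ## Cirquents -/

/-- Literals: `pos P a` is the `P`-lettered `a`-clustered positive literal, and `neg P a` is its
negation. Letters and clusters are identified with their numbers. -/
inductive Literal where
  | pos (P a : ℕ)
  | neg (P a : ℕ)
  deriving DecidableEq

/-- Cirquents. -/
inductive Cirquent where
  | top
  | bot
  | lit (L : Literal)
  | or (A B : Cirquent)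
  | and (A B : Cirquent)
  | chand (c : ℕ) (A B : Cirquent)
  | chor (c : ℕ) (A B : Cirquent)
  deriving DecidableEq

/-- The decimal numeral of a number. -/
def numeral (n : ℕ) : List Key :=
  if n = 0 then [Key.digit 0]
  else (Nat.digits 10 n).reverse.map fun d => Key.digit (Fin.ofNat 10 d)

/-- The string by which a literal is denoted in moves, such as `P12^7` or `¬P12^7`. -/
def Literal.name : Literal → List Key
  | .pos P a => Key.latin 15 :: numeral P ++ Key.caret :: numeral a
  | .neg P a => Key.neg :: Key.latin 15 :: numeral P ++ Key.caret :: numeral a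

/-- The move `L.α`. -/
def Literal.move (L : Literal) (α : Move) : Move := L.name ++ Key.dot :: α

/-- The key for a choice. -/
def choiceKey (i : Bool) : Key := Key.digit (if i then 1 else 0)

/-- The labmove `⊥⊓ᶜ.i` (with `false` and `true` for `i = 0` and `i = 1`). -/
def chandLabmove (c : ℕ) (i : Bool) : Labmove :=
  (Player.environment, Key.chand :: Key.caret :: numeral c ++ [Key.dot, choiceKey i])

/-- The labmove `⊤⊔ᶜ.i`. -/
def chorLabmove (c : ℕ) (i : Bool) : Labmove :=
  (Player.machine, Key.chor :: Key.caret :: numeral c ++ [Key.dot, choiceKey i])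

/-- In-literal labmoves. -/
def InLiteral (x : Labmove) : Prop := ∃ (L : Literal) (α : Move), x.2 = L.move α

/-- Choice labmoves. -/
def IsChoice (x : Labmove) : Prop :=
  ∃ (c : ℕ) (i : Bool), x = chandLabmove c i ∨ x = chorLabmove c i

/-- The labmove `℘α`, when the given labmove is `℘L.α` (otherwise `none`). -/
noncomputable def Literal.strip (L : Literal) (x : Labmove) : Option Labmove :=
  open Classical in
  if h : ∃ α : Move, x.2 = L.move α then some (x.1, h.choose) else none

/-- The subrun of `Γ` that takes place in the copies of the literal `L`. -/
noncomputable def Run.inLit (Γ : Run) (L : Literal) : Run := sift L.strip Γ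

/-- The labmove `x` occurs in `Γ`. -/
def Run.Has (Γ : Run) (x : Labmove) : Prop := ∃ n : ℕ, Γ.get? n = some x

/-! ## Semantics -/

/-- An interpretation assigns a static game to every letter. -/
structure Interpretation where
  letter : ℕ → Game
  isStatic : ∀ P : ℕ, (letter P).Static

/-- The game assigned to a literal. -/
def Interpretation.lit (I : Interpretation) : Literal → Game
  | .pos P _ => I.letter P
  | .neg P _ => (I.letter P).neg

/-- The legal runs of (any cirquent under) an interpretation. -/
def Interpretation.LegalRun (I : Interpretation) (Γ : Run) : Prop :=
  (∀ x : Labmove, Γ.Has x → InLiteral x ∨ IsChoice x) ∧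
  (∀ L : Literal, Γ.inLit L ∈ (I.lit L).legal) ∧
  (∀ (c : ℕ) (i j : Bool) (m n : ℕ),
    Γ.get? m = some (chandLabmove c i) → Γ.get? n = some (chandLabmove c j) → m = n) ∧
  (∀ (c : ℕ) (i j : Bool) (m n : ℕ),
    Γ.get? m = some (chorLabmove c i) → Γ.get? n = some (chorLabmove c j) → m = n)

/-- The (legal) run `Γ` of a cirquent is won by the machine. -/
def Cirquent.Won (I : Interpretation) (Γ : Run) : Cirquent → Prop
  | .top => True
  | .bot => False
  | .lit L => (I.lit L).win (Γ.inLit L) = Player.machine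
  | .and A B => A.Won I Γ ∧ B.Won I Γ
  | .or A B => A.Won I Γ ∨ B.Won I Γ
  | .chand c A B =>
      (Γ.Has (chandLabmove c false) ∧ A.Won I Γ) ∨ (Γ.Has (chandLabmove c true) ∧ B.Won I Γ) ∨
        (¬ Γ.Has (chandLabmove c false) ∧ ¬ Γ.Has (chandLabmove c true))
  | .chor c A B =>
      (Γ.Has (chorLabmove c false) ∧ A.Won I Γ) ∨ (Γ.Has (chorLabmove c true) ∧ B.Won I Γ)

theorem get?_of_ofList_take {α : Type} {s : Stream'.Seq α} {t n : ℕ} {b : α}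
    (h : (Stream'.Seq.ofList (s.take t)).get? n = some b) : s.get? n = some b := by
  rw [Stream'.Seq.ofList_get?, Stream'.Seq.getElem?_take] at h
  split_ifs at h
  exact h

theorem get?_ofList_take {α : Type} {s : Stream'.Seq α} {t n : ℕ} (h : n < t) :
    (Stream'.Seq.ofList (s.take t)).get? n = s.get? n := by
  rw [Stream'.Seq.ofList_get?, Stream'.Seq.getElem?_take, if_pos h]

/-- The game that a cirquent denotes under an interpretation. -/
noncomputable def Cirquent.game (C : Cirquent) (I : Interpretation) : Game where
  legal := {Γ | I.LegalRun Γ}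
  win Γ := open Classical in if C.Won I Γ then Player.machine else Player.environment
  nonempty := by
    refine ⟨Stream'.Seq.ofList [], ?_, fun L => ?_, ?_, ?_⟩
    · rintro x ⟨n, hn⟩
      simp at hn
    · rw [Run.inLit, sift_ofList]
      exact Game.empty_legal _
    · intro c i j m n h
      simp at h
    · intro c i j m n h
      simp at h
  prefix_closed := by
    rintro Γ ⟨h1, h2, h3, h4⟩ n
    refine ⟨?_, fun L => Game.sift_take_legal _ _ _ _ (h2 L), ?_, ?_⟩
    · rintro x ⟨k, hk⟩
      exact h1 x ⟨k, get?_of_ofList_take hk⟩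
    · intro c i j k l hk hl
      exact h3 c i j k l (get?_of_ofList_take hk) (get?_of_ofList_take hl)
    · intro c i j k l hk hl
      exact h4 c i j k l (get?_of_ofList_take hk) (get?_of_ofList_take hl)
  limit_closed := by
    intro Γ _ h
    refine ⟨?_, fun L => Game.sift_legal _ _ _ fun n => (h n).2.1 L, ?_, ?_⟩
    · rintro x ⟨k, hk⟩
      exact (h (k + 1)).1 x ⟨k, by rw [get?_ofList_take (Nat.lt_succ_self k), hk]⟩
    · intro c i j k l hk hl
      refine (h (k + l + 1)).2.2.1 c i j k l ?_ ?_
      · rw [get?_ofList_take (by omega), hk]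
      · rw [get?_ofList_take (by omega), hl]
    · intro c i j k l hk hl
      refine (h (k + l + 1)).2.2.2 c i j k l ?_ ?_
      · rw [get?_ofList_take (by omega), hk]
      · rw [get?_ofList_take (by omega), hl]

/-- `H` is a logical solution of `C`: one machine that solves `C` under every interpretation. -/
def HPM.IsLogicalSolution (H : HPM) (C : Cirquent) : Prop :=
  ∀ I : Interpretation, H.Solves (C.game I)

/-- A cirquent is valid if it has a logical solution. -/
def Cirquent.Valid (C : Cirquent) : Prop := ∃ H : HPM, H.IsLogicalSolution C

/-! ## The calculus -/

/-- `S` is a subcirquent of the given cirquent (possibly the cirquent itself). -/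
def Cirquent.Occurs (S : Cirquent) : Cirquent → Prop
  | .top => S = .top
  | .bot => S = .bot
  | .lit L => S = .lit L
  | .or A B => S = .or A B ∨ S.Occurs A ∨ S.Occurs B
  | .and A B => S = .and A B ∨ S.Occurs A ∨ S.Occurs B
  | .chand c A B => S = .chand c A B ∨ S.Occurs A ∨ S.Occurs B
  | .chor c A B => S = .chor c A B ∨ S.Occurs A ∨ S.Occurs B

/-- The result of replacing in the cirquent `X` all occurrences of the subcirquent `S` by `T`. -/
def Cirquent.replace (X S T : Cirquent) : Cirquent :=
  if S = X then T
  else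
    match X with
    | .top => .top
    | .bot => .bot
    | .lit L => .lit L
    | .or A B => .or (A.replace S T) (B.replace S T)
    | .and A B => .and (A.replace S T) (B.replace S T)
    | .chand c A B => .chand c (A.replace S T) (B.replace S T)
    | .chor c A B => .chor c (A.replace S T) (B.replace S T)

/-- The result of replacing in a cirquent every subcirquent of the form `A ⊔ᶜ B` by `A` (if `i` is
`false`) or by `B` (if `i` is `true`), including those that are nested in one another. -/
def Cirquent.choose (c : ℕ) (i : Bool) : Cirquent → Cirquent
  | .top => .top
  | .bot => .bot
  | .lit L => .lit L
  | .or A B => .or (A.choose c i) (B.choose c i)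
  | .and A B => .and (A.choose c i) (B.choose c i)
  | .chand d A B => .chand d (A.choose c i) (B.choose c i)
  | .chor d A B =>
      if d = c then (if i then B.choose c i else A.choose c i)
      else .chor d (A.choose c i) (B.choose c i)

/-- The connective `⊓ᶜ` occurs in `C`. -/
def Cirquent.HasChand (c : ℕ) (C : Cirquent) : Prop := ∃ A B, (Cirquent.chand c A B).Occurs C

/-- The literal `L` occurs in `C`. -/
def Cirquent.HasLiteral (L : Literal) (C : Cirquent) : Prop := (Cirquent.lit L).Occurs C

/-- The letter `P` occurs in `C`. -/
def Cirquent.HasLetter (P : ℕ) (C : Cirquent) : Prop :=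
  ∃ a, C.HasLiteral (.pos P a) ∨ C.HasLiteral (.neg P a)

/-- `P` is a pseudoelementary letter of `C`: it occurs in `C`, and `C` contains at most one positive
and at most one negative `P`-lettered literal (each possibly with many occurrences). -/
def Cirquent.Pseudoelementary (P : ℕ) (C : Cirquent) : Prop :=
  C.HasLetter P ∧
  (∀ a b, C.HasLiteral (.pos P a) → C.HasLiteral (.pos P b) → a = b) ∧
  (∀ a b, C.HasLiteral (.neg P a) → C.HasLiteral (.neg P b) → a = b)

/-- `P` is a non-pseudoelementary letter of `C`. -/
def Cirquent.NonPseudoelementary (P : ℕ) (C : Cirquent) : Prop :=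
  C.HasLetter P ∧ ¬ C.Pseudoelementary P

open Cirquent in
/-- `Infers E F`: the cirquent `F` follows from the single premise `E` by a rule of CL18. The
conclusion `X` is displayed as `X` and the premise as the result of a replacement in `X`. -/
inductive Infers : Cirquent → Cirquent → Prop
  | porCommutativity (X A B : Cirquent) (h : (or A B).Occurs X) :
      Infers (X.replace (or A B) (or B A)) X
  | pandCommutativity (X A B : Cirquent) (h : (and A B).Occurs X) :
      Infers (X.replace (and A B) (and B A)) X
  | porAssociativity (X A B C : Cirquent) (h : (or (or A B) C).Occurs X) :
      Infers (X.replace (or (or A B) C) (or A (or B C))) X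
  | pandAssociativity (X A B C : Cirquent) (h : (and (and A B) C).Occurs X) :
      Infers (X.replace (and (and A B) C) (and A (and B C))) X
  | porIdentity (X A : Cirquent) (h : (or A bot).Occurs X) :
      Infers (X.replace (or A bot) A) X
  | pandIdentity (X A : Cirquent) (h : (and A top).Occurs X) :
      Infers (X.replace (and A top) A) X
  | porDomination (X A : Cirquent) (h : (or A top).Occurs X) :
      Infers (X.replace (or A top) top) X
  | pandDomination (X A : Cirquent) (h : (and A bot).Occurs X) :
      Infers (X.replace (and A bot) bot) X
  | pandDistribution (X A B C : Cirquent) (h : (or (and A B) C).Occurs X) :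
      Infers (X.replace (or (and A B) C) (and (or A C) (or B C))) X
  | chandDistribution (X A B C : Cirquent) (c : ℕ) (h : (or (chand c A B) C).Occurs X) :
      Infers (X.replace (or (chand c A B) C) (chand c (or A C) (or B C))) X
  | leftCleansing (X Y A B C : Cirquent) (c : ℕ) (hY : (chand c A B).Occurs Y)
      (hX : (chand c Y C).Occurs X) :
      Infers (X.replace (chand c Y C) (chand c (Y.replace (chand c A B) A) C)) X
  | rightCleansing (X Y A B C : Cirquent) (c : ℕ) (hY : (chand c A B).Occurs Y)
      (hX : (chand c C Y).Occurs X) :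
      Infers (X.replace (chand c C Y) (chand c C (Y.replace (chand c A B) B))) X
  | trivialization (X : Cirquent) (Q a b : ℕ)
      (h : (or (lit (.pos Q a)) (lit (.neg Q b))).Occurs X) (hQ : X.Pseudoelementary Q) :
      Infers (X.replace (or (lit (.pos Q a)) (lit (.neg Q b))) top) X
  | quadrilemma (X A B C D : Cirquent) (a b c : ℕ)
      (h : (and (chand a A B) (chand b C D)).Occurs X) (hc : ¬ X.HasChand c) :
      Infers
        (X.replace (and (chand a A B) (chand b C D))
          (chand c
            (chand a (and A (chand b C D)) (and B (chand b C D)))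
            (chand b (and (chand a A B) C) (and (chand a A B) D)))) X
  | leftChoosing (X : Cirquent) (c : ℕ) : Infers (X.choose c false) X
  | rightChoosing (X : Cirquent) (c : ℕ) : Infers (X.choose c true) X
  | matching (X : Cirquent) (P Q a b c d : ℕ) (ha : X.HasLiteral (.pos P a))
      (hb : X.HasLiteral (.neg P b)) (hP : X.NonPseudoelementary P) (hQ : ¬ X.HasLetter Q) :
      Infers
        ((X.replace (lit (.pos P a)) (lit (.pos Q c))).replace (lit (.neg P b)) (lit (.neg Q d))) X

/-- Provability in CL18: being the root of a finite tree of cirquents in which every leaf is `⊤` and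
every other node follows from its children by a rule. -/
inductive Provable : Cirquent → Prop
  | top : Provable .top
  | infer (E F : Cirquent) (hE : Provable E) (h : Infers E F) : Provable F
  | splitting (A B : Cirquent) (c : ℕ) (hA : Provable A) (hB : Provable B)
      (hcA : ¬ A.HasChand c) (hcB : ¬ B.HasChand c) : Provable (.chand c A B)

end CL18

/-!
# Soundness and completeness of CL18

Validity and provability of a cirquent `C` are both shown to be equivalent to a combinatorial
property, `Cirquent.Winnable`. A state of a play is abstracted to the choices `σ` of the
environment, the choices `τ` of the machine, and a set `μ` of matches: pairs of literals `P^a`,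
`¬P^b` that the machine plays against each other by copying moves, so that it wins at least one of
them. A state is safe when `C` evaluates to true under all values of the literals that respect `μ`
(`Cirquent.Taut`), where a choice `⊓` that has not been made counts as true and a choice `⊔` that
has not been made counts as false. `C` is winnable when, starting from the empty state, the machine
can always add choices and matches so as to be in a safe state, whatever further choices the
environment makes.

*Provable cirquents are winnable* (`Provable.winnable`). Every rule turns a way of winning the
premises into a way of winning the conclusion. Most rules merely replace a subcirquent by one whose
truth implies that of the former. Trivialization and matching add a match. In the quadrilemma the
choice in the new cluster is imagined to be made at the time of the first choice in `a` or `b`, in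
favour of the side where the other choice is still pending.

*Winnable cirquents are provable* (`Cirquent.Winnable.provable`), by induction on a rank. Let the
machine add the choices and matches that make the initial state safe. Its choices are carried out by
Left and Right Choosing (`Cirquent.provable_of_resolve`), and matched literals of a letter that is
not pseudoelementary are given a fresh letter by Matching
(`Cirquent.WinnableFrom.exists_pseudoelementary`). Then distribution, domination, identity,
trivialization and quadrilemma are applied, read from the conclusion to the premise, outside the
scope of choices; each of them preserves truth and lowers the rank (`Cirquent.Reducible`). When none
of them applies, the cirquent is `⊤`, or of the form `A ⊓^c B`, or can be refuted by values that
respect the matches (`Cirquent.irreducible_cases`); the last is impossible in a safe state, and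
`A ⊓^c B` is handled by cleansing and splitting.

*Valid cirquents are winnable* (`Cirquent.Valid.winnable`). A machine that wins under all
interpretations is made to play against environments that at once write into each literal the
literal's own name, and otherwise only make choices (`Cirquent.challenge`). If the machine has made
the name of `¬P^b` its first move in `P^a` and the other way around, it has matched the two. For any
values of the literals that respect these matches, the letters can be interpreted by games that
depend on the first moves only, and in which the machine wins a literal only if its value is true
(`Cirquent.adversary`). As the machine wins, `C` is true under these values.

*Winnable cirquents are valid* (`Cirquent.Winnable.valid`). A winning policy depends on the history
of the environment's choices only (`Cirquent.Strategy`), and there are finitely many histories, so a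
single machine can carry it in its finite control. The machine reads the run tape from left to
right, announces the choices prescribed by the strategy, and copies the moves of the environment
between matched literals. After a new choice it returns to the beginning of the tape and rescans the
part of the run that it has read, on behalf of the literals that have just been matched. What the
machine has copied is expressed by `Cirquent.Strategy.Progress`, and that every labmove is processed
at some time follows from `exists_lt_of_advances`. Up to a delay, the runs in two matched literals
are the same run seen by the two players, and thus staticity of the games shows that the copied moves
are legal (`legal_copy`) and that the machine wins one of the two literals (`Copies.win`).
-/

namespace CL18

/-! ### Truth of a cirquent at given choices and literal values -/

/-- The truth value of a cirquent when `σ` lists the choices made by the environment, `τ` those made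
by the machine, and `v` says which literals are won by the machine. -/
def Cirquent.eval (σ τ : ℕ → Option Bool) (v : Literal → Prop) : Cirquent → Prop
  | .top => True
  | .bot => False
  | .lit L => v L
  | .or A B => A.eval σ τ v ∨ B.eval σ τ v
  | .and A B => A.eval σ τ v ∧ B.eval σ τ v
  | .chand c A B => (σ c = some false → A.eval σ τ v) ∧ (σ c = some true → B.eval σ τ v)
  | .chor c A B => (τ c = some false ∧ A.eval σ τ v) ∨ (τ c = some true ∧ B.eval σ τ v)

namespace Cirquent

theorem occurs_self (X : Cirquent) : X.Occurs X := by
  cases X <;> simp [Occurs]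

theorem occurs_trans {S T X : Cirquent} (h : S.Occurs T) (h' : T.Occurs X) : S.Occurs X := by
  induction X with
  | top | bot | lit => simp only [Occurs] at h'; subst h'; exact h
  | or A B ihA ihB | and A B ihA ihB | chand c A B ihA ihB | chor c A B ihA ihB =>
    rcases h' with rfl | h' | h'
    · exact h
    · exact Or.inr (Or.inl (ihA h'))
    · exact Or.inr (Or.inr (ihB h'))

theorem replace_self (S T : Cirquent) : S.replace S T = T := by
  rw [replace.eq_def]; simp

/-- To relate the results of replacement it suffices to relate what replaces the subcirquent, given
that the relation is reflexive at atoms and respected by the connectives. -/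
theorem replace_rel {R : Cirquent → Cirquent → Prop} {S T : Cirquent} (hST : R S T)
    (htop : R top top) (hbot : R bot bot) (hlit : ∀ L, R (lit L) (lit L))
    (hor : ∀ {A B A' B'}, R A A' → R B B' → R (or A B) (or A' B'))
    (hand : ∀ {A B A' B'}, R A A' → R B B' → R (and A B) (and A' B'))
    (hchand : ∀ {c A B A' B'}, R A A' → R B B' → R (chand c A B) (chand c A' B'))
    (hchor : ∀ {c A B A' B'}, R A A' → R B B' → R (chor c A B) (chor c A' B'))
    (X : Cirquent) : R X (X.replace S T) := by
  induction X with
  | top | bot =>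
    rw [replace.eq_def]; split_ifs with h
    · exact h ▸ hST
    · assumption
  | lit L =>
    rw [replace.eq_def]; split_ifs with h
    · exact h ▸ hST
    · exact hlit L
  | or A B ihA ihB | and A B ihA ihB | chand c A B ihA ihB | chor c A B ihA ihB =>
    rw [replace.eq_def]; split_ifs with h
    · exact h ▸ hST
    · first
        | exact hor ihA ihB
        | exact hand ihA ihB
        | exact hchand ihA ihB
        | exact hchor ihA ihB

variable {σ τ : ℕ → Option Bool} {v : Literal → Prop}

theorem eval_replace_mono {S T : Cirquent} (h : S.eval σ τ v → T.eval σ τ v) (X : Cirquent) :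
    X.eval σ τ v → (X.replace S T).eval σ τ v := by
  refine replace_rel (R := fun A B => A.eval σ τ v → B.eval σ τ v) h id id (fun _ => id)
    ?_ ?_ ?_ ?_ X <;> intros <;> simp only [eval] at * <;> tauto

theorem eval_replace_mono' {S T : Cirquent} (h : T.eval σ τ v → S.eval σ τ v) (X : Cirquent) :
    (X.replace S T).eval σ τ v → X.eval σ τ v := by
  refine replace_rel (R := fun A B => B.eval σ τ v → A.eval σ τ v) h id id (fun _ => id)
    ?_ ?_ ?_ ?_ X <;> intros <;> simp only [eval] at * <;> tauto

theorem eval_replace {S T : Cirquent} (h : S.eval σ τ v ↔ T.eval σ τ v) (X : Cirquent) :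
    (X.replace S T).eval σ τ v ↔ X.eval σ τ v :=
  ⟨eval_replace_mono' h.2 X, eval_replace_mono h.1 X⟩

theorem eval_mono {v' : Literal → Prop} (X : Cirquent)
    (hv : ∀ L, X.HasLiteral L → v L → v' L) : X.eval σ τ v → X.eval σ τ v' := by
  unfold HasLiteral at hv
  induction X with
  | top | bot => exact id
  | lit L => exact hv L (by simp [Occurs])
  | or A B ihA ihB | and A B ihA ihB | chand c A B ihA ihB | chor c A B ihA ihB =>
    have hA := ihA fun L hL => hv L (Or.inr (Or.inl hL))
    have hB := ihB fun L hL => hv L (Or.inr (Or.inr hL))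
    simp only [eval]
    tauto

theorem eval_congr_chand {σ' : ℕ → Option Bool} (X : Cirquent)
    (hσ : ∀ c, X.HasChand c → σ c = σ' c) : X.eval σ τ v ↔ X.eval σ' τ v := by
  unfold HasChand at hσ
  induction X with
  | top | bot | lit => exact Iff.rfl
  | or A B ihA ihB | and A B ihA ihB | chor c A B ihA ihB =>
    have hA := ihA fun c ⟨S, T, hL⟩ => hσ c ⟨S, T, Or.inr (Or.inl hL)⟩
    have hB := ihB fun c ⟨S, T, hL⟩ => hσ c ⟨S, T, Or.inr (Or.inr hL)⟩
    simp only [eval, hA, hB]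
  | chand c A B ihA ihB =>
    have hA := ihA fun c ⟨S, T, hL⟩ => hσ c ⟨S, T, Or.inr (Or.inl hL)⟩
    have hB := ihB fun c ⟨S, T, hL⟩ => hσ c ⟨S, T, Or.inr (Or.inr hL)⟩
    have hc := hσ c ⟨A, B, Or.inl rfl⟩
    simp only [eval, hc, hA, hB]

theorem eval_choose (X : Cirquent) (c : ℕ) (i : Bool) :
    (X.choose c i).eval σ τ v ↔ X.eval σ (Function.update τ c (some i)) v := by
  induction X with
  | top | bot | lit => exact Iff.rfl
  | or A B ihA ihB | and A B ihA ihB | chand d A B ihA ihB =>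
    simp only [choose, eval, ihA, ihB]
  | chor d A B ihA ihB =>
    simp only [choose, eval]
    by_cases h : d = c
    · subst h
      cases i <;> simp [ihA, ihB]
    · rw [if_neg h]
      simp only [eval, Function.update_of_ne h, ihA, ihB]

/-- Literals are renamed by changing the valuation, provided that the renamed literal does not
occur after the replacement. -/
theorem eval_replace_lit {L M : Literal} {v' : Literal → Prop} (X : Cirquent)
    (hL : v L ↔ v' M) (hv : ∀ K, K ≠ L → X.HasLiteral K → (v K ↔ v' K)) :
    X.eval σ τ v ↔ (X.replace (lit L) (lit M)).eval σ τ v' := by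
  unfold HasLiteral at hv
  induction X with
  | top | bot => simp [replace, eval]
  | lit K =>
    rw [replace]
    by_cases h : K = L
    · subst h; simp [eval, hL]
    · have : ¬ lit L = lit K := fun h' => h (by injection h' with h'; exact h'.symm)
      simp only [this, if_false, eval]
      exact hv K h (by simp [Occurs])
  | or A B ihA ihB | and A B ihA ihB | chand d A B ihA ihB | chor d A B ihA ihB =>
    have hA := ihA fun K h hK => hv K h (Or.inr (Or.inl hK))
    have hB := ihB fun K h hK => hv K h (Or.inr (Or.inr hK))
    rw [replace]
    simp only [reduceCtorEq, if_false, eval, hA, hB]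

theorem hasLiteral_replace_lit {L M K : Literal} (X : Cirquent) :
    (X.replace (lit L) (lit M)).HasLiteral K →
      (K = M ∧ X.HasLiteral L) ∨ (K ≠ L ∧ X.HasLiteral K) := by
  unfold HasLiteral
  induction X with
  | top | bot => simp [replace, Occurs]
  | lit N =>
    rw [replace]
    by_cases h : N = L
    · subst h; simp [Occurs]
    · have : ¬ lit L = lit N := fun h' => h (by injection h' with h'; exact h'.symm)
      simp only [this, if_false, Occurs, lit.injEq]
      rintro rfl; exact Or.inr ⟨h, rfl⟩
  | or A B ihA ihB | and A B ihA ihB | chand d A B ihA ihB | chor d A B ihA ihB =>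
    rw [replace]
    simp only [reduceCtorEq, if_false, Occurs, false_or]
    tauto

theorem hasLiteral_replace_lit_of {L M K : Literal} (X : Cirquent)
    (h : (K = M ∧ X.HasLiteral L) ∨ (K ≠ L ∧ X.HasLiteral K)) :
    (X.replace (lit L) (lit M)).HasLiteral K := by
  unfold HasLiteral at *
  induction X with
  | top | bot => simp [Occurs] at h
  | lit N =>
    rw [replace]
    simp only [Occurs, lit.injEq] at h ⊢
    by_cases h' : L = N
    · subst h'
      rw [if_pos rfl]
      simp only [Occurs, lit.injEq]
      tauto
    · rw [if_neg h']
      simp only [Occurs, lit.injEq]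
      tauto
  | or A B ihA ihB | and A B ihA ihB | chand d A B ihA ihB | chor d A B ihA ihB =>
    rw [replace]
    simp only [reduceCtorEq, if_false, Occurs, false_or] at h ⊢
    tauto

end Cirquent

/-! ### Winnability -/

/-- The values of literals `v` respect the matches `μ`, a set of triples `(P, a, b)` saying that the
machine plays `P^a` against `¬P^b` by copying moves; so it wins at least one of the two. -/
def Compat (μ : Set (ℕ × ℕ × ℕ)) (v : Literal → Prop) : Prop :=
  ∀ P a b, (P, a, b) ∈ μ → v (.pos P a) ∨ v (.neg P b)

/-- Every literal is matched with at most one other literal. -/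
def IsMatching (μ : Set (ℕ × ℕ × ℕ)) : Prop :=
  ∀ P a b a' b', (P, a, b) ∈ μ → (P, a', b') ∈ μ → (a = a' ↔ b = b')

/-- What matters about a position of a play: the choices `σ` made by the environment, the choices
`τ` made by the machine, and the literals `μ` matched by the machine. -/
structure GameState where
  σ : ℕ → Option Bool
  τ : ℕ → Option Bool
  μ : Set (ℕ × ℕ × ℕ)

/-- The state before any choices and matches have been made. -/
def GameState.start : GameState := ⟨fun _ => none, fun _ => none, ∅⟩

/-- `τ'` makes all the choices that `τ` makes. -/
def ChoiceLE (τ τ' : ℕ → Option Bool) : Prop := ∀ c i, τ c = some i → τ' c = some i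

theorem ChoiceLE.refl (τ : ℕ → Option Bool) : ChoiceLE τ τ := fun _ _ => id

theorem ChoiceLE.trans {τ τ' τ'' : ℕ → Option Bool} (h : ChoiceLE τ τ') (h' : ChoiceLE τ' τ'') :
    ChoiceLE τ τ'' := fun c i hc => h' c i (h c i hc)

/-- At the state `s` the cirquent is true whatever the outcome of the play in the literals. -/
def Cirquent.Taut (C : Cirquent) (s : GameState) : Prop :=
  ∀ v, Compat s.μ v → C.eval s.σ s.τ v

/-- In every state belonging to `W` the machine can add choices and matches so that the cirquent
becomes true, and remain in `W` after any further choice made by the environment. -/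
def Cirquent.Good (C : Cirquent) (W : Set GameState) : Prop :=
  ∀ s ∈ W, ∃ τ' μ', ChoiceLE s.τ τ' ∧ s.μ ⊆ μ' ∧ IsMatching μ' ∧ C.Taut ⟨s.σ, τ', μ'⟩ ∧
    ∀ c i, s.σ c = none → (⟨Function.update s.σ c (some i), τ', μ'⟩ : GameState) ∈ W

/-- The machine can keep the cirquent true by making choices and matching literals. -/
def Cirquent.Winnable (C : Cirquent) : Prop := ∃ W, C.Good W ∧ GameState.start ∈ W

theorem Cirquent.Winnable.mono {X Y : Cirquent}
    (h : ∀ σ τ v, X.eval σ τ v → Y.eval σ τ v) (hX : X.Winnable) : Y.Winnable := by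
  obtain ⟨W, hW, h0⟩ := hX
  refine ⟨W, fun s hs => ?_, h0⟩
  obtain ⟨τ', μ', h1, h2, h3, h4, h5⟩ := hW s hs
  exact ⟨τ', μ', h1, h2, h3, fun v hv => h _ _ _ (h4 v hv), h5⟩

/-- Values of literals that do not occur in the cirquent are irrelevant, so matches that involve
such literals may be dropped. -/
theorem Cirquent.Taut.of_occurring {C : Cirquent} {s : GameState} (h : C.Taut s)
    {v : Literal → Prop}
    (hv : ∀ P a b, (P, a, b) ∈ s.μ → C.HasLiteral (.pos P a) → C.HasLiteral (.neg P b) →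
      v (.pos P a) ∨ v (.neg P b)) : C.eval s.σ s.τ v := by
  have := h (fun L => C.HasLiteral L → v L) (fun P a b hm => by
    have := hv P a b hm
    by_cases h1 : C.HasLiteral (.pos P a) <;> by_cases h2 : C.HasLiteral (.neg P b) <;> tauto)
  exact Cirquent.eval_mono C (fun L hL h => h hL) this


/-! ### Provable cirquents are winnable -/

namespace Cirquent

theorem hasLiteral_replace {S T : Cirquent} {L : Literal} (h : T.HasLiteral L → S.HasLiteral L)
    (X : Cirquent) : (X.replace S T).HasLiteral L → X.HasLiteral L := by
  unfold HasLiteral at *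
  refine replace_rel (R := fun A B => (lit L).Occurs B → (lit L).Occurs A) h id id (fun _ => id)
    ?_ ?_ ?_ ?_ X <;> intros <;> simp only [Occurs, reduceCtorEq, false_or] at * <;> tauto

theorem eval_leftCleansing {σ τ : ℕ → Option Bool} {v : Literal → Prop} (Y A B C : Cirquent)
    (c : ℕ) : (chand c Y C).eval σ τ v ↔
      (chand c (Y.replace (chand c A B) A) C).eval σ τ v := by
  simp only [eval]
  refine and_congr_left fun _ => imp_congr_right fun h => (eval_replace ?_ Y).symm
  simp [eval, h]

theorem eval_rightCleansing {σ τ : ℕ → Option Bool} {v : Literal → Prop} (Y A B C : Cirquent)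
    (c : ℕ) : (chand c C Y).eval σ τ v ↔
      (chand c C (Y.replace (chand c A B) B)).eval σ τ v := by
  simp only [eval]
  refine and_congr_right fun _ => imp_congr_right fun h => (eval_replace ?_ Y).symm
  simp [eval, h]

/-- One may assume that the states reached by the responses of the machine belong to the set. -/
theorem Winnable.exists_good {X : Cirquent} (hX : X.Winnable) :
    ∃ W : Set GameState, GameState.start ∈ W ∧
      ∀ s ∈ W, ∃ τ' μ', ChoiceLE s.τ τ' ∧ s.μ ⊆ μ' ∧ IsMatching μ' ∧ X.Taut ⟨s.σ, τ', μ'⟩ ∧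
        ⟨s.σ, τ', μ'⟩ ∈ W ∧
        ∀ c i, s.σ c = none → (⟨Function.update s.σ c (some i), τ', μ'⟩ : GameState) ∈ W := by
  obtain ⟨W, hW, h0⟩ := hX
  refine ⟨{s | s ∈ W ∨ (IsMatching s.μ ∧ X.Taut s ∧ ∀ c i, s.σ c = none →
    (⟨Function.update s.σ c (some i), s.τ, s.μ⟩ : GameState) ∈ W)}, Or.inl h0, ?_⟩
  rintro s (hs | ⟨h1, h2, h3⟩)
  · obtain ⟨τ', μ', h1, h2, h3, h4, h5⟩ := hW s hs
    exact ⟨τ', μ', h1, h2, h3, h4, Or.inr ⟨h3, h4, h5⟩, fun c i h => Or.inl (h5 c i h)⟩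
  · exact ⟨s.τ, s.μ, ChoiceLE.refl _, subset_rfl, h1, h2, Or.inr ⟨h1, h2, h3⟩,
      fun c i h => Or.inl (h3 c i h)⟩

/-- The machine matches `Q^a` and `¬Q^b`. No other literals of the letter `Q` occur in the conclusion,
so that other matches of this letter can be dropped. -/
theorem winnable_of_trivialization {X : Cirquent} {Q a b : ℕ}
    (h : (or (lit (.pos Q a)) (lit (.neg Q b))).Occurs X) (hQ : X.Pseudoelementary Q)
    (hX : (X.replace (or (lit (.pos Q a)) (lit (.neg Q b))) top).Winnable) : X.Winnable := by
  obtain ⟨W, hW, h0⟩ := hX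
  have hlit : ∀ L, (X.replace (or (lit (.pos Q a)) (lit (.neg Q b))) top).HasLiteral L →
      X.HasLiteral L := fun L => hasLiteral_replace (fun h => by simp [HasLiteral, Occurs] at h) X
  have ha : X.HasLiteral (.pos Q a) := occurs_trans (by simp [Occurs]) h
  have hb : X.HasLiteral (.neg Q b) := occurs_trans (by simp [Occurs]) h
  let tr : Set (ℕ × ℕ × ℕ) → Set (ℕ × ℕ × ℕ) := fun μ => {t | (t ∈ μ ∧ t.1 ≠ Q) ∨ t = (Q, a, b)}
  have htr : ∀ μ μ', μ ⊆ μ' → tr μ ⊆ tr μ' := fun μ μ' h t ht =>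
    ht.imp (fun ht => ⟨h ht.1, ht.2⟩) id
  refine ⟨{s | ∃ μ, ⟨s.σ, s.τ, μ⟩ ∈ W ∧ s.μ ⊆ tr μ}, ?_, ∅, h0, by simp [GameState.start]⟩
  rintro s ⟨μ, hs, hμ⟩
  obtain ⟨τ', μ', h1, h2, h3, h4, h5⟩ := hW _ hs
  refine ⟨τ', tr μ', h1, hμ.trans (htr _ _ h2), ?_, fun v hv => ?_,
    fun c i hc => ⟨μ', h5 c i hc, subset_rfl⟩⟩
  · rintro P x y x' y' (⟨hx, hxQ⟩ | hx) (⟨hy, hyQ⟩ | hy)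
    · exact h3 P x y x' y' hx hy
    all_goals simp_all
  · have hab : v (.pos Q a) ∨ v (.neg Q b) := hv Q a b (Or.inr rfl)
    refine (eval_replace (S := or (lit (.pos Q a)) (lit (.neg Q b))) (T := top) ?_ X).1
      (h4.of_occurring ?_)
    · simpa [eval] using hab
    · intro P x y hm hx hy
      by_cases hP : P = Q
      · subst hP
        rw [hQ.2.1 x a (hlit _ hx) ha, hQ.2.2 y b (hlit _ hy) hb]
        exact hab
      · exact hv P x y (Or.inl ⟨hm, hP⟩)

/-- The environment is imagined to choose `i = 0` in the new cluster `c` as soon as it chooses in `a`,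
and `i = 1` as soon as it chooses in `b`, whichever happens first. -/
theorem winnable_of_quadrilemma {X A B C D : Cirquent} {a b c : ℕ}
    (h : (and (chand a A B) (chand b C D)).Occurs X) (hc : ¬ X.HasChand c)
    (hX : (X.replace (and (chand a A B) (chand b C D))
          (chand c
            (chand a (and A (chand b C D)) (and B (chand b C D)))
            (chand b (and (chand a A B) C) (and (chand a A B) D)))).Winnable) : X.Winnable := by
  obtain ⟨W, h0, hW⟩ := hX.exists_good
  have hca : a ≠ c := by
    rintro rfl; exact hc ⟨A, B, occurs_trans (by simp [Occurs]) h⟩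
  have hcb : b ≠ c := by
    rintro rfl; exact hc ⟨C, D, occurs_trans (by simp [Occurs]) h⟩
  refine ⟨{s | ∃ s0 ∈ W, ChoiceLE s.τ s0.τ ∧ s.μ ⊆ s0.μ ∧ (∀ d, d ≠ c → s0.σ d = s.σ d) ∧
    ((s0.σ c = none ∧ s.σ a = none ∧ s.σ b = none) ∨ (s0.σ c = some false ∧ s.σ a ≠ none) ∨
      (s0.σ c = some true ∧ s.σ b ≠ none))}, ?_, _, h0, ChoiceLE.refl _, subset_rfl,
      by simp [GameState.start]⟩
  rintro s ⟨s0, hs, hτ, hμ, hσ, hσc⟩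
  obtain ⟨τ', μ', h1, h2, h3, h4, h5, h6⟩ := hW _ hs
  refine ⟨τ', μ', hτ.trans h1, hμ.trans h2, h3, fun v hv => ?_, fun d i hd => ?_⟩
  · refine (eval_congr_chand (σ := s0.σ) X fun d hd => hσ d fun h => hc (h ▸ hd)).1 ?_
    refine eval_replace_mono' ?_ X (h4 v hv)
    have ha' := hσ a hca
    have hb' := hσ b hcb
    rcases hσc with ⟨hc0, ha, hb⟩ | ⟨hc0, ha⟩ | ⟨hc0, hb⟩
    · simp [eval, ha', hb', ha, hb]
    · rcases hx : s.σ a with _ | _ | _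
      · exact absurd hx ha
      all_goals simp [eval, hc0, ha', hx]; try tauto
    · rcases hx : s.σ b with _ | _ | _
      · exact absurd hx hb
      all_goals simp [eval, hc0, hb', hx]; try tauto
  · by_cases hdc : d = c
    · subst hdc
      refine ⟨_, h5, ChoiceLE.refl _, subset_rfl,
        fun e he => by simp [Function.update_of_ne he, hσ e he], ?_⟩
      simpa [Function.update_of_ne hca, Function.update_of_ne hcb] using hσc
    have hd' : s0.σ d = none := (hσ d hdc).trans hd
    have hcd : c ≠ d := fun h => hdc h.symm
    have hupd : ∀ e, s.σ e ≠ none → Function.update s.σ d (some i) e ≠ none := fun e he => by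
      have : e ≠ d := by rintro rfl; exact he hd
      simpa [Function.update_of_ne this] using he
    by_cases hnew : s0.σ c = none ∧ (d = a ∨ d = b)
    · -- The first choice in either of the clusters `a` and `b` decides which choice in the
      -- cluster `c` to imagine.
      obtain ⟨hc0, hab⟩ := hnew
      obtain ⟨τ'', μ'', g1, g2, g3, g4, g5, g6⟩ := hW _ (h6 c (decide (d ≠ a)) hc0)
      refine ⟨_, g6 d i (by simpa [Function.update_of_ne hdc] using hd'), g1, g2, fun e he => ?_, ?_⟩
      · by_cases hed : e = d
        · subst hed; simp
        · simp [Function.update_of_ne hed, Function.update_of_ne he, hσ e he]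
      · simp only [Function.update_of_ne hcd, Function.update_self]
        by_cases hda : d = a
        · subst hda; simp
        · have : d = b := by tauto
          subst this; simp [hda]
    · refine ⟨_, h6 d i hd', ChoiceLE.refl _, subset_rfl, fun e he => ?_, ?_⟩
      · by_cases hed : e = d
        · subst hed; simp
        · simp [Function.update_of_ne hed, hσ e he]
      · simp only [Function.update_of_ne hcd]
        rcases hσc with ⟨hc0, ha, hb⟩ | ⟨hc0, ha⟩ | ⟨hc0, hb⟩
        · have hab : a ≠ d ∧ b ≠ d :=
            ⟨fun h => hnew ⟨hc0, Or.inl h.symm⟩, fun h => hnew ⟨hc0, Or.inr h.symm⟩⟩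
          exact Or.inl ⟨hc0, by simp [Function.update_of_ne hab.1, ha],
            by simp [Function.update_of_ne hab.2, hb]⟩
        · exact Or.inr (Or.inl ⟨hc0, hupd a ha⟩)
        · exact Or.inr (Or.inr ⟨hc0, hupd b hb⟩)

/-- The machine makes the choice `i` in the cluster `c` together with its first response. -/
theorem winnable_of_choose {X : Cirquent} {c : ℕ} {i : Bool} (hX : (X.choose c i).Winnable) :
    X.Winnable := by
  obtain ⟨W, hW, h0⟩ := hX
  refine ⟨{s | ∃ τ, ⟨s.σ, τ, s.μ⟩ ∈ W ∧ ChoiceLE s.τ (Function.update τ c (some i))}, ?_, _, h0,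
    fun _ _ h => by simp [GameState.start] at h⟩
  rintro s ⟨τ, hs, hτ⟩
  obtain ⟨τ', μ', h1, h2, h3, h4, h5⟩ := hW _ hs
  refine ⟨Function.update τ' c (some i), μ', hτ.trans fun d j => ?_, h2, h3,
    fun v hv => (eval_choose X c i).1 (h4 v hv), fun d j hd => ⟨τ', h5 d j hd, ChoiceLE.refl _⟩⟩
  by_cases hd : d = c
  · subst hd; simp
  · simpa [Function.update_of_ne hd] using h1 d j

/-- The machine waits for the choice of the environment in the cluster `c`, and meanwhile follows, in
thought, the plays of both `A` and `B`. -/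
theorem winnable_splitting {A B : Cirquent} {c : ℕ} (hA : A.Winnable) (hB : B.Winnable)
    (hcA : ¬ A.HasChand c) (hcB : ¬ B.HasChand c) : (chand c A B).Winnable := by
  obtain ⟨WA, hWA, h0A⟩ := hA
  obtain ⟨WB, hWB, h0B⟩ := hB
  let R : Set GameState → GameState → Prop := fun W s => ∃ s0 ∈ W,
    (∀ d, d ≠ c → s0.σ d = s.σ d) ∧ ChoiceLE s.τ s0.τ ∧ s.μ ⊆ s0.μ
  -- Once the environment has chosen, the play continues as in the chosen cirquent.
  have step : ∀ (E : Cirquent) (W : Set GameState), E.Good W → ¬ E.HasChand c →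
      ∀ s, R W s → ∃ τ' μ', ChoiceLE s.τ τ' ∧ s.μ ⊆ μ' ∧ IsMatching μ' ∧ E.Taut ⟨s.σ, τ', μ'⟩ ∧
      ∀ d i, d ≠ c → s.σ d = none →
        ∀ τ μ, ChoiceLE τ τ' → μ ⊆ μ' → R W ⟨Function.update s.σ d (some i), τ, μ⟩ := by
    rintro E W hW hE s ⟨s0, hs0, hσ, hτ, hμ⟩
    obtain ⟨τ', μ', h1, h2, h3, h4, h5⟩ := hW _ hs0
    refine ⟨τ', μ', hτ.trans h1, hμ.trans h2, h3, fun v hv => ?_, fun d i hdc hd τ μ hτ hμ => ?_⟩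
    · exact (eval_congr_chand E fun d hd => hσ d fun h => hE (h ▸ hd)).1 (h4 v hv)
    · refine ⟨_, h5 d i ((hσ d hdc).trans hd), fun e he => ?_, hτ, hμ⟩
      by_cases hed : e = d
      · subst hed; simp
      · simp [Function.update_of_ne hed, hσ e he]
  refine ⟨{s | (s.σ c = none ∧ s.τ = (fun _ => none) ∧ s.μ = ∅ ∧ R WA s ∧ R WB s) ∨
    (s.σ c = some false ∧ R WA s) ∨ (s.σ c = some true ∧ R WB s)}, ?_, Or.inl ⟨rfl, rfl, rfl,
    ⟨_, h0A, fun _ _ => rfl, ChoiceLE.refl _, subset_rfl⟩,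
    ⟨_, h0B, fun _ _ => rfl, ChoiceLE.refl _, subset_rfl⟩⟩⟩
  rintro s (⟨hc, hτ, hμ, hA, hB⟩ | ⟨hc, hA⟩ | ⟨hc, hB⟩)
  · obtain ⟨τA, μA, h1, h2, h3, h4, h5⟩ := step A WA hWA hcA s hA
    obtain ⟨τB, μB, g1, g2, g3, g4, g5⟩ := step B WB hWB hcB s hB
    refine ⟨s.τ, s.μ, ChoiceLE.refl _, subset_rfl, by simp [hμ, IsMatching],
      fun v _ => by simp [eval, hc], fun d i hd => ?_⟩
    by_cases hdc : d = c
    · subst hdc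
      right
      have hR : ∀ W, R W s → R W ⟨Function.update s.σ d (some i), s.τ, s.μ⟩ := by
        rintro W ⟨s0, h, h1, h2⟩
        exact ⟨s0, h, fun e he => by simp [Function.update_of_ne he, h1 e he], h2⟩
      cases i
      · exact Or.inl ⟨by simp, hR _ hA⟩
      · exact Or.inr ⟨by simp, hR _ hB⟩
    · refine Or.inl ⟨by simp [Function.update_of_ne (Ne.symm hdc), hc], hτ, hμ,
        h5 d i hdc hd _ _ h1 h2, g5 d i hdc hd _ _ g1 g2⟩
  · obtain ⟨τA, μA, h1, h2, h3, h4, h5⟩ := step A WA hWA hcA s hA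
    refine ⟨τA, μA, h1, h2, h3, fun v hv => ?_, fun d i hd => ?_⟩
    · simpa [eval, hc] using h4 v hv
    · have hdc : d ≠ c := by rintro rfl; simp [hd] at hc
      exact Or.inr (Or.inl ⟨by simp [Function.update_of_ne (Ne.symm hdc), hc],
        h5 d i hdc hd _ _ (ChoiceLE.refl _) subset_rfl⟩)
  · obtain ⟨τA, μA, h1, h2, h3, h4, h5⟩ := step B WB hWB hcB s hB
    refine ⟨τA, μA, h1, h2, h3, fun v hv => ?_, fun d i hd => ?_⟩
    · simpa [eval, hc] using h4 v hv
    · have hdc : d ≠ c := by rintro rfl; simp [hd] at hc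
      exact Or.inr (Or.inr ⟨by simp [Function.update_of_ne (Ne.symm hdc), hc],
        h5 d i hdc hd _ _ (ChoiceLE.refl _) subset_rfl⟩)

/-- The machine matches `P^a` and `¬P^b`, and drops all other matches of these two literals. -/
theorem winnable_of_matching {X : Cirquent} {P Q a b c d : ℕ} (ha : X.HasLiteral (.pos P a))
    (hQ : ¬ X.HasLetter Q)
    (hX : ((X.replace (lit (.pos P a)) (lit (.pos Q c))).replace
      (lit (.neg P b)) (lit (.neg Q d))).Winnable) : X.Winnable := by
  obtain ⟨W, hW, h0⟩ := hX
  have hPQ : P ≠ Q := by rintro rfl; exact hQ ⟨a, Or.inl ha⟩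
  let tr : Set (ℕ × ℕ × ℕ) → Set (ℕ × ℕ × ℕ) := fun μ =>
    {t | (t ∈ μ ∧ (t.1 = P → t.2.1 ≠ a ∧ t.2.2 ≠ b)) ∨ t = (P, a, b)}
  have htr : ∀ μ μ', μ ⊆ μ' → tr μ ⊆ tr μ' := fun μ μ' h t ht =>
    ht.imp (fun ht => ⟨h ht.1, ht.2⟩) id
  refine ⟨{s | ∃ μ, ⟨s.σ, s.τ, μ⟩ ∈ W ∧ s.μ ⊆ tr μ}, ?_, ∅, h0, by simp [GameState.start]⟩
  rintro s ⟨μ, hs, hμ⟩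
  obtain ⟨τ', μ', h1, h2, h3, h4, h5⟩ := hW _ hs
  refine ⟨τ', tr μ', h1, hμ.trans (htr _ _ h2), ?_, fun v hv => ?_,
    fun c i hc => ⟨μ', h5 c i hc, subset_rfl⟩⟩
  · rintro R x y x' y' (⟨hx, hxQ⟩ | hx) (⟨hy, hyQ⟩ | hy)
    · exact h3 R x y x' y' hx hy
    · obtain ⟨rfl, rfl, rfl⟩ := by simpa using hy
      have := hxQ rfl
      exact iff_of_false this.1 this.2
    · obtain ⟨rfl, rfl, rfl⟩ := by simpa using hx
      have := hyQ rfl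
      exact iff_of_false this.1.symm this.2.symm
    · simp_all
  · have hab : v (.pos P a) ∨ v (.neg P b) := hv P a b (Or.inr rfl)
    let v' : Literal → Prop
      | .pos R x => if R = Q then v (.pos P a) else v (.pos R x)
      | .neg R x => if R = Q then v (.neg P b) else v (.neg R x)
    have hv' : ∀ K, X.HasLiteral K → (v K ↔ v' K) := by
      rintro (⟨R, x⟩ | ⟨R, x⟩) hK
      · have : R ≠ Q := by rintro rfl; exact hQ ⟨x, Or.inl hK⟩
        simp [v', this]
      · have : R ≠ Q := by rintro rfl; exact hQ ⟨x, Or.inr hK⟩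
        simp [v', this]
    rw [eval_replace_lit (L := .pos P a) (M := .pos Q c) (v' := v') X (by simp [v'])
      (fun K _ hK => hv' K hK), eval_replace_lit (L := .neg P b) (M := .neg Q d) (v' := v') _
      (by simp [v']) (fun _ _ _ => Iff.rfl)]
    refine h4.of_occurring fun R x y hm hx hy => ?_
    by_cases hR : R = Q
    · simpa [v', hR] using hab
    · simp only [v', hR, if_false]
      refine hv R x y (Or.inl ⟨hm, ?_⟩)
      rintro rfl
      constructor
      · rintro rfl
        rcases hasLiteral_replace_lit _ hx with ⟨h, _⟩ | ⟨_, hx⟩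
        · simp at h
        · rcases hasLiteral_replace_lit _ hx with ⟨h, _⟩ | ⟨h, _⟩
          · simp [hR] at h
          · simp at h
      · rintro rfl
        rcases hasLiteral_replace_lit _ hy with ⟨h, _⟩ | ⟨h, _⟩
        · simp [hR] at h
        · simp at h

end Cirquent

open Cirquent in
theorem Infers.winnable {E F : Cirquent} (h : Infers E F) (hE : E.Winnable) : F.Winnable := by
  cases h with
  | trivialization X Q a b h hQ => exact winnable_of_trivialization h hQ hE
  | quadrilemma X A B C D a b c h hc => exact winnable_of_quadrilemma h hc hE
  | leftChoosing X c => exact winnable_of_choose hE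
  | rightChoosing X c => exact winnable_of_choose hE
  | matching X P Q a b c d ha hb hP hQ => exact winnable_of_matching ha hQ hE
  | leftCleansing X Y A B C c =>
    exact hE.mono fun σ τ v => eval_replace_mono' (eval_leftCleansing Y A B C c).2 F
  | rightCleansing X Y A B C c =>
    exact hE.mono fun σ τ v => eval_replace_mono' (eval_rightCleansing Y A B C c).2 F
  | _ =>
    refine hE.mono fun σ τ v => eval_replace_mono' ?_ F
    simp only [eval]
    tauto

theorem Provable.winnable {C : Cirquent} (h : Provable C) : C.Winnable := by
  induction h with
  | top =>
    exact ⟨{s | s.μ = ∅}, fun s hs => ⟨s.τ, ∅, ChoiceLE.refl _, hs.subset,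
      fun _ _ _ _ _ h => h.elim, fun _ _ => trivial, fun _ _ _ => rfl⟩, rfl⟩
  | infer E F _ h ih => exact h.winnable ih
  | splitting A B c _ _ hcA hcB ihA ihB => exact Cirquent.winnable_splitting ihA ihB hcA hcB


/-! ### A rank that the purifying rules decrease -/

namespace Cirquent

/-- The binary logarithm of the rank of a cirquent. It is multiplicative on disjunctions and nearly
additive on conjunctions, so that it decreases by distribution of `∨` over `∧`; a choice only adds
one to the larger of two ranks, so that it decreases by distribution of `∨` over `⊓` and by the quadrilemma, where
the choices move towards the root. -/
noncomputable def logRank : Cirquent → ℝ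
  | .top | .bot | .lit _ => 2
  | .or A B => A.logRank * B.logRank
  | .and A B => A.logRank + B.logRank + 1
  | .chand _ A B => Real.logb 2 (2 ^ max A.logRank B.logRank + 1)
  | .chor _ A B => A.logRank + B.logRank

/-- The rank of a cirquent. Each reduction lowers `2 ^ logRank` by at least one, so that the integer
part decreases. -/
noncomputable def rank (X : Cirquent) : ℕ := ⌊(2 : ℝ) ^ X.logRank⌋₊

theorem two_rpow_logRank_chand (c : ℕ) (A B : Cirquent) :
    (2 : ℝ) ^ (chand c A B).logRank = 2 ^ max A.logRank B.logRank + 1 := by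
  rw [logRank, Real.rpow_logb (by norm_num) (by norm_num) (by positivity)]

theorem two_rpow_le {x y : ℝ} : (2 : ℝ) ^ x ≤ 2 ^ y ↔ x ≤ y :=
  Real.rpow_le_rpow_left_iff (by norm_num)

theorem max_le_logRank_chand (c : ℕ) (A B : Cirquent) :
    max A.logRank B.logRank ≤ (chand c A B).logRank := by
  rw [← two_rpow_le, two_rpow_logRank_chand]
  linarith

theorem two_le_logRank (X : Cirquent) : 2 ≤ X.logRank := by
  induction X with
  | top | bot | lit => exact le_rfl
  | or A B ihA ihB => simp only [logRank]; nlinarith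
  | and A B ihA ihB | chor c A B ihA ihB => simp only [logRank]; linarith
  | chand c A B ihA ihB => exact (ihA.trans (le_max_left _ _)).trans (max_le_logRank_chand c A B)

theorem logRank_chand_mono {c d : ℕ} {A B A' B' : Cirquent}
    (hA : A'.logRank ≤ A.logRank) (hB : B'.logRank ≤ B.logRank) :
    (chand c A' B').logRank ≤ (chand d A B).logRank := by
  rw [← two_rpow_le, two_rpow_logRank_chand, two_rpow_logRank_chand]
  gcongr
  norm_num

theorem logRank_replace_le {S T : Cirquent} (h : T.logRank ≤ S.logRank) (X : Cirquent) :
    (X.replace S T).logRank ≤ X.logRank := by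
  refine replace_rel (R := fun A B => B.logRank ≤ A.logRank) h le_rfl le_rfl (fun _ => le_rfl)
    ?_ ?_ ?_ ?_ X
  · intro A B A' B' hA hB
    have := two_le_logRank A; have := two_le_logRank B'
    simp only [logRank]; nlinarith
  · intro A B A' B' hA hB; simp only [logRank]; linarith
  · intro c A B A' B' hA hB; exact logRank_chand_mono hA hB
  · intro c A B A' B' hA hB; simp only [logRank]; linarith

theorem logRank_replace_eq {S T : Cirquent} (h : T.logRank = S.logRank) (X : Cirquent) :
    (X.replace S T).logRank = X.logRank := by
  refine replace_rel (R := fun A B => B.logRank = A.logRank) h rfl rfl (fun _ => rfl)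
    ?_ ?_ ?_ ?_ X <;> intros <;> simp only [logRank, *]

theorem rank_lt {X Y : Cirquent} (h : (2 : ℝ) ^ Y.logRank + 1 ≤ 2 ^ X.logRank) :
    Y.rank < X.rank := by
  unfold rank
  have := Nat.floor_mono h
  rw [Nat.floor_add_one (by positivity)] at this
  omega

theorem rank_le {X Y : Cirquent} (h : Y.logRank ≤ X.logRank) : Y.rank ≤ X.rank :=
  Nat.floor_mono (two_rpow_le.2 h)

theorem rank_left_lt (c : ℕ) (A B : Cirquent) : A.rank < (chand c A B).rank := by
  refine rank_lt ?_
  rw [two_rpow_logRank_chand]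
  gcongr
  · norm_num
  · exact le_max_left _ _

theorem rank_right_lt (c : ℕ) (A B : Cirquent) : B.rank < (chand c A B).rank := by
  refine rank_lt ?_
  rw [two_rpow_logRank_chand]
  gcongr
  · norm_num
  · exact le_max_right _ _

/-- `S` occurs in the given cirquent outside the scope of choice connectives. -/
def SurfaceOccurs (S : Cirquent) : Cirquent → Prop
  | .or A B => S = .or A B ∨ S.SurfaceOccurs A ∨ S.SurfaceOccurs B
  | .and A B => S = .and A B ∨ S.SurfaceOccurs A ∨ S.SurfaceOccurs B
  | X => S = X

theorem surfaceOccurs_self (X : Cirquent) : X.SurfaceOccurs X := by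
  cases X <;> simp [SurfaceOccurs]

theorem SurfaceOccurs.occurs {S X : Cirquent} (h : S.SurfaceOccurs X) : S.Occurs X := by
  induction X with
  | top | bot | lit | chand | chor => simp only [SurfaceOccurs] at h; subst h; exact occurs_self _
  | or A B ihA ihB | and A B ihA ihB =>
    rcases h with rfl | h | h
    · exact occurs_self _
    · exact Or.inr (Or.inl (ihA h))
    · exact Or.inr (Or.inr (ihB h))

theorem SurfaceOccurs.trans {S T X : Cirquent} (h : S.SurfaceOccurs T) (h' : T.SurfaceOccurs X) :
    S.SurfaceOccurs X := by
  induction X with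
  | top | bot | lit | chand | chor => simp only [SurfaceOccurs] at h'; subst h'; exact h
  | or A B ihA ihB | and A B ihA ihB =>
    rcases h' with rfl | h' | h'
    · exact h
    · exact Or.inr (Or.inl (ihA h'))
    · exact Or.inr (Or.inr (ihB h'))

theorem SurfaceOccurs.replace {S X : Cirquent} (h : S.SurfaceOccurs X) (T : Cirquent) :
    T.SurfaceOccurs (X.replace S T) := by
  induction X with
  | top | bot | lit | chand | chor =>
    simp only [SurfaceOccurs] at h; subst h; rw [replace_self]; exact surfaceOccurs_self _
  | or A B ihA ihB | and A B ihA ihB =>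
    rw [Cirquent.replace]
    split_ifs with h'
    · exact surfaceOccurs_self _
    · rcases h with h | h | h
      · exact absurd h h'
      · exact Or.inr (Or.inl (ihA h))
      · exact Or.inr (Or.inr (ihB h))

theorem two_rpow_mul_add_one {a b c : ℝ} (hc : 1 ≤ c) (h : (2 : ℝ) ^ a + 1 ≤ 2 ^ b) :
    (2 : ℝ) ^ (a * c) + 1 ≤ 2 ^ (b * c) := by
  have h0 : (0 : ℝ) < 2 ^ a := by positivity
  calc (2 : ℝ) ^ (a * c) + 1 = (2 ^ a) ^ c + 1 ^ c := by
        rw [Real.rpow_mul (by norm_num), Real.one_rpow]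
    _ ≤ (2 ^ a + 1) ^ c := Real.add_rpow_le_rpow_add h0.le zero_le_one hc
    _ ≤ (2 ^ b) ^ c := by gcongr
    _ = 2 ^ (b * c) := by rw [← Real.rpow_mul (by norm_num)]

theorem two_rpow_add_add_one {a b c : ℝ} (hc : 0 ≤ c) (h : (2 : ℝ) ^ a + 1 ≤ 2 ^ b) :
    (2 : ℝ) ^ (a + c) + 1 ≤ 2 ^ (b + c) := by
  rw [Real.rpow_add (by norm_num), Real.rpow_add (by norm_num)]
  have : (1 : ℝ) ≤ 2 ^ c := Real.one_le_rpow (by norm_num) hc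
  nlinarith [Real.rpow_pos_of_pos (show (0 : ℝ) < 2 by norm_num) a]

/-- Lowering the rank of a surface subcirquent by one lowers the rank of the whole by at least one.
This fails below a choice, where the larger of two ranks counts. -/
theorem logRank_replace_surface {S T X : Cirquent} (h : (2 : ℝ) ^ T.logRank + 1 ≤ 2 ^ S.logRank)
    (hS : S.SurfaceOccurs X) : (2 : ℝ) ^ (X.replace S T).logRank + 1 ≤ 2 ^ X.logRank := by
  have hle : T.logRank ≤ S.logRank := by
    rw [← two_rpow_le]; linarith
  induction X with
  | top | bot | lit | chand | chor =>
    simp only [SurfaceOccurs] at hS; subst hS; rwa [replace_self]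
  | or A B ihA ihB =>
    rw [replace]
    split_ifs with h'
    · rwa [← h']
    · have hA := logRank_replace_le hle A
      have hB := logRank_replace_le hle B
      have := two_le_logRank A; have := two_le_logRank B
      have := two_le_logRank (A.replace S T); have := two_le_logRank (B.replace S T)
      simp only [logRank]
      rcases hS with hS | hS | hS
      · exact absurd hS h'
      · refine le_trans ?_ (two_rpow_mul_add_one (by linarith) (ihA hS))
        gcongr
        norm_num
      · rw [mul_comm, mul_comm A.logRank]
        refine le_trans ?_ (two_rpow_mul_add_one (by linarith) (ihB hS))
        gcongr
        norm_num
  | and A B ihA ihB =>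
    rw [replace]
    split_ifs with h'
    · rwa [← h']
    · have hA := logRank_replace_le hle A
      have hB := logRank_replace_le hle B
      have := two_le_logRank A; have := two_le_logRank B
      have := two_le_logRank (A.replace S T); have := two_le_logRank (B.replace S T)
      simp only [logRank]
      rcases hS with hS | hS | hS
      · exact absurd hS h'
      · rw [add_assoc, add_assoc]
        refine le_trans ?_ (two_rpow_add_add_one (by linarith) (ihA hS))
        gcongr
        norm_num
      · rw [add_comm (logRank _), add_assoc, add_comm A.logRank, add_assoc]
        refine le_trans ?_ (two_rpow_add_add_one (by linarith) (ihB hS))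
        gcongr
        norm_num

theorem two_rpow_add_one_le {a b : ℝ} (ha : 0 ≤ a) (h : a + 1 ≤ b) :
    (2 : ℝ) ^ a + 1 ≤ 2 ^ b := by
  have h1 : (1 : ℝ) ≤ 2 ^ a := Real.one_le_rpow (by norm_num) ha
  have h2 : (2 : ℝ) ^ (a + 1) ≤ 2 ^ b := two_rpow_le.2 h
  rw [Real.rpow_add (by norm_num), Real.rpow_one] at h2
  linarith

theorem logRank_chandDistribution (A B C : Cirquent) (c : ℕ) :
    (2 : ℝ) ^ (chand c (or A C) (or B C)).logRank + 1 ≤ 2 ^ (or (chand c A B) C).logRank := by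
  have hC := two_le_logRank C
  have hA := two_le_logRank A
  rw [two_rpow_logRank_chand]
  simp only [logRank]
  rw [Real.rpow_mul (by norm_num), Real.rpow_logb (by norm_num) (by norm_num) (by positivity),
    ← max_mul_of_nonneg _ _ (by linarith), Real.rpow_mul (by norm_num)]
  set x : ℝ := 2 ^ max A.logRank B.logRank
  have hx : (4 : ℝ) ≤ x := by
    have : (2 : ℝ) ^ (2 : ℝ) ≤ x := two_rpow_le.2 (hA.trans (le_max_left _ _))
    norm_num at this
    exact this
  have h1 : (x + 1) ^ C.logRank = (x + 1) ^ (C.logRank - 1) * (x + 1) := by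
    rw [← Real.rpow_add_one (by positivity), sub_add_cancel]
  have h2 : x ^ C.logRank = x ^ (C.logRank - 1) * x := by
    rw [← Real.rpow_add_one (by positivity), sub_add_cancel]
  have h3 : x ^ (C.logRank - 1) ≤ (x + 1) ^ (C.logRank - 1) := by
    apply Real.rpow_le_rpow <;> linarith
  have h4 : x ≤ x ^ (C.logRank - 1) := Real.self_le_rpow_of_one_le (by linarith) (by linarith)
  rw [h1, h2]
  nlinarith

theorem logRank_quadrilemma (A B C D : Cirquent) (a b c : ℕ) :
    (2 : ℝ) ^ (chand c
            (chand a (and A (chand b C D)) (and B (chand b C D)))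
            (chand b (and (chand a A B) C) (and (chand a A B) D))).logRank + 1 ≤
      2 ^ (and (chand a A B) (chand b C D)).logRank := by
  have hpow : ∀ x y : ℝ, (2 : ℝ) ^ max x y = max (2 ^ x) (2 ^ y) := fun x y =>
    (Real.monotone_rpow_of_base_ge_one (by norm_num)).map_max
  have hand : ∀ A B : Cirquent,
      (2 : ℝ) ^ (and A B).logRank = 2 ^ A.logRank * 2 ^ B.logRank * 2 := fun A B => by
    simp only [logRank]
    rw [Real.rpow_add (by norm_num), Real.rpow_add (by norm_num), Real.rpow_one]
  have h4 : ∀ A : Cirquent, (4 : ℝ) ≤ 2 ^ A.logRank := fun A => by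
    have : (2 : ℝ) ^ (2 : ℝ) ≤ 2 ^ A.logRank := two_rpow_le.2 (two_le_logRank A)
    norm_num at this
    exact this
  simp only [two_rpow_logRank_chand, hpow, hand]
  have hA := h4 A; have hB := h4 B; have hC := h4 C; have hD := h4 D
  set p : ℝ := 2 ^ A.logRank
  set q : ℝ := 2 ^ B.logRank
  set r : ℝ := 2 ^ C.logRank
  set s : ℝ := 2 ^ D.logRank
  have e1 : max p q ≥ p := le_max_left _ _
  have e2 : max p q ≥ q := le_max_right _ _
  have e3 : max r s ≥ r := le_max_left _ _
  have e4 : max r s ≥ s := le_max_right _ _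
  set M := max p q
  set N := max r s
  have g1 : max (max (p * (N + 1) * 2) (q * (N + 1) * 2) + 1)
      (max ((M + 1) * r * 2) ((M + 1) * s * 2) + 1) ≤ (M + 1) * (N + 1) * 2 - 2 := by
    refine max_le ?_ ?_
    · have : max (p * (N + 1) * 2) (q * (N + 1) * 2) ≤ M * (N + 1) * 2 := max_le (by nlinarith) (by nlinarith)
      nlinarith
    · have : max ((M + 1) * r * 2) ((M + 1) * s * 2) ≤ (M + 1) * N * 2 := max_le (by nlinarith) (by nlinarith)
      nlinarith
  linarith

end Cirquent

/-! ### Winnable cirquents are provable -/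

/-- The letter of a literal. -/
def Literal.letter : Literal → ℕ
  | .pos P _ | .neg P _ => P

namespace Cirquent

/-- The set of the literals of a cirquent. -/
def literals : Cirquent → Finset Literal
  | .top | .bot => ∅
  | .lit L => {L}
  | .or A B | .and A B | .chand _ A B | .chor _ A B => A.literals ∪ B.literals

theorem mem_literals {L : Literal} {X : Cirquent} : L ∈ X.literals ↔ X.HasLiteral L := by
  unfold HasLiteral
  induction X with
  | top | bot => simp [literals, Occurs]
  | lit => simp [literals, Occurs]
  | or A B ihA ihB | and A B ihA ihB | chand _ A B ihA ihB | chor _ A B ihA ihB =>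
    simp [literals, Occurs, ihA, ihB]

/-- The set of the clusters of the environment's choices in a cirquent. -/
def chands : Cirquent → Finset ℕ
  | .top | .bot | .lit _ => ∅
  | .or A B | .and A B | .chor _ A B => A.chands ∪ B.chands
  | .chand c A B => insert c (A.chands ∪ B.chands)

theorem mem_chands {c : ℕ} {X : Cirquent} (h : X.HasChand c) : c ∈ X.chands := by
  obtain ⟨S, T, h⟩ := h
  induction X with
  | top | bot | lit => simp [Occurs] at h
  | or A B ihA ihB | and A B ihA ihB | chor _ A B ihA ihB =>
    simp only [Occurs, reduceCtorEq, false_or] at h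
    simp only [chands, Finset.mem_union]
    exact h.imp ihA ihB
  | chand d A B ihA ihB =>
    simp only [chands, Finset.mem_union, Finset.mem_insert]
    exact h.imp (fun h => by injection h) (Or.imp ihA ihB)

theorem exists_not_hasChand (X : Cirquent) : ∃ c, ¬ X.HasChand c := by
  obtain ⟨c, hc⟩ := Infinite.exists_notMem_finset X.chands
  exact ⟨c, fun h => hc (mem_chands h)⟩

theorem hasLetter_letter {X : Cirquent} {L : Literal} (h : X.HasLiteral L) :
    X.HasLetter L.letter := by
  cases L with
  | pos P a => exact ⟨a, Or.inl h⟩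
  | neg P a => exact ⟨a, Or.inr h⟩

theorem exists_not_hasLetter (X : Cirquent) : ∃ P, ¬ X.HasLetter P := by
  obtain ⟨P, hP⟩ := Infinite.exists_notMem_finset (X.literals.image Literal.letter)
  refine ⟨P, ?_⟩
  rintro ⟨a, h | h⟩ <;>
    exact hP (Finset.mem_image.2 ⟨_, mem_literals.2 h, rfl⟩)

/-! #### The choices made by the machine -/

/-- The result of making the choices `τ` throughout a cirquent. -/
def resolve (τ : ℕ → Option Bool) : Cirquent → Cirquent
  | .top => .top
  | .bot => .bot
  | .lit L => .lit L
  | .or A B => .or (A.resolve τ) (B.resolve τ)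
  | .and A B => .and (A.resolve τ) (B.resolve τ)
  | .chand c A B => .chand c (A.resolve τ) (B.resolve τ)
  | .chor c A B =>
      match τ c with
      | none => .chor c (A.resolve τ) (B.resolve τ)
      | some false => A.resolve τ
      | some true => B.resolve τ

/-- The number of occurrences of the machine's choices. -/
def chorCount : Cirquent → ℕ
  | .top | .bot | .lit _ => 0
  | .or A B | .and A B | .chand _ A B => A.chorCount + B.chorCount
  | .chor _ A B => A.chorCount + B.chorCount + 1

theorem resolve_choose {τ : ℕ → Option Bool} {c : ℕ} {i : Bool} (h : τ c = some i)
    (X : Cirquent) : (X.choose c i).resolve τ = X.resolve τ := by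
  induction X with
  | top | bot | lit => rfl
  | or A B ihA ihB | and A B ihA ihB | chand _ A B ihA ihB => simp [choose, resolve, ihA, ihB]
  | chor d A B ihA ihB =>
    rw [choose]
    split_ifs with hd hi
    · subst hd hi; simp [resolve, h, ihB]
    · subst hd
      have : i = false := by simpa using hi
      subst this
      simp [resolve, h, ihA]
    · simp [resolve, ihA, ihB]

theorem chorCount_choose_le (c : ℕ) (i : Bool) (X : Cirquent) :
    (X.choose c i).chorCount ≤ X.chorCount := by
  induction X with
  | top | bot | lit => exact le_rfl
  | or A B ihA ihB | and A B ihA ihB | chand _ A B ihA ihB => simp only [choose, chorCount]; omega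
  | chor d A B ihA ihB =>
    rw [choose]
    split_ifs <;> simp only [chorCount] <;> omega

theorem exists_choose_of_resolve_ne {τ : ℕ → Option Bool} {X : Cirquent} (h : X.resolve τ ≠ X) :
    ∃ c i, τ c = some i ∧ (X.choose c i).chorCount < X.chorCount := by
  induction X with
  | top | bot | lit => exact absurd rfl h
  | or A B ihA ihB | and A B ihA ihB | chand _ A B ihA ihB =>
    by_cases hA : A.resolve τ = A
    · have hB : B.resolve τ ≠ B := fun hB => h (by rw [resolve, hA, hB])
      obtain ⟨c, i, h1, h2⟩ := ihB hB
      refine ⟨c, i, h1, ?_⟩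
      have := chorCount_choose_le c i A
      simp only [choose, chorCount]; omega
    · obtain ⟨c, i, h1, h2⟩ := ihA hA
      refine ⟨c, i, h1, ?_⟩
      have := chorCount_choose_le c i B
      simp only [choose, chorCount]; omega
  | chor d A B ihA ihB =>
    rcases hd : τ d with _ | i
    · by_cases hA : A.resolve τ = A
      · have hB : B.resolve τ ≠ B := fun hB => h (by simp [resolve, hA, hB, hd])
        obtain ⟨c, i, h1, h2⟩ := ihB hB
        refine ⟨c, i, h1, ?_⟩
        have := chorCount_choose_le c i A
        rw [choose]; split_ifs <;> simp only [chorCount] <;> omega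
      · obtain ⟨c, i, h1, h2⟩ := ihA hA
        refine ⟨c, i, h1, ?_⟩
        have := chorCount_choose_le c i B
        rw [choose]; split_ifs <;> simp only [chorCount] <;> omega
    · refine ⟨d, i, hd, ?_⟩
      have := chorCount_choose_le d i A
      have := chorCount_choose_le d i B
      rw [choose, if_pos rfl]; split_ifs <;> simp only [chorCount] <;> omega

/-- The choices of the machine can be carried out one by one by Left and Right Choosing. -/
theorem provable_of_resolve {τ : ℕ → Option Bool} {X : Cirquent} (h : Provable (X.resolve τ)) :
    Provable X := by
  induction hn : X.chorCount using Nat.strong_induction_on generalizing X with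
  | _ n ih =>
    by_cases hX : X.resolve τ = X
    · rwa [hX] at h
    · obtain ⟨c, i, hc, hlt⟩ := exists_choose_of_resolve_ne hX
      have := ih _ (hn ▸ hlt) (by rwa [resolve_choose hc]) rfl
      cases i
      · exact .infer _ _ this (.leftChoosing X c)
      · exact .infer _ _ this (.rightChoosing X c)

theorem eval_resolve {σ τ τ' : ℕ → Option Bool} {v : Literal → Prop} (h : ChoiceLE τ τ')
    (X : Cirquent) : (X.resolve τ).eval σ τ' v ↔ X.eval σ τ' v := by
  induction X with
  | top | bot | lit => exact Iff.rfl
  | or A B ihA ihB | and A B ihA ihB | chand _ A B ihA ihB => simp [resolve, eval, ihA, ihB]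
  | chor d A B ihA ihB =>
    rcases hd : τ d with _ | _ | _
    · simp [resolve, hd, eval, ihA, ihB]
    · simp [resolve, hd, eval, h _ _ hd, ihA]
    · simp [resolve, hd, eval, h _ _ hd, ihB]

theorem eval_resolve_none {σ τ : ℕ → Option Bool} {v : Literal → Prop} (X : Cirquent) :
    (X.resolve τ).eval σ (fun _ => none) v ↔ X.eval σ τ v := by
  induction X with
  | top | bot | lit => exact Iff.rfl
  | or A B ihA ihB | and A B ihA ihB | chand _ A B ihA ihB => simp [resolve, eval, ihA, ihB]
  | chor d A B ihA ihB =>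
    rcases hd : τ d with _ | _ | _ <;> simp [resolve, hd, eval, ihA, ihB]

theorem logRank_resolve_le (τ : ℕ → Option Bool) (X : Cirquent) :
    (X.resolve τ).logRank ≤ X.logRank := by
  induction X with
  | top | bot | lit => exact le_rfl
  | or A B ihA ihB =>
    have := two_le_logRank A; have := two_le_logRank (B.resolve τ)
    simp only [resolve, logRank]; nlinarith
  | and A B ihA ihB => simp only [resolve, logRank]; linarith
  | chand _ A B ihA ihB => exact logRank_chand_mono ihA ihB
  | chor d A B ihA ihB =>
    have := two_le_logRank A; have := two_le_logRank B
    rcases hd : τ d with _ | _ | _ <;> simp only [resolve, hd, logRank] <;> linarith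

/-! #### The matches made by the machine -/

/-- The cirquent is true before any further choices or matches, and the machine can keep it so when
it has made the matches `μ` but no choices. -/
def WinnableFrom (X : Cirquent) (μ : Set (ℕ × ℕ × ℕ)) : Prop :=
  IsMatching μ ∧ X.Taut ⟨fun _ => none, fun _ => none, μ⟩ ∧
    ∃ W, X.Good W ∧ ⟨fun _ => none, fun _ => none, μ⟩ ∈ W

theorem WinnableFrom.winnable {X : Cirquent} {μ : Set (ℕ × ℕ × ℕ)} (h : X.WinnableFrom μ) :
    X.Winnable := by
  obtain ⟨h1, h2, W, hW, h0⟩ := h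
  refine ⟨insert GameState.start W, ?_, Set.mem_insert _ _⟩
  rintro s (rfl | hs)
  · obtain ⟨τ', μ', g1, g2, g3, g4, g5⟩ := hW _ h0
    exact ⟨τ', μ', g1, Set.empty_subset _, g3, g4, fun c i hc => Or.inr (g5 c i hc)⟩
  · obtain ⟨τ', μ', g1, g2, g3, g4, g5⟩ := hW _ hs
    exact ⟨τ', μ', g1, g2, g3, g4, fun c i hc => Or.inr (g5 c i hc)⟩

/-- The machine can make its first choices by modifying the cirquent, so that only its matches are
left to be recorded. -/
theorem Winnable.resolve {X : Cirquent} (h : X.Winnable) :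
    ∃ τ μ, (X.resolve τ).WinnableFrom μ := by
  obtain ⟨W, h0, hW⟩ := h.exists_good
  obtain ⟨τ, μ, h1, h2, h3, h4, h5, -⟩ := hW _ h0
  refine ⟨τ, μ, h3, fun v hv => (eval_resolve_none X).2 (h4 v hv),
    {s | ∃ s0 ∈ W, s.σ = s0.σ ∧ s.μ = s0.μ ∧ ChoiceLE τ s0.τ ∧ ChoiceLE s.τ s0.τ}, ?_,
    _, h5, rfl, rfl, ChoiceLE.refl _, fun _ _ h => by simp at h⟩
  rintro ⟨σs, τs, μs⟩ ⟨s0, hs0, rfl, rfl, g1, g2⟩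
  obtain ⟨τ', μ', k1, k2, k3, k4, -, k6⟩ := hW _ hs0
  exact ⟨τ', μ', g2.trans k1, k2, k3, fun v hv => (eval_resolve (g1.trans k1) X).2 (k4 v hv),
    fun c i hc => ⟨_, k6 c i hc, rfl, rfl, g1.trans k1, ChoiceLE.refl _⟩⟩

/-- The result of renaming the matched literals `P^a` and `¬P^b` into `Q^0` and `¬Q^0`. -/
def rename (X : Cirquent) (P a b Q : ℕ) : Cirquent :=
  (X.replace (lit (.pos P a)) (lit (.pos Q 0))).replace (lit (.neg P b)) (lit (.neg Q 0))

/-- A match survives the renaming of the two literals into literals of a fresh letter. -/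
theorem WinnableFrom.rename {X : Cirquent} {μ : Set (ℕ × ℕ × ℕ)} {P a b Q : ℕ}
    (h : X.WinnableFrom μ) (hP : (P, a, b) ∈ μ) (ha : X.HasLiteral (.pos P a))
    (hQ : ¬ X.HasLetter Q) : ∃ μ', (X.rename P a b Q).WinnableFrom μ' := by
  obtain ⟨h1, h2, W, hW, h0⟩ := h
  have hPQ : P ≠ Q := by rintro rfl; exact hQ ⟨a, Or.inl ha⟩
  let tr : Set (ℕ × ℕ × ℕ) → Set (ℕ × ℕ × ℕ) := fun μ =>
    {t | (t ∈ μ ∧ t.1 ≠ Q ∧ t ≠ (P, a, b)) ∨ t = (Q, 0, 0)}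
  have htr : ∀ μ μ', μ ⊆ μ' → tr μ ⊆ tr μ' := fun μ μ' h t ht =>
    ht.imp (fun ht => ⟨h ht.1, ht.2⟩) id
  have htrm : ∀ μ, IsMatching μ → IsMatching (tr μ) := by
    rintro μ hμ R x y x' y' (⟨hx, hxQ, -⟩ | hx) (⟨hy, hyQ, -⟩ | hy)
    · exact hμ R x y x' y' hx hy
    all_goals simp_all
  have key : ∀ σ τ μ v, (P, a, b) ∈ μ → IsMatching μ → X.Taut ⟨σ, τ, μ⟩ → Compat (tr μ) v →
      (X.rename P a b Q).eval σ τ v := by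
    intro σ τ μ v hm hinj ht hv
    let v' : Literal → Prop := fun L => L.letter ≠ Q →
      if L = .pos P a then v (.pos Q 0) else if L = .neg P b then v (.neg Q 0) else v L
    have e := ht v' fun R x y hxy => by
      by_cases hR : R = Q
      · exact Or.inl fun h => absurd hR h
      · by_cases hRP : R = P
        · subst hRP
          have := hinj R x y a b hxy hm
          by_cases hx : x = a
          · have hy := this.1 hx
            subst hx hy
            have := hv Q 0 0 (Or.inr rfl)
            simpa [v', Literal.letter, hPQ] using this
          · have hy : y ≠ b := fun hy => hx (this.2 hy)
            have := hv R x y (Or.inl ⟨hxy, hR, by simp [hx]⟩)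
            simpa [v', Literal.letter, hPQ, hx, hy] using this
        · have := hv R x y (Or.inl ⟨hxy, hR, by simp [hRP]⟩)
          simpa [v', Literal.letter, hR, hRP] using this
    let v'' : Literal → Prop := fun L => if L = .neg P b then v (.neg Q 0) else v L
    rw [eval_replace_lit (L := .pos P a) (M := .pos Q 0) (v' := v'') X,
      eval_replace_lit (L := .neg P b) (M := .neg Q 0) (v' := v)] at e
    · exact e
    · simp [v'']
    · intro K hK _; simp [v'', hK]
    · simp [v', v'', Literal.letter, hPQ]
    · intro K hK hXK
      have hKQ : K.letter ≠ Q := fun h => hQ (h ▸ hasLetter_letter hXK)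
      simp [v', v'', hKQ, hK]
  refine ⟨tr μ, htrm _ h1, fun v hv => key _ _ μ v hP h1 h2 hv,
    {s | ∃ s0 ∈ W, s.σ = s0.σ ∧ s.τ = s0.τ ∧ (P, a, b) ∈ s0.μ ∧ s.μ = tr s0.μ}, ?_,
    _, h0, rfl, rfl, hP, rfl⟩
  rintro ⟨σs, τs, μs⟩ ⟨s0, hs0, rfl, rfl, hm, rfl⟩
  obtain ⟨τ', μ', k1, k2, k3, k4, k5⟩ := hW _ hs0
  exact ⟨τ', tr μ', k1, htr _ _ k2, htrm _ k3, fun v hv => key _ _ μ' v (k2 hm) k3 k4 hv,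
    fun c i hc => ⟨_, k5 c i hc, rfl, rfl, k2 hm, rfl⟩⟩

theorem logRank_rename (X : Cirquent) (P a b Q : ℕ) : (X.rename P a b Q).logRank = X.logRank := by
  rw [rename, logRank_replace_eq (by rfl), logRank_replace_eq (by rfl)]

theorem hasLiteral_rename {X : Cirquent} {P a b Q : ℕ} {L : Literal}
    (h : (X.rename P a b Q).HasLiteral L) :
    L = .pos Q 0 ∨ L = .neg Q 0 ∨ (L ≠ .pos P a ∧ X.HasLiteral L) := by
  rcases hasLiteral_replace_lit _ h with ⟨h, _⟩ | ⟨_, h⟩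
  · exact Or.inr (Or.inl h)
  · rcases hasLiteral_replace_lit _ h with ⟨h, _⟩ | h
    · exact Or.inl h
    · exact Or.inr (Or.inr h)

/-- Renaming matched literals makes the letters of all matched literals pseudoelementary. -/
theorem WinnableFrom.exists_pseudoelementary {X : Cirquent} {μ : Set (ℕ × ℕ × ℕ)}
    (h : X.WinnableFrom μ) : ∃ Y ν, (Provable Y → Provable X) ∧ Y.logRank = X.logRank ∧
      Y.WinnableFrom ν ∧ ∀ P a b, (P, a, b) ∈ ν → Y.HasLiteral (.pos P a) →
        Y.HasLiteral (.neg P b) → Y.Pseudoelementary P := by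
  classical
  induction hn : (X.literals.filter fun L => ¬ X.Pseudoelementary L.letter).card
    using Nat.strong_induction_on generalizing X μ with
  | _ n ih =>
    by_cases hall : ∀ P a b, (P, a, b) ∈ μ → X.HasLiteral (.pos P a) →
        X.HasLiteral (.neg P b) → X.Pseudoelementary P
    · exact ⟨X, μ, id, rfl, h, hall⟩
    · push Not at hall
      obtain ⟨P, a, b, hm, ha, hb, hP⟩ := hall
      obtain ⟨Q, hQ⟩ := X.exists_not_hasLetter
      obtain ⟨μ', h'⟩ := h.rename hm ha hQ
      have hQa : (X.rename P a b Q).HasLiteral (.pos Q 0) := by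
        refine hasLiteral_replace_lit_of _ (Or.inr ⟨by simp, ?_⟩)
        exact hasLiteral_replace_lit_of _ (Or.inl ⟨rfl, ha⟩)
      have hXQ : ∀ L, X.HasLiteral L → L.letter ≠ Q := fun L hL h => hQ (h ▸ hasLetter_letter hL)
      have hlt : ((X.rename P a b Q).literals.filter fun L =>
          ¬ (X.rename P a b Q).Pseudoelementary L.letter).card < n := by
        rw [← hn]
        apply Finset.card_lt_card
        rw [Finset.ssubset_iff_of_subset]
        · refine ⟨.pos P a, Finset.mem_filter.2 ⟨mem_literals.2 ha, hP⟩, ?_⟩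
          rw [Finset.mem_filter, mem_literals]
          rintro ⟨h, -⟩
          rcases hasLiteral_rename h with h | h | h
          · injection h with h; exact hXQ _ ha h
          · simp at h
          · exact h.1 rfl
        · intro L hL
          rw [Finset.mem_filter, mem_literals] at hL ⊢
          obtain ⟨hL, hLp⟩ := hL
          have hQp : (X.rename P a b Q).Pseudoelementary Q := by
            refine ⟨⟨0, Or.inl hQa⟩, ?_, ?_⟩
            · have : ∀ x, (X.rename P a b Q).HasLiteral (.pos Q x) → x = 0 := fun x hx => by
                rcases hasLiteral_rename hx with h | h | h
                · injection h
                · simp at h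
                · exact absurd rfl (hXQ _ h.2)
              intro x y hx hy; rw [this x hx, this y hy]
            · have : ∀ x, (X.rename P a b Q).HasLiteral (.neg Q x) → x = 0 := fun x hx => by
                rcases hasLiteral_rename hx with h | h | h
                · simp at h
                · injection h
                · exact absurd rfl (hXQ _ h.2)
              intro x y hx hy; rw [this x hx, this y hy]
          have hLQ : L.letter ≠ Q := fun h => hLp (h ▸ hQp)
          have hX : ∀ K : Literal, K.letter ≠ Q → (X.rename P a b Q).HasLiteral K →
              X.HasLiteral K := fun K hKQ hK => by
            rcases hasLiteral_rename hK with h | h | h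
            · subst h; exact absurd rfl hKQ
            · subst h; exact absurd rfl hKQ
            · exact h.2
          refine ⟨hX L hLQ hL, fun hp => hLp ⟨hasLetter_letter hL, ?_, ?_⟩⟩
          · exact fun x y hx hy => hp.2.1 x y (hX _ hLQ hx) (hX _ hLQ hy)
          · exact fun x y hx hy => hp.2.2 x y (hX _ hLQ hx) (hX _ hLQ hy)
      obtain ⟨Y, ν, h1, h2, h3, h4⟩ := ih _ hlt h' rfl
      refine ⟨Y, ν, fun hY => ?_, h2.trans (logRank_rename X P a b Q), h3, h4⟩
      exact .infer _ _ (h1 hY) (.matching X P Q a b 0 0 ha hb ⟨⟨a, Or.inl ha⟩, hP⟩ hQ)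

end Cirquent
namespace Cirquent

/-! #### Purification -/

/-- `X` follows from `Y` by rules that merely rearrange disjunctions. -/
structure Rearranges (X Y : Cirquent) : Prop where
  provable : Provable Y → Provable X
  eval : ∀ σ τ v, X.eval σ τ v → Y.eval σ τ v
  logRank : Y.logRank = X.logRank
  hasLiteral : ∀ L, Y.HasLiteral L ↔ X.HasLiteral L

theorem SurfaceOccurs.or_left {A B X : Cirquent} (h : (or A B).SurfaceOccurs X) :
    A.SurfaceOccurs X :=
  .trans (T := or A B) (Or.inr (Or.inl (surfaceOccurs_self A))) h

theorem SurfaceOccurs.or_right {A B X : Cirquent} (h : (or A B).SurfaceOccurs X) :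
    B.SurfaceOccurs X :=
  .trans (T := or A B) (Or.inr (Or.inr (surfaceOccurs_self B))) h

theorem SurfaceOccurs.and_left {A B X : Cirquent} (h : (and A B).SurfaceOccurs X) :
    A.SurfaceOccurs X :=
  .trans (T := and A B) (Or.inr (Or.inl (surfaceOccurs_self A))) h

theorem SurfaceOccurs.and_right {A B X : Cirquent} (h : (and A B).SurfaceOccurs X) :
    B.SurfaceOccurs X :=
  .trans (T := and A B) (Or.inr (Or.inr (surfaceOccurs_self B))) h

theorem Rearranges.refl (X : Cirquent) : X.Rearranges X :=
  ⟨id, fun _ _ _ => id, rfl, fun _ => Iff.rfl⟩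

theorem Rearranges.trans {X Y Z : Cirquent} (h : X.Rearranges Y) (h' : Y.Rearranges Z) :
    X.Rearranges Z :=
  ⟨h.provable ∘ h'.provable, fun σ τ v => h'.eval σ τ v ∘ h.eval σ τ v,
    h'.logRank.trans h.logRank, fun L => (h'.hasLiteral L).trans (h.hasLiteral L)⟩

theorem hasLiteral_replace_iff {S T : Cirquent} {L : Literal}
    (h : T.HasLiteral L ↔ S.HasLiteral L) (X : Cirquent) :
    (X.replace S T).HasLiteral L ↔ X.HasLiteral L := by
  unfold HasLiteral at *
  refine replace_rel (R := fun A B => (lit L).Occurs B ↔ (lit L).Occurs A) h Iff.rfl Iff.rfl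
    (fun _ => Iff.rfl) ?_ ?_ ?_ ?_ X <;> intros <;>
    simp only [Occurs, reduceCtorEq, false_or, *]

theorem rearranges_comm {X A B : Cirquent} (h : (or A B).SurfaceOccurs X) :
    ∃ Y, X.Rearranges Y ∧ (or B A).SurfaceOccurs Y := by
  refine ⟨_, ⟨fun hY => .infer _ _ hY (.porCommutativity X A B h.occurs), fun σ τ v => ?_, ?_,
    fun L => ?_⟩, h.replace _⟩
  · exact eval_replace_mono (by simp only [Cirquent.eval]; tauto) X
  · exact logRank_replace_eq (mul_comm _ _) X
  · exact hasLiteral_replace_iff (by simp [HasLiteral, Occurs, or_comm]) X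

theorem rearranges_assoc {X A B C : Cirquent} (h : (or (or A B) C).SurfaceOccurs X) :
    ∃ Y, X.Rearranges Y ∧ (or A (or B C)).SurfaceOccurs Y := by
  refine ⟨_, ⟨fun hY => .infer _ _ hY (.porAssociativity X A B C h.occurs), fun σ τ v => ?_, ?_,
    fun L => ?_⟩, h.replace _⟩
  · exact eval_replace_mono (by simp only [Cirquent.eval]; tauto) X
  · exact logRank_replace_eq (mul_assoc _ _ _).symm X
  · exact hasLiteral_replace_iff (by simp [HasLiteral, Occurs, or_assoc]) X

/-- The literal `L` is one of those whose disjunction, together with other cirquents, is `S`. -/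
def Disjunct (L : Literal) : Cirquent → Prop
  | .or A B => A.Disjunct L ∨ B.Disjunct L
  | .lit K => K = L
  | _ => False

theorem Disjunct.hasLiteral {L : Literal} {S : Cirquent} (h : S.Disjunct L) : S.HasLiteral L := by
  unfold HasLiteral
  induction S with
  | top | bot | and | chand | chor => exact h.elim
  | lit K => cases h; exact occurs_self _
  | or A B ihA ihB => exact Or.inr (h.imp ihA ihB)

/-- The literals of a disjunction can be moved closer to its root without touching its immediate
constituents elsewhere. -/
theorem rearranges_descend {X A₁ A₂ B : Cirquent} {K : Literal}
    (h : (or (or A₁ A₂) B).SurfaceOccurs X) (hK : (or A₁ A₂).Disjunct K) :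
    ∃ Y A, X.Rearranges Y ∧ (or A B).SurfaceOccurs Y ∧ A.Disjunct K ∧ (A = A₁ ∨ A = A₂) := by
  obtain ⟨Y, hY, hs⟩ := rearranges_assoc h
  rcases hK with hK | hK
  · obtain ⟨Y₁, hY₁, hs⟩ := rearranges_comm hs
    obtain ⟨Y₂, hY₂, hs⟩ := rearranges_assoc hs
    have hs : (or B A₁).SurfaceOccurs Y₂ :=
      hs.or_right
    obtain ⟨Y₃, hY₃, hs⟩ := rearranges_comm hs
    exact ⟨Y₃, A₁, hY.trans (hY₁.trans (hY₂.trans hY₃)), hs, hK, Or.inl rfl⟩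
  · exact ⟨Y, A₂, hY, hs.or_right, hK, Or.inr rfl⟩

/-- Two disjuncts can be made adjacent. -/
theorem rearranges_adjacent {X A B : Cirquent} {K L : Literal} (h : (or A B).SurfaceOccurs X)
    (hK : A.Disjunct K) (hL : B.Disjunct L) :
    ∃ Y, X.Rearranges Y ∧ (or (lit K) (lit L)).SurfaceOccurs Y := by
  induction hn : sizeOf A + sizeOf B using Nat.strong_induction_on generalizing X A B K L with
  | _ n ih =>
    cases A with
    | top | bot | and | chand | chor => exact hK.elim
    | or A₁ A₂ =>
      obtain ⟨Y, A, hY, hs, hA, hA'⟩ := rearranges_descend h hK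
      have hlt : sizeOf A + sizeOf B < n := by
        rw [← hn]; simp only [or.sizeOf_spec]; rcases hA' with rfl | rfl <;> omega
      obtain ⟨Z, hZ, hs⟩ := ih _ hlt hs hA hL rfl
      exact ⟨Z, hY.trans hZ, hs⟩
    | lit K' =>
      cases hK
      cases B with
      | top | bot | and | chand | chor => exact hL.elim
      | lit L' => cases hL; exact ⟨X, .refl X, h⟩
      | or B₁ B₂ =>
        obtain ⟨Y, hY, hs⟩ := rearranges_comm h
        obtain ⟨Y₁, B, hY₁, hs, hB, hB'⟩ := rearranges_descend hs hL
        have hlt : sizeOf B + sizeOf (lit K) < n := by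
          rw [← hn]; simp only [or.sizeOf_spec]; rcases hB' with rfl | rfl <;> omega
        obtain ⟨Z, hZ, hs⟩ := ih _ hlt hs hB rfl rfl
        obtain ⟨Z', hZ', hs⟩ := rearranges_comm hs
        exact ⟨Z', hY.trans (hY₁.trans (hZ.trans hZ')), hs⟩

theorem exists_or_of_disjuncts {S : Cirquent} {K L : Literal} (hKL : K ≠ L) (hK : S.Disjunct K)
    (hL : S.Disjunct L) : ∃ A B, (or A B).SurfaceOccurs S ∧
      ((A.Disjunct K ∧ B.Disjunct L) ∨ (A.Disjunct L ∧ B.Disjunct K)) := by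
  induction S with
  | top | bot | and | chand | chor => exact hK.elim
  | lit M => exact absurd (hK.symm.trans hL) hKL
  | or A B ihA ihB =>
    rcases hK with hK | hK <;> rcases hL with hL | hL
    · obtain ⟨C, D, h1, h2⟩ := ihA hK hL
      exact ⟨C, D, Or.inr (Or.inl h1), h2⟩
    · exact ⟨A, B, Or.inl rfl, Or.inl ⟨hK, hL⟩⟩
    · exact ⟨A, B, Or.inl rfl, Or.inr ⟨hL, hK⟩⟩
    · obtain ⟨C, D, h1, h2⟩ := ihB hK hL
      exact ⟨C, D, Or.inr (Or.inr h1), h2⟩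

/-- `X` can be inferred from a winnable cirquent of a smaller rank, if it is winnable itself. -/
def Reducible (X : Cirquent) : Prop :=
  ∃ Y, (Provable Y → Provable X) ∧ (∀ σ τ v, X.eval σ τ v → Y.eval σ τ v) ∧ Y.rank < X.rank

theorem reducible_of_replace {X S T : Cirquent} (h : S.SurfaceOccurs X)
    (hi : Infers (X.replace S T) X) (he : ∀ σ τ v, S.eval σ τ v → T.eval σ τ v)
    (hr : (2 : ℝ) ^ T.logRank + 1 ≤ 2 ^ S.logRank) : X.Reducible :=
  ⟨_, fun hY => .infer _ _ hY hi, fun σ τ v => eval_replace_mono (he σ τ v) X,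
    rank_lt (logRank_replace_surface hr h)⟩

theorem Rearranges.reducible {X Y : Cirquent} (h : X.Rearranges Y) (hY : Y.Reducible) :
    X.Reducible := by
  obtain ⟨Z, h1, h2, h3⟩ := hY
  refine ⟨Z, h.provable ∘ h1, fun σ τ v => h2 σ τ v ∘ h.eval σ τ v, ?_⟩
  rwa [rank, rank, h.logRank, ← rank, ← rank] at h3

theorem logRank_or_top (A : Cirquent) : (2 : ℝ) ^ top.logRank + 1 ≤ 2 ^ (or A top).logRank := by
  have := two_le_logRank A
  exact two_rpow_add_one_le (by simp [logRank]) (by simp only [logRank]; linarith)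

theorem logRank_and_top (A : Cirquent) : (2 : ℝ) ^ A.logRank + 1 ≤ 2 ^ (and A top).logRank := by
  have := two_le_logRank A
  exact two_rpow_add_one_le (by linarith) (by simp only [logRank]; linarith)

theorem reducible_or_top {X A : Cirquent} (h : (or A top).SurfaceOccurs X) : X.Reducible :=
  reducible_of_replace h (.porDomination X A h.occurs) (fun _ _ _ _ => trivial) (logRank_or_top A)

theorem reducible_and_top {X A : Cirquent} (h : (and A top).SurfaceOccurs X) : X.Reducible :=
  reducible_of_replace h (.pandIdentity X A h.occurs) (fun _ _ _ h => h.1) (logRank_and_top A)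

theorem reducible_top_and {X A : Cirquent} (h : (and top A).SurfaceOccurs X) : X.Reducible := by
  have h' := h.replace (and A top)
  obtain ⟨Y, h1, h2, h3⟩ := reducible_and_top h'
  refine ⟨Y, fun hY => .infer _ _ (h1 hY) (.pandCommutativity X top A h.occurs),
    fun σ τ v hX => h2 σ τ v (eval_replace_mono (by simp only [eval]; tauto) X hX), ?_⟩
  rwa [rank, rank, logRank_replace_eq (by simp only [logRank]; ring), ← rank, ← rank] at h3

theorem reducible_or_and {X A B C : Cirquent} (h : (or (and A B) C).SurfaceOccurs X) :
    X.Reducible := by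
  have hA := two_le_logRank A
  have hB := two_le_logRank B
  have hC := two_le_logRank C
  refine reducible_of_replace h (.pandDistribution X A B C h.occurs)
    (fun σ τ v => by simp only [eval]; tauto) (two_rpow_add_one_le ?_ ?_)
  · simp only [logRank]; positivity
  · simp only [logRank]; nlinarith

theorem reducible_or_chand {X A B C : Cirquent} {c : ℕ}
    (h : (or (chand c A B) C).SurfaceOccurs X) : X.Reducible :=
  reducible_of_replace h (.chandDistribution X A B C c h.occurs)
    (fun σ τ v => by simp only [eval]; tauto) (logRank_chandDistribution A B C c)

theorem reducible_chand_and_chand {X A B C D : Cirquent} {a b : ℕ}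
    (h : (and (chand a A B) (chand b C D)).SurfaceOccurs X) : X.Reducible := by
  obtain ⟨c, hc⟩ := X.exists_not_hasChand
  exact reducible_of_replace h (.quadrilemma X A B C D a b c h.occurs hc)
    (fun σ τ v => by simp only [eval]; tauto) (logRank_quadrilemma A B C D a b c)

/-- Opposite literals of a pseudoelementary letter in one clause can be made adjacent, and are
then replaced by `⊤`. -/
theorem reducible_of_disjuncts {X S : Cirquent} {P a b : ℕ} (h : S.SurfaceOccurs X)
    (ha : S.Disjunct (.pos P a)) (hb : S.Disjunct (.neg P b)) (hP : X.Pseudoelementary P) :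
    X.Reducible := by
  obtain ⟨A, B, hs, hAB⟩ := exists_or_of_disjuncts (by simp) ha hb
  have hs := hs.trans h
  obtain ⟨Y, hY, hs⟩ : ∃ Y, X.Rearranges Y ∧
      (or (lit (.pos P a)) (lit (.neg P b))).SurfaceOccurs Y := by
    rcases hAB with ⟨hA, hB⟩ | ⟨hA, hB⟩
    · exact rearranges_adjacent hs hA hB
    · obtain ⟨Y, hY, hs⟩ := rearranges_adjacent hs hA hB
      obtain ⟨Z, hZ, hs⟩ := rearranges_comm hs
      exact ⟨Z, hY.trans hZ, hs⟩
  refine hY.reducible (reducible_of_replace hs (.trivialization Y P a b hs.occurs ?_)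
    (fun _ _ _ _ => trivial) (two_rpow_add_one_le ?_ ?_))
  · simpa only [Pseudoelementary, HasLetter, hY.hasLiteral] using hP
  · simp [logRank]
  · simp only [logRank]; norm_num

/-- What remains of a cirquent to which no reduction applies. -/
theorem irreducible_cases {X : Cirquent} {μ : Set (ℕ × ℕ × ℕ)} (hX : ¬ X.Reducible)
    (hμ : ∀ P a b, (P, a, b) ∈ μ → X.HasLiteral (.pos P a) → X.HasLiteral (.neg P b) →
      X.Pseudoelementary P) {S : Cirquent} (hS : S.SurfaceOccurs X) :
    S = top ∨ (∃ c A B, S = chand c A B) ∨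
      ∃ v, Compat μ v ∧ ¬ S.eval (fun _ => none) (fun _ => none) v := by
  -- A clause is refuted by making all of its literals false.
  have clause : ∀ (v : Literal → Prop) (T : Cirquent), T.SurfaceOccurs X → T ≠ top →
      (∀ A B, T ≠ and A B) → (∀ c A B, T ≠ chand c A B) → (∀ L, T.Disjunct L → ¬ v L) →
      ¬ T.eval (fun _ => none) (fun _ => none) v := by
    intro v T hT h1 h2 h3 hv
    induction T with
    | top => exact absurd rfl h1
    | bot => exact id
    | lit L => exact hv L rfl
    | and A B => exact absurd rfl (h2 A B)
    | chand c A B => exact absurd rfl (h3 c A B)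
    | chor c A B => simp [eval]
    | or A B ihA ihB =>
      obtain ⟨Y, hY, hs⟩ := rearranges_comm hT
      rintro (h | h)
      · refine ihA hT.or_left ?_ ?_ ?_
          (fun L hL => hv L (Or.inl hL)) h
        · rintro rfl; exact hX (hY.reducible (reducible_or_top hs))
        · rintro C D rfl; exact hX (reducible_or_and hT)
        · rintro c C D rfl; exact hX (reducible_or_chand hT)
      · refine ihB hT.or_right ?_ ?_ ?_
          (fun L hL => hv L (Or.inr hL)) h
        · rintro rfl; exact hX (reducible_or_top hT)
        · rintro C D rfl; exact hX (hY.reducible (reducible_or_and hs))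
        · rintro c C D rfl; exact hX (hY.reducible (reducible_or_chand hs))
  have refute : ∀ S : Cirquent, S.SurfaceOccurs X → S ≠ top → (∀ A B, S ≠ and A B) → (∀ c A B, S ≠ chand c A B) →
      ∃ v, Compat μ v ∧ ¬ S.eval (fun _ => none) (fun _ => none) v := by
    intro S hS h1 h2 h3
    refine ⟨fun L => ¬ S.Disjunct L, fun P a b hm => ?_,
      clause _ S hS h1 h2 h3 fun L hL h => h hL⟩
    by_contra hcon
    push Not at hcon
    exact hX (reducible_of_disjuncts hS hcon.1 hcon.2 (hμ P a b hm
      (occurs_trans hcon.1.hasLiteral hS.occurs) (occurs_trans hcon.2.hasLiteral hS.occurs)))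
  induction S with
  | top => exact Or.inl rfl
  | chand c A B => exact Or.inr (Or.inl ⟨c, A, B, rfl⟩)
  | bot | lit | chor => exact Or.inr (Or.inr (refute _ hS (by simp) (by simp) (by simp)))
  | or A B => exact Or.inr (Or.inr (refute _ hS (by simp) (by simp) (by simp)))
  | and A B ihA ihB =>
    right; right
    rcases ihA hS.and_left with rfl | ⟨c, C, D, rfl⟩ | ⟨v, hv, h⟩
    · exact absurd (reducible_top_and hS) hX
    · rcases ihB hS.and_right with rfl | ⟨d, E, F, rfl⟩ | ⟨v, hv, h⟩
      · exact absurd (reducible_and_top hS) hX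
      · exact absurd (reducible_chand_and_chand hS) hX
      · exact ⟨v, hv, fun h' => h h'.2⟩
    · exact ⟨v, hv, fun h' => h h'.1⟩

theorem sizeOf_replace_le {S T : Cirquent} (h : sizeOf T ≤ sizeOf S) (X : Cirquent) :
    sizeOf (X.replace S T) ≤ sizeOf X := by
  refine replace_rel (R := fun A B => sizeOf B ≤ sizeOf A) h le_rfl le_rfl (fun _ => le_rfl)
    ?_ ?_ ?_ ?_ X <;> intros <;>
    simp only [or.sizeOf_spec, and.sizeOf_spec, chand.sizeOf_spec, chor.sizeOf_spec] <;> omega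

theorem sizeOf_replace_lt {S T X : Cirquent} (h : sizeOf T < sizeOf S) (hS : S.Occurs X) :
    sizeOf (X.replace S T) < sizeOf X := by
  induction X with
  | top | bot | lit => simp only [Occurs] at hS; subst hS; rwa [replace_self]
  | or A B ihA ihB | and A B ihA ihB | chand c A B ihA ihB | chor c A B ihA ihB =>
    have hA := sizeOf_replace_le h.le A
    have hB := sizeOf_replace_le h.le B
    rw [replace]
    split_ifs with h'
    · rwa [← h']
    · simp only [or.sizeOf_spec, and.sizeOf_spec, chand.sizeOf_spec, chor.sizeOf_spec]
      rcases hS with hS | hS | hS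
      · exact absurd hS h'
      · have := ihA hS; omega
      · have := ihB hS; omega

theorem exists_leftCleansing (c : ℕ) (Y C : Cirquent) : ∃ Y', ¬ Y'.HasChand c ∧
    (Provable (chand c Y' C) → Provable (chand c Y C)) ∧ Y'.logRank ≤ Y.logRank ∧
    ∀ σ τ v, (chand c Y C).eval σ τ v ↔ (chand c Y' C).eval σ τ v := by
  induction hn : sizeOf Y using Nat.strong_induction_on generalizing Y with
  | _ n ih =>
    by_cases hY : Y.HasChand c
    · obtain ⟨A, B, hAB⟩ := hY
      obtain ⟨Y', h1, h2, h3, h4⟩ := ih _ (hn ▸ sizeOf_replace_lt (T := A)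
        (by simp only [chand.sizeOf_spec]; omega) hAB) (Y.replace (chand c A B) A) rfl
      refine ⟨Y', h1, fun h => ?_, h3.trans (logRank_replace_le
        ((le_max_left _ _).trans (max_le_logRank_chand c A B)) Y),
        fun σ τ v => (eval_leftCleansing Y A B C c).trans (h4 σ τ v)⟩
      have := Infers.leftCleansing (chand c Y C) Y A B C c hAB (occurs_self _)
      rw [replace_self] at this
      exact .infer _ _ (h2 h) this
    · exact ⟨Y, hY, id, le_rfl, fun _ _ _ => Iff.rfl⟩

theorem exists_rightCleansing (c : ℕ) (Y C : Cirquent) : ∃ Y', ¬ Y'.HasChand c ∧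
    (Provable (chand c C Y') → Provable (chand c C Y)) ∧ Y'.logRank ≤ Y.logRank ∧
    ∀ σ τ v, (chand c C Y).eval σ τ v ↔ (chand c C Y').eval σ τ v := by
  induction hn : sizeOf Y using Nat.strong_induction_on generalizing Y with
  | _ n ih =>
    by_cases hY : Y.HasChand c
    · obtain ⟨A, B, hAB⟩ := hY
      obtain ⟨Y', h1, h2, h3, h4⟩ := ih _ (hn ▸ sizeOf_replace_lt (T := B)
        (by simp only [chand.sizeOf_spec]; omega) hAB) (Y.replace (chand c A B) B) rfl
      refine ⟨Y', h1, fun h => ?_, h3.trans (logRank_replace_le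
        ((le_max_right _ _).trans (max_le_logRank_chand c A B)) Y),
        fun σ τ v => (eval_rightCleansing Y A B C c).trans (h4 σ τ v)⟩
      have := Infers.rightCleansing (chand c C Y) Y A B C c hAB (occurs_self _)
      rw [replace_self] at this
      exact .infer _ _ (h2 h) this
    · exact ⟨Y, hY, id, le_rfl, fun _ _ _ => Iff.rfl⟩

/-- The environment may begin by making a choice. -/
theorem Winnable.of_chand {c : ℕ} {A B E : Cirquent} {i : Bool} (hX : (chand c A B).Winnable)
    (hE : E = if i then B else A) (hc : ¬ E.HasChand c) : E.Winnable := by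
  obtain ⟨W, h0, hW⟩ := hX.exists_good
  obtain ⟨τ₁, μ₁, -, -, -, -, -, h1⟩ := hW _ h0
  refine ⟨{s | ∃ s0 ∈ W, s0.σ c = some i ∧ (∀ d, d ≠ c → s0.σ d = s.σ d) ∧
    ChoiceLE s.τ s0.τ ∧ s.μ ⊆ s0.μ}, ?_, _, h1 c i rfl, by simp, fun d hd => by
      simp [Function.update_of_ne hd], fun _ _ h => by simp [GameState.start] at h,
      Set.empty_subset _⟩
  rintro s ⟨s0, hs0, hi, hσ, hτ, hμ⟩
  obtain ⟨τ', μ', k1, k2, k3, k4, k5, k6⟩ := hW _ hs0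
  refine ⟨τ', μ', hτ.trans k1, hμ.trans k2, k3, fun v hv => ?_, fun d j hd => ?_⟩
  · refine (eval_congr_chand E fun d hd => hσ d fun h => hc (h ▸ hd)).1 ?_
    have := k4 v hv
    cases i
    · exact hE ▸ this.1 hi
    · exact hE ▸ this.2 hi
  · by_cases hdc : d = c
    · subst hdc
      exact ⟨_, k5, hi, fun e he => by simp [Function.update_of_ne he, hσ e he],
        ChoiceLE.refl _, subset_rfl⟩
    · refine ⟨_, k6 d j ((hσ d hdc).trans hd), by simp [Function.update_of_ne (Ne.symm hdc), hi],
        fun e he => ?_, ChoiceLE.refl _, subset_rfl⟩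
      by_cases hed : e = d
      · subst hed; simp
      · simp [Function.update_of_ne hed, hσ e he]

/-- The proof is by induction on the rank; neither carrying out choices nor renaming literals raises
the rank. -/
theorem Winnable.provable {X : Cirquent} (hX : X.Winnable) : Provable X := by
  induction hn : X.rank using Nat.strong_induction_on generalizing X with
  | _ n ih =>
    obtain ⟨τ, μ₀, h0⟩ := hX.resolve
    obtain ⟨Y, μ, hp, hr, hY, hμ⟩ := h0.exists_pseudoelementary
    refine provable_of_resolve (hp ?_)
    have hrank : Y.rank ≤ n := hn ▸ rank_le (hr.le.trans (logRank_resolve_le τ X))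
    by_cases hred : Y.Reducible
    · obtain ⟨Z, h1, h2, h3⟩ := hred
      exact h1 (ih _ (h3.trans_le hrank) (hY.winnable.mono h2) rfl)
    · rcases irreducible_cases hred hμ (surfaceOccurs_self Y) with rfl | ⟨c, A, B, rfl⟩ | ⟨v, hv, h⟩
      · exact .top
      · obtain ⟨A', a1, a2, a3, a4⟩ := exists_leftCleansing c A B
        obtain ⟨B', b1, b2, b3, b4⟩ := exists_rightCleansing c B A'
        have hw : (chand c A' B').Winnable := hY.winnable.mono fun σ τ v h =>
          (b4 σ τ v).1 ((a4 σ τ v).1 h)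
        refine a2 (b2 (.splitting A' B' c ?_ ?_ a1 b1))
        · exact ih _ (((rank_le a3).trans_lt (rank_left_lt c A B)).trans_le hrank)
            (hw.of_chand (i := false) rfl a1) rfl
        · exact ih _ (((rank_le b3).trans_lt (rank_right_lt c A B)).trans_le hrank)
            (hw.of_chand (i := true) rfl b1) rfl
      · exact absurd (hY.2.1 v hv) h

end Cirquent

/-! ### Moves and their names -/

theorem digit_of_mem_numeral {n : ℕ} {k : Key} (h : k ∈ numeral n) : ∃ d, k = Key.digit d := by
  rw [numeral] at h
  split_ifs at h
  · exact ⟨0, by simpa using h⟩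
  · obtain ⟨d, -, rfl⟩ := List.mem_map.1 h
    exact ⟨_, rfl⟩

theorem numeral_injective : Function.Injective numeral := by
  let g : Key → ℕ := fun k => match k with | .digit d => d | _ => 0
  have key : ∀ n, Nat.ofDigits 10 ((numeral n).reverse.map g) = n := by
    intro n
    rw [numeral]
    split_ifs with h
    · simp [g, h]
    · rw [← List.map_reverse, List.reverse_reverse, List.map_map]
      have : (Nat.digits 10 n).map (g ∘ fun d => Key.digit (Fin.ofNat 10 d)) =
          Nat.digits 10 n := by
        conv_rhs => rw [← List.map_id (Nat.digits 10 n)]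
        refine List.map_congr_left fun d hd => ?_
        simp [g, Nat.mod_eq_of_lt (Nat.digits_lt_base (by norm_num) hd)]
      rw [this, Nat.ofDigits_digits]
  intro m n h
  rw [← key m, h, key n]

theorem numeral_append_inj {m n : ℕ} {k k' : Key} {r r' : List Key}
    (hk : ∀ d, k ≠ Key.digit d) (hk' : ∀ d, k' ≠ Key.digit d)
    (h : numeral m ++ k :: r = numeral n ++ k' :: r') : m = n ∧ k = k' ∧ r = r' := by
  have key : ∀ l l' : List Key, (∀ x ∈ l, ∃ d, x = Key.digit d) → (∀ x ∈ l', ∃ d, x = Key.digit d) →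
      l ++ k :: r = l' ++ k' :: r' → l = l' ∧ k = k' ∧ r = r' := by
    intro l
    induction l with
    | nil =>
      rintro (_ | ⟨y, l'⟩) _ h2 h
      · simpa using h
      · obtain ⟨d, rfl⟩ := h2 y (by simp)
        simp only [List.nil_append, List.cons_append, List.cons.injEq] at h
        exact absurd h.1 (hk d)
    | cons x l ih =>
      rintro (_ | ⟨y, l'⟩) h1 h2 h
      · obtain ⟨d, rfl⟩ := h1 x (by simp)
        simp only [List.nil_append, List.cons_append, List.cons.injEq] at h
        exact absurd h.1.symm (hk' d)
      · simp only [List.cons_append, List.cons.injEq] at h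
        obtain ⟨h3, h4⟩ := ih l' (fun x hx => h1 x (by simp [hx])) (fun x hx => h2 x (by simp [hx])) h.2
        exact ⟨by rw [h.1, h3], h4⟩
  obtain ⟨h1, h2⟩ := key _ _ (fun x => digit_of_mem_numeral) (fun x => digit_of_mem_numeral) h
  exact ⟨numeral_injective h1, h2⟩

theorem Literal.move_inj {L M : Literal} {α β : Move} (h : L.move α = M.move β) :
    L = M ∧ α = β := by
  rcases L with ⟨P, a⟩ | ⟨P, a⟩ <;> rcases M with ⟨Q, b⟩ | ⟨Q, b⟩ <;>
    simp only [Literal.move, Literal.name, List.cons_append, List.append_assoc, List.cons.injEq,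
      true_and, reduceCtorEq, false_and] at h
  all_goals
    obtain ⟨rfl, -, h⟩ := numeral_append_inj (by simp) (by simp) h
    obtain ⟨rfl, -, h⟩ := numeral_append_inj (by simp) (by simp) h
    exact ⟨rfl, h⟩

theorem Literal.name_injective : Function.Injective Literal.name := fun L M h =>
  (Literal.move_inj (α := []) (β := []) (by rw [Literal.move, Literal.move, h])).1

theorem Literal.strip_eq_some {L : Literal} {x y : Labmove} :
    L.strip x = some y ↔ x = (y.1, L.move y.2) := by
  classical
  unfold Literal.strip
  constructor
  · intro h
    split_ifs at h with hx
    obtain rfl := Option.some.inj h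
    exact Prod.ext rfl hx.choose_spec
  · rintro rfl
    have hx : ∃ α : Move, L.move y.2 = L.move α := ⟨_, rfl⟩
    rw [dif_pos hx, ← (Literal.move_inj hx.choose_spec).2]

theorem choiceKey_injective : Function.Injective choiceKey := by
  intro i j h
  cases i <;> cases j <;> simp [choiceKey] at h ⊢

theorem chandLabmove_inj {c d : ℕ} {i j : Bool} (h : chandLabmove c i = chandLabmove d j) :
    c = d ∧ i = j := by
  simp only [chandLabmove, List.cons_append, Prod.mk.injEq, List.cons.injEq, true_and] at h
  obtain ⟨rfl, -, h⟩ := numeral_append_inj (by simp) (by simp) h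
  exact ⟨rfl, choiceKey_injective (by simpa using h)⟩

theorem chorLabmove_inj {c d : ℕ} {i j : Bool} (h : chorLabmove c i = chorLabmove d j) :
    c = d ∧ i = j := by
  simp only [chorLabmove, List.cons_append, Prod.mk.injEq, List.cons.injEq, true_and] at h
  obtain ⟨rfl, -, h⟩ := numeral_append_inj (by simp) (by simp) h
  exact ⟨rfl, choiceKey_injective (by simpa using h)⟩

theorem chandLabmove_ne_move (c : ℕ) (i : Bool) (L : Literal) (α : Move) :
    (chandLabmove c i).2 ≠ L.move α := by
  cases L <;> simp [chandLabmove, Literal.move, Literal.name]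

theorem chorLabmove_ne_move (c : ℕ) (i : Bool) (L : Literal) (α : Move) :
    (chorLabmove c i).2 ≠ L.move α := by
  cases L <;> simp [chorLabmove, Literal.move, Literal.name]

/-- The choice made by the environment in the given labmove, if that is what it is. -/
noncomputable def chandOf (x : Labmove) : Option (ℕ × Bool) :=
  open Classical in
  if h : ∃ y : ℕ × Bool, x = chandLabmove y.1 y.2 then some h.choose else none

/-- The choice made by the machine in the given labmove, if that is what it is. -/
noncomputable def chorOf (x : Labmove) : Option (ℕ × Bool) :=
  open Classical in
  if h : ∃ y : ℕ × Bool, x = chorLabmove y.1 y.2 then some h.choose else none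

theorem chandOf_eq_some {x : Labmove} {c : ℕ} {i : Bool} :
    chandOf x = some (c, i) ↔ x = chandLabmove c i := by
  classical
  unfold chandOf
  constructor
  · intro h
    split_ifs at h with hx
    have := hx.choose_spec
    rwa [Option.some.inj h] at this
  · rintro rfl
    have hx : ∃ y : ℕ × Bool, chandLabmove c i = chandLabmove y.1 y.2 := ⟨(c, i), rfl⟩
    rw [dif_pos hx]
    obtain ⟨h1, h2⟩ := chandLabmove_inj hx.choose_spec
    rw [Option.some.injEq]
    exact Prod.ext h1.symm h2.symm

theorem chorOf_eq_some {x : Labmove} {c : ℕ} {i : Bool} :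
    chorOf x = some (c, i) ↔ x = chorLabmove c i := by
  classical
  unfold chorOf
  constructor
  · intro h
    split_ifs at h with hx
    have := hx.choose_spec
    rwa [Option.some.inj h] at this
  · rintro rfl
    have hx : ∃ y : ℕ × Bool, chorLabmove c i = chorLabmove y.1 y.2 := ⟨(c, i), rfl⟩
    rw [dif_pos hx]
    obtain ⟨h1, h2⟩ := chorLabmove_inj hx.choose_spec
    rw [Option.some.injEq]
    exact Prod.ext h1.symm h2.symm

/-! ### Legality -/

theorem get?_take {α : Type} (s : Stream'.Seq α) {m n : ℕ} :
    (s.take n)[m]? = if m < n then s.get? m else none := Stream'.Seq.getElem?_take ..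

theorem take_succ_of_get? {α : Type} {s : Stream'.Seq α} {n : ℕ} {x : α}
    (h : s.get? n = some x) : s.take (n + 1) = s.take n ++ [x] := by
  have hlen : (s.take n).length = n := by
    refine le_antisymm Stream'.Seq.length_take_le ?_
    by_contra hlt
    push Not at hlt
    have h1 : (s.take n)[(s.take n).length]? = none := List.getElem?_eq_none le_rfl
    rw [get?_take, if_pos hlt] at h1
    have := Stream'.Seq.le_stable s hlt.le h1
    rw [h] at this
    cases this
  apply List.ext_getElem?
  intro i
  rw [get?_take, List.getElem?_append, hlen, get?_take]
  rcases lt_trichotomy i n with hi | rfl | hi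
  · simp [hi, Nat.lt_succ_of_lt hi]
  · simp [h]
  · have : ¬ i < n + 1 := by omega
    have h2 : ¬ i < n := by omega
    have h3 : i - n ≠ 0 := by omega
    simp [this, h2, h3]

theorem take_succ_of_get?_none {α : Type} {s : Stream'.Seq α} {n : ℕ}
    (h : s.get? n = none) : s.take (n + 1) = s.take n := by
  apply List.ext_getElem?
  intro i
  rw [get?_take, get?_take]
  rcases lt_trichotomy i n with hi | rfl | hi
  · simp [hi, Nat.lt_succ_of_lt hi]
  · simp [h]
  · have : ¬ i < n + 1 := by omega
    have h2 : ¬ i < n := by omega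
    simp [this, h2]

theorem Game.exists_first_illegal (G : Game) {Γ : Run} (h : Γ ∉ G.legal) :
    ∃ n x, Stream'.Seq.ofList (Γ.take n) ∈ G.legal ∧
      Stream'.Seq.ofList (Γ.take (n + 1)) ∉ G.legal ∧ Γ.get? n = some x := by
  have hex : ∃ n, (Stream'.Seq.ofList (Γ.take n) : Run) ∉ G.legal := by
    by_contra hcon
    push Not at hcon
    have := G.sift_legal some Γ fun n => by rw [sift_ofList]; simpa using hcon n
    have h2 : sift some Γ = Γ := by
      ext n b
      rw [get?_sift_eq_some]
      simp only [List.filterMap_some, get?_take]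
      exact ⟨fun ⟨t, ht⟩ => by split_ifs at ht; exact ht, fun ht => ⟨n + 1, by simpa using ht⟩⟩
    rw [h2] at this
    exact h this
  classical
  obtain ⟨n, hn⟩ : ∃ n, Nat.find hex = n + 1 := Nat.exists_eq_succ_of_ne_zero fun h0 => by
    have := Nat.find_spec hex
    rw [h0] at this
    exact this (by simpa using G.empty_legal)
  have h1 : (Stream'.Seq.ofList (Γ.take n) : Run) ∈ G.legal := by
    by_contra hcon
    have := Nat.find_min' hex hcon
    omega
  have h2 : (Stream'.Seq.ofList (Γ.take (n + 1)) : Run) ∉ G.legal := hn ▸ Nat.find_spec hex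
  rcases hx : Γ.get? n with _ | x
  · rw [take_succ_of_get?_none hx] at h2
    exact absurd h1 h2
  · exact ⟨n, x, h1, h2, hx⟩

/-- A run is won by the machine if the machine never makes the first illegal move. -/
theorem Game.wonBy_machine (G : Game) {Γ : Run}
    (h : ∀ n α, Stream'.Seq.ofList (Γ.take n) ∈ G.legal → Γ.get? n = some (Player.machine, α) →
      Stream'.Seq.ofList (Γ.take (n + 1)) ∈ G.legal)
    (hw : Γ ∈ G.legal → G.win Γ = Player.machine) : G.WonBy Player.machine Γ := by
  by_cases hl : Γ ∈ G.legal
  · exact Or.inl ⟨hl, hw hl⟩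
  · right
    rintro (h' | ⟨n, α, h1, h2, h3⟩)
    · exact hl h'
    · exact h2 (h n α h1 h3)

theorem Game.WonBy.legal {G : Game} {Γ : Run} (hw : G.WonBy Player.machine Γ)
    (h : ∀ n α, Stream'.Seq.ofList (Γ.take n) ∈ G.legal →
      Γ.get? n = some (Player.environment, α) → Stream'.Seq.ofList (Γ.take (n + 1)) ∈ G.legal) :
    Γ ∈ G.legal ∧ G.win Γ = Player.machine := by
  rcases hw with hw | hw
  · exact hw
  · refine absurd ?_ hw
    by_cases hl : Γ ∈ G.legal
    · exact Or.inl hl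
    · obtain ⟨n, ⟨p, α⟩, h1, h2, h3⟩ := G.exists_first_illegal hl
      cases p
      · exact Or.inr ⟨n, α, h1, h2, h3⟩
      · exact absurd (h n α h1 h3) h2

theorem index_unique_iff {α β γ : Type} {l : List α} {f : α → Option (β × γ)} :
    ((l.filterMap f).map Prod.fst).Nodup ↔ ∀ (c : β) (i j : γ) (m n : ℕ) (x y : α),
      l[m]? = some x → l[n]? = some y → f x = some (c, i) → f y = some (c, j) → m = n := by
  rw [List.Nodup, List.pairwise_map, List.pairwise_filterMap, List.pairwise_iff_getElem]
  constructor
  · intro h c i j m n x y hx hy hfx hfy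
    obtain ⟨hm, rfl⟩ := List.getElem?_eq_some_iff.1 hx
    obtain ⟨hn, rfl⟩ := List.getElem?_eq_some_iff.1 hy
    rcases lt_trichotomy m n with hmn | hmn | hmn
    · exact absurd rfl (h m n hm hn hmn (c, i) hfx (c, j) hfy)
    · exact hmn
    · exact absurd rfl (h n m hn hm hmn (c, j) hfy (c, i) hfx)
  · rintro h m n hm hn hmn ⟨c, i⟩ hb ⟨d, j⟩ hb' rfl
    exact absurd (h c i j m n _ _ (List.getElem?_eq_getElem hm) (List.getElem?_eq_getElem hn) hb hb')
      (by omega)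

/-- The legality of a position, with the choices listed. -/
theorem Interpretation.legalRun_ofList (I : Interpretation) (Φ : Position) :
    I.LegalRun (Stream'.Seq.ofList Φ) ↔
      (∀ x ∈ Φ, InLiteral x ∨ IsChoice x) ∧
      (∀ L : Literal, Stream'.Seq.ofList (Φ.filterMap L.strip) ∈ (I.lit L).legal) ∧
      ((Φ.filterMap chandOf).map Prod.fst).Nodup ∧ ((Φ.filterMap chorOf).map Prod.fst).Nodup := by
  rw [index_unique_iff, index_unique_iff]
  refine and_congr ?_ (and_congr ?_ (and_congr ?_ ?_))
  · constructor
    · intro h x hx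
      obtain ⟨n, hn⟩ := List.mem_iff_getElem?.1 hx
      exact h x ⟨n, hn⟩
    · rintro h x ⟨n, hn⟩
      exact h x (List.mem_iff_getElem?.2 ⟨n, hn⟩)
  · simp only [Run.inLit, sift_ofList]
  · simp only [chandOf_eq_some]
    constructor
    · rintro h c i j m n x y hx hy rfl rfl
      exact h c i j m n hx hy
    · intro h c i j m n hm hn
      exact h c i j m n _ _ hm hn rfl rfl
  · simp only [chorOf_eq_some]
    constructor
    · rintro h c i j m n x y hx hy rfl rfl
      exact h c i j m n hx hy
    · intro h c i j m n hm hn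
      exact h c i j m n _ _ hm hn rfl rfl

theorem Interpretation.legalRun_append (I : Interpretation) {Φ : Position} {x : Labmove}
    (h : I.LegalRun (Stream'.Seq.ofList Φ)) (hx : InLiteral x ∨ IsChoice x)
    (hL : ∀ L y, L.strip x = some y →
      Stream'.Seq.ofList (Φ.filterMap L.strip ++ [y]) ∈ (I.lit L).legal)
    (hand : ∀ c i j, chandOf x = some (c, i) → chandLabmove c j ∉ Φ)
    (hor : ∀ c i j, chorOf x = some (c, i) → chorLabmove c j ∉ Φ) :
    I.LegalRun (Stream'.Seq.ofList (Φ ++ [x])) := by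
  rw [I.legalRun_ofList] at h ⊢
  obtain ⟨h1, h2, h3, h4⟩ := h
  refine ⟨fun y hy => ?_, fun L => ?_, ?_, ?_⟩
  · rcases List.mem_append.1 hy with hy | hy
    · exact h1 y hy
    · rw [List.mem_singleton.1 hy]; exact hx
  · rw [List.filterMap_append]
    rcases hs : L.strip x with _ | y
    · simpa [hs] using h2 L
    · simpa [hs] using hL L y hs
  · rw [List.filterMap_append]
    rcases hs : chandOf x with _ | ⟨c, i⟩
    · simpa [hs] using h3
    · rw [show [x].filterMap chandOf = [(c, i)] by simp [hs], List.map_append, List.nodup_append]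
      refine ⟨h3, by simp, ?_⟩
      simp only [List.map_cons, List.map_nil, List.mem_singleton, List.mem_map, List.mem_filterMap]
      rintro _ ⟨⟨d, j⟩, ⟨y, hy, hyd⟩, rfl⟩ _ rfl rfl
      rw [chandOf_eq_some] at hyd
      exact hand _ i j hs (hyd ▸ hy)
  · rw [List.filterMap_append]
    rcases hs : chorOf x with _ | ⟨c, i⟩
    · simpa [hs] using h4
    · rw [show [x].filterMap chorOf = [(c, i)] by simp [hs], List.map_append, List.nodup_append]
      refine ⟨h4, by simp, ?_⟩
      simp only [List.map_cons, List.map_nil, List.mem_singleton, List.mem_map, List.mem_filterMap]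
      rintro _ ⟨⟨d, j⟩, ⟨y, hy, hyd⟩, rfl⟩ _ rfl rfl
      rw [chorOf_eq_some] at hyd
      exact hor _ i j hs (hyd ▸ hy)

/-! ### Runs of machines -/

theorem HPM.position_step (H : HPM) (e : List Move) (c : H.Config) :
    ∃ l : List Move, (H.step e c).position = c.position ++ e.map (fun α => (Player.environment, α)) ++
      l.map fun α => (Player.machine, α) := by
  simp only [HPM.step]
  split
  · exact ⟨[c.buffer], by simp⟩
  · exact ⟨[], by simp⟩

theorem HPM.position_prefix (H : HPM) (env : ℕ → List Move) {s t : ℕ} (h : s ≤ t) :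
    (H.configAt env s).position <+: (H.configAt env t).position := by
  induction t, h using Nat.le_induction with
  | base => exact List.prefix_rfl
  | succ t _ ih =>
    obtain ⟨l, hl⟩ := H.position_step (env t) (H.configAt env t)
    refine ih.trans ?_
    rw [HPM.configAt, hl, List.append_assoc]
    exact List.prefix_append _ _

theorem HPM.get?_run (H : HPM) (env : ℕ → List Move) {n : ℕ} {x : Labmove} :
    (H.run env).get? n = some x ↔ ∃ t, (H.configAt env t).position[n]? = some x :=
  get?_limit_eq_some (fun _ _ h => H.position_prefix env h) n x

theorem HPM.run_has (H : HPM) (env : ℕ → List Move) {x : Labmove} :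
    (H.run env).Has x ↔ ∃ t, x ∈ (H.configAt env t).position := by
  simp only [Run.Has, H.get?_run, List.mem_iff_getElem?]
  exact exists_comm

theorem HPM.take_run (H : HPM) (env : ℕ → List Move) (t : ℕ) :
    (H.run env).take (H.configAt env t).position.length = (H.configAt env t).position :=
  ofList_take_of_prefix fun _ _ hb => (H.get?_run env).2 ⟨t, hb⟩

theorem HPM.exists_take_run (H : HPM) (env : ℕ → List Move) (n : ℕ) :
    ∃ t, (H.run env).take n <+: (H.configAt env t).position := by
  induction n with
  | zero => exact ⟨0, by simp⟩
  | succ n ih =>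
    rcases hx : (H.run env).get? n with _ | x
    · rwa [take_succ_of_get?_none hx]
    · obtain ⟨t, ht⟩ := (H.get?_run env).1 hx
      refine ⟨t, ?_⟩
      have hlt : n + 1 ≤ (H.configAt env t).position.length :=
        (List.getElem?_eq_some_iff.1 ht).1
      rw [← H.take_run env t]
      exact take_prefix_take _ hlt

theorem sift_sift {α β γ : Type} (f : α → Option β) (g : β → Option γ) (s : Stream'.Seq α) :
    sift g (sift f s) = sift (fun x => (f x).bind g) s := by
  ext n b
  rw [get?_sift_eq_some, get?_sift_eq_some]
  simp only [← List.filterMap_filterMap]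
  constructor
  · rintro ⟨k, hk⟩
    obtain ⟨t, ht⟩ := exists_take_take f s k
    exact ⟨t, prefix_get ((List.take_prefix k _).filterMap g) (ht ▸ hk)⟩
  · rintro ⟨t, ht⟩
    obtain ⟨k, hk⟩ := exists_take_sift f s t
    exact ⟨k, by rwa [hk]⟩

/-- The move made by `p` in the copies of `L`, if that is what the given labmove is. -/
noncomputable def Literal.moveBy (L : Literal) (p : Player) (x : Labmove) : Option Move :=
  (L.strip x).bind fun y => if y.1 = p then some y.2 else none

theorem Literal.moveBy_eq_some {L : Literal} {p : Player} {x : Labmove} {α : Move} :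
    L.moveBy p x = some α ↔ x = (p, L.move α) := by
  simp only [Literal.moveBy, Option.bind_eq_some_iff, Literal.strip_eq_some]
  constructor
  · rintro ⟨y, rfl, h⟩
    split_ifs at h with hy
    rw [← Option.some.inj h, hy]
  · rintro rfl
    exact ⟨(p, α), rfl, by simp⟩

theorem movesOf_inLit (Γ : Run) (L : Literal) (p : Player) :
    (Γ.inLit L).movesOf p = sift (L.moveBy p) Γ := by
  rw [Run.movesOf, Run.inLit, sift_sift]
  rfl


/-! ### Valid cirquents are winnable -/

theorem bar_movesOf (Γ : Run) (p : Player) : Γ.bar.movesOf p = Γ.movesOf p.opp := by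
  simp only [Run.movesOf, sift, bar_take, List.filterMap_map]
  congr
  funext m
  congr
  funext x
  obtain ⟨q, α⟩ := x
  cases p <;> cases q <;> simp [Player.opp]

/-- A game in which all runs are legal, and the winner depends on the first moves of the two
players only. -/
noncomputable def firstMoveGame (K : Option Move → Option Move → Player) : Game where
  legal := Set.univ
  win Γ := K ((Γ.movesOf .machine).get? 0) ((Γ.movesOf .environment).get? 0)
  nonempty := ⟨Stream'.Seq.nil, trivial⟩
  prefix_closed _ _ _ := trivial
  limit_closed _ _ _ := trivial

theorem firstMoveGame_static (K : Option Move → Option Move → Player) :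
    (firstMoveGame K).Static := by
  intro p Υ Γ h
  refine ⟨fun _ => Or.inl trivial, ?_⟩
  rintro (⟨_, hw⟩ | hw)
  · refine Or.inl ⟨trivial, ?_⟩
    simpa only [firstMoveGame, h.1] using hw
  · exact absurd (Or.inl trivial) hw

/-- The first move made by `p` in the copies of `L`. -/
noncomputable def Run.firstMove (Γ : Run) (L : Literal) (p : Player) : Option Move :=
  (sift (L.moveBy p) Γ).get? 0

theorem win_pos {I : Interpretation} {K : Option Move → Option Move → Player} {P : ℕ}
    (h : I.letter P = firstMoveGame K) (Γ : Run) (a : ℕ) :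
    (I.lit (.pos P a)).win (Γ.inLit (.pos P a)) =
      K (Γ.firstMove (.pos P a) .machine) (Γ.firstMove (.pos P a) .environment) := by
  simp only [Interpretation.lit, h, firstMoveGame, movesOf_inLit, Run.firstMove]

theorem win_neg {I : Interpretation} {K : Option Move → Option Move → Player} {P : ℕ}
    (h : I.letter P = firstMoveGame K) (Γ : Run) (a : ℕ) :
    (I.lit (.neg P a)).win (Γ.inLit (.neg P a)) =
      (K (Γ.firstMove (.neg P a) .environment) (Γ.firstMove (.neg P a) .machine)).opp := by
  simp only [Interpretation.lit, h, Game.neg, firstMoveGame, bar_movesOf, movesOf_inLit,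
    Run.firstMove, Player.opp]

namespace Cirquent

/-- The set of the clusters of the machine's choices in a cirquent. -/
def chors : Cirquent → Finset ℕ
  | .top | .bot | .lit _ => ∅
  | .or A B | .and A B | .chand _ A B => A.chors ∪ B.chors
  | .chor c A B => insert c (A.chors ∪ B.chors)

/-- The moves with which the environment opens the play: in every literal it writes the name of the
literal. -/
noncomputable def openingMoves (C : Cirquent) : List Move :=
  C.literals.toList.map fun L => L.move L.name

/-- The moves of an environment that opens the play as above and makes the choice `i` in the cluster
`c` at the time `t` for every member `(t, c, i)` of a list. -/
noncomputable def challenge (C : Cirquent) (e : List (ℕ × ℕ × Bool)) (t : ℕ) : List Move :=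
  (if t = 0 then C.openingMoves else []) ++
    (e.filter fun x => x.1 = t).map fun x => (chandLabmove x.2.1 x.2.2).2

end Cirquent

theorem HPM.mem_position_environment (H : HPM) (env : ℕ → List Move) {t : ℕ} {α : Move} :
    (Player.environment, α) ∈ (H.configAt env t).position ↔ ∃ s < t, α ∈ env s := by
  induction t with
  | zero => simp [HPM.configAt, HPM.init]
  | succ t ih =>
    obtain ⟨l, hl⟩ := H.position_step (env t) (H.configAt env t)
    rw [HPM.configAt, hl]
    simp only [List.mem_append, List.mem_map, ih, Prod.mk.injEq, true_and, exists_eq_right,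
      reduceCtorEq, false_and, and_false, exists_false, or_false]
    constructor
    · rintro (⟨s, hs, h⟩ | h)
      · exact ⟨s, by omega, h⟩
      · exact ⟨t, by omega, h⟩
    · rintro ⟨s, hs, h⟩
      rcases Nat.lt_succ_iff_lt_or_eq.1 hs with hs | rfl
      · exact Or.inl ⟨s, hs, h⟩
      · exact Or.inr h

theorem HPM.configAt_congr (H : HPM) {env env' : ℕ → List Move} {t : ℕ}
    (h : ∀ s < t, env s = env' s) : H.configAt env t = H.configAt env' t := by
  induction t with
  | zero => rfl
  | succ t ih =>
    rw [HPM.configAt, HPM.configAt, ih fun s hs => h s (by omega), h t (by omega)]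

theorem chandOf_move (p : Player) (L : Literal) (α : Move) : chandOf (p, L.move α) = none := by
  by_contra h
  obtain ⟨⟨c, i⟩, h⟩ := Option.ne_none_iff_exists'.1 h
  rw [chandOf_eq_some] at h
  exact chandLabmove_ne_move c i L α (by rw [← h])

theorem chandOf_machine (α : Move) : chandOf (.machine, α) = none := by
  by_contra h
  obtain ⟨⟨c, i⟩, h⟩ := Option.ne_none_iff_exists'.1 h
  rw [chandOf_eq_some] at h
  simp [chandLabmove] at h

theorem Cirquent.challenge_chands (C : Cirquent) (e : List (ℕ × ℕ × Bool)) (H : HPM) (t : ℕ) :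
    (H.configAt (C.challenge e) t).position.filterMap chandOf =
      (List.range t).flatMap fun s => (e.filter fun x => x.1 = s).map Prod.snd := by
  induction t with
  | zero => simp [HPM.configAt, HPM.init]
  | succ t ih =>
    obtain ⟨l, hl⟩ := H.position_step (C.challenge e t) (H.configAt (C.challenge e) t)
    rw [HPM.configAt, hl, List.filterMap_append, List.filterMap_append, ih, List.range_succ,
      List.flatMap_append, List.filterMap_map, List.filterMap_map]
    have h1 : l.filterMap (chandOf ∘ fun α => (Player.machine, α)) = [] := by
      simp [chandOf_machine]
    rw [h1, List.append_nil]
    congr 1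
    rw [Cirquent.challenge, List.filterMap_append]
    have h2 : (if t = 0 then C.openingMoves else []).filterMap
        (chandOf ∘ fun α => (Player.environment, α)) = [] := by
      split_ifs
      · simp [Cirquent.openingMoves, chandOf_move]
      · rfl
    rw [h2, List.nil_append, List.filterMap_map, List.flatMap_cons, List.flatMap_nil,
      List.append_nil]
    generalize (e.filter fun x => x.1 = t) = l'
    induction l' with
    | nil => rfl
    | cons x l' ih =>
      have : ((chandOf ∘ fun α => (Player.environment, α)) ∘
          fun x : ℕ × ℕ × Bool => (chandLabmove x.2.1 x.2.2).2) x = some x.2 :=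
        chandOf_eq_some.2 rfl
      rw [List.filterMap_cons_some this, ih, List.map_cons]

theorem Cirquent.challenge_nodup (C : Cirquent) {e : List (ℕ × ℕ × Bool)} (H : HPM) (t : ℕ)
    (he : (e.map fun x => x.2.1).Nodup) :
    (((H.configAt (C.challenge e) t).position.filterMap chandOf).map Prod.fst).Nodup := by
  rw [C.challenge_chands, List.map_flatMap, List.nodup_flatMap]
  simp only [List.map_map]
  have hinj := List.inj_on_of_nodup_map he
  refine ⟨fun s _ => ?_, ?_⟩
  · exact he.sublist ((List.filter_sublist (l := e)).map _)
  · refine List.pairwise_lt_range.imp fun {a b} hab => ?_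
    rw [Function.onFun, List.disjoint_left]
    intro c hc hc'
    obtain ⟨x, hx, rfl⟩ := List.mem_map.1 hc
    obtain ⟨y, hy, hxy⟩ := List.mem_map.1 hc'
    simp only [List.mem_filter, decide_eq_true_eq] at hx hy
    have := hinj hy.1 hx.1 hxy
    subst this
    omega

theorem mem_of_sift_get? {α β : Type} {f : α → Option β} {s : Stream'.Seq α} {n : ℕ} {b : β}
    (h : (sift f s).get? n = some b) : ∃ x m, s.get? m = some x ∧ f x = some b := by
  rw [get?_sift_eq_some] at h
  obtain ⟨t, ht⟩ := h
  obtain ⟨x, hx, hb⟩ := List.mem_filterMap.1 (List.mem_iff_getElem?.2 ⟨n, ht⟩)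
  obtain ⟨m, hm⟩ := List.mem_iff_getElem?.1 hx
  rw [get?_take] at hm
  split_ifs at hm
  exact ⟨x, m, hm, hb⟩

theorem sift_get?_zero_of_mem {α β : Type} {f : α → Option β} {s : Stream'.Seq α} {m : ℕ} {x : α}
    {b : β} (hm : s.get? m = some x) (h : f x = some b) : ∃ b', (sift f s).get? 0 = some b' := by
  have hx : x ∈ s.take (m + 1) := List.mem_iff_getElem?.2 ⟨m, by simpa [get?_take] using hm⟩
  have hb := List.mem_filterMap.2 ⟨x, hx, h⟩
  have hlen := List.length_pos_of_mem hb
  exact ⟨_, (get?_sift_eq_some f s 0 _).2 ⟨m + 1, List.getElem?_eq_getElem hlen⟩⟩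

/-- At the given position the machine has, as its first moves in `P^a` and `¬P^b`, repeated the
first moves of the environment in `¬P^b` and `P^a`. -/
def Cirquent.MatchedAt (C : Cirquent) (Φ : Position) (P a b : ℕ) : Prop :=
  Literal.pos P a ∈ C.literals ∧ Literal.neg P b ∈ C.literals ∧
  (Φ.filterMap ((Literal.pos P a).moveBy .machine))[0]? = some (Literal.neg P b).name ∧
  (Φ.filterMap ((Literal.neg P b).moveBy .machine))[0]? = some (Literal.pos P a).name

theorem Cirquent.MatchedAt.mono {C : Cirquent} {Φ Ψ : Position} {P a b : ℕ} (h : Φ <+: Ψ)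
    (hm : C.MatchedAt Φ P a b) : C.MatchedAt Ψ P a b :=
  ⟨hm.1, hm.2.1, prefix_get (h.filterMap _) hm.2.2.1, prefix_get (h.filterMap _) hm.2.2.2⟩

theorem Cirquent.isMatching_matchedAt (C : Cirquent) (Φ : Position) :
    IsMatching {x | C.MatchedAt Φ x.1 x.2.1 x.2.2} := by
  rintro P a b a' b' ⟨-, -, h1, h2⟩ ⟨-, -, h3, h4⟩
  constructor
  · rintro rfl
    have := Literal.name_injective (Option.some.inj (h1.symm.trans h3))
    injection this
  · rintro rfl
    have := Literal.name_injective (Option.some.inj (h2.symm.trans h4))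
    injection this

theorem HPM.exists_sift_get? (H : HPM) (env : ℕ → List Move) {β : Type} {f : Labmove → Option β}
    {n : ℕ} {b : β} (h : (sift f (H.run env)).get? n = some b) :
    ∃ t, ((H.configAt env t).position.filterMap f)[n]? = some b := by
  obtain ⟨m, hm⟩ := (get?_sift_eq_some _ _ _ _).1 h
  obtain ⟨t, ht⟩ := H.exists_take_run env m
  exact ⟨t, prefix_get (ht.filterMap f) hm⟩

namespace Cirquent

variable {C : Cirquent} {e : List (ℕ × ℕ × Bool)} {H : HPM}

theorem mem_challenge {t : ℕ} {α : Move} : α ∈ C.challenge e t ↔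
    (t = 0 ∧ ∃ L ∈ C.literals, α = L.move L.name) ∨
      ∃ c i, (t, c, i) ∈ e ∧ α = (chandLabmove c i).2 := by
  simp only [challenge, List.mem_append, List.mem_map, List.mem_filter, decide_eq_true_eq,
    openingMoves]
  refine or_congr ?_ ?_
  · split_ifs with h
    · simp only [List.mem_map, Finset.mem_toList, h, true_and]
      exact exists_congr fun L => and_congr_right fun _ => eq_comm
    · simp [h]
  · constructor
    · rintro ⟨⟨_, c, i⟩, ⟨h, rfl⟩, rfl⟩; exact ⟨c, i, h, rfl⟩
    · rintro ⟨c, i, h, rfl⟩; exact ⟨_, ⟨h, rfl⟩, rfl⟩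

theorem challenge_has_chand {c : ℕ} {i : Bool} :
    (H.run (C.challenge e)).Has (chandLabmove c i) ↔ ∃ t, (t, c, i) ∈ e := by
  rw [H.run_has]
  have : ∀ t, chandLabmove c i ∈ (H.configAt (C.challenge e) t).position ↔ _ :=
    fun t => H.mem_position_environment (C.challenge e) (t := t) (α := (chandLabmove c i).2)
  simp only [this, mem_challenge]
  constructor
  · rintro ⟨t, s, hs, ⟨-, L, -, h⟩ | ⟨d, j, h, hdj⟩⟩
    · exact absurd h (chandLabmove_ne_move _ _ _ _)
    · obtain ⟨rfl, rfl⟩ := chandLabmove_inj (Prod.ext (by rfl) hdj)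
      exact ⟨s, h⟩
  · rintro ⟨t, ht⟩
    exact ⟨t + 1, t, by omega, Or.inr ⟨c, i, ht, rfl⟩⟩

theorem challenge_firstMove {L : Literal} (hL : L ∈ C.literals) :
    (H.run (C.challenge e)).firstMove L .environment = some L.name := by
  have hex : (H.run (C.challenge e)).Has (.environment, L.move L.name) := by
    rw [H.run_has]
    exact ⟨1, (H.mem_position_environment _).2 ⟨0, by omega, mem_challenge.2
      (Or.inl ⟨rfl, L, hL, rfl⟩)⟩⟩
  obtain ⟨m, hm⟩ := hex
  obtain ⟨β, hβ⟩ := sift_get?_zero_of_mem (f := L.moveBy .environment) hm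
    (Literal.moveBy_eq_some.2 rfl)
  rw [Run.firstMove, hβ]
  obtain ⟨x, k, hk, hx⟩ := mem_of_sift_get? hβ
  rw [Literal.moveBy_eq_some] at hx
  subst hx
  obtain ⟨t, ht⟩ := (H.run_has _).1 ⟨k, hk⟩
  obtain ⟨s, -, hs⟩ := (H.mem_position_environment _).1 ht
  rcases mem_challenge.1 hs with ⟨-, M, -, h⟩ | ⟨c, i, -, h⟩
  · obtain ⟨rfl, rfl⟩ := Literal.move_inj h
    rfl
  · exact absurd h.symm (chandLabmove_ne_move _ _ _ _)

/-- No matter how the letters are interpreted by games with no illegal moves, a logical solution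
plays legally and wins. -/
theorem challenge_won (hH : H.IsLogicalSolution C) (he : (e.map fun x => x.2.1).Nodup)
    {I : Interpretation} (hI : ∀ P, (I.letter P).legal = Set.univ) :
    I.LegalRun (H.run (C.challenge e)) ∧ C.Won I (H.run (C.challenge e)) := by
  have hleg : ∀ n α, Stream'.Seq.ofList ((H.run (C.challenge e)).take n) ∈ (C.game I).legal →
      (H.run (C.challenge e)).get? n = some (Player.environment, α) →
      Stream'.Seq.ofList ((H.run (C.challenge e)).take (n + 1)) ∈ (C.game I).legal := ?_
  · obtain ⟨h1, h2⟩ := (hH I (C.challenge e)).legal hleg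
    refine ⟨h1, ?_⟩
    simp only [Cirquent.game] at h2
    by_contra hcon
    rw [if_neg hcon] at h2
    cases h2
  · intro n α hn hα
    rw [take_succ_of_get? hα]
    obtain ⟨t, ht⟩ := H.exists_take_run (C.challenge e) (n + 1)
    have hmem : (Player.environment, α) ∈ (H.configAt (C.challenge e) t).position :=
      ht.subset (by rw [take_succ_of_get? hα]; simp)
    obtain ⟨s, -, hs⟩ := (H.mem_position_environment _).1 hmem
    refine I.legalRun_append hn ?_ ?_ ?_ ?_
    · rcases mem_challenge.1 hs with ⟨-, M, -, h⟩ | ⟨c, i, -, h⟩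
      · exact Or.inl ⟨M, _, h⟩
      · exact Or.inr ⟨c, i, Or.inl (Prod.ext rfl h)⟩
    · rintro (⟨P, a⟩ | ⟨P, a⟩) y _
      · simp only [Interpretation.lit, hI]; exact trivial
      · simp only [Interpretation.lit, Game.neg, hI]; exact trivial
    · intro c i j hc hmem'
      obtain ⟨m, hm⟩ := List.mem_iff_getElem?.1 hmem'
      have hmn : m < n := by
        rw [get?_take] at hm; by_contra h; simp [h] at hm
      have := index_unique_iff.1 (C.challenge_nodup H t he) c j i m n _ _
        (prefix_get ((take_prefix_take _ n.le_succ).trans ht) hm)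
        (prefix_get ht (by simpa [get?_take] using hα))
        (chandOf_eq_some.2 rfl) hc
      omega
    · intro c i j hc
      rw [chorOf_eq_some] at hc
      simp [chorLabmove] at hc

/-- The winners in a letter `P` that give the literals at most the values `v`, when the literals are
opened by the environment by writing their names, and `m` says how they are opened by the machine. -/
noncomputable def adversary (C : Cirquent) (m : Literal → Option Move) (v : Literal → Prop) (P : ℕ)
    (x y : Option Move) : Player :=
  open Classical in
  if (∃ a, y = some (Literal.pos P a).name ∧ x = m (.pos P a) ∧ v (.pos P a)) ∨
    (∃ b, Literal.neg P b ∈ C.literals ∧ x = some (Literal.neg P b).name ∧ y = m (.neg P b) ∧ ¬ v (.neg P b))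
  then .machine else .environment

theorem adversary_eq_machine {m : Literal → Option Move} {v : Literal → Prop} {P : ℕ}
    {x y : Option Move} : C.adversary m v P x y = .machine ↔
      (∃ a, y = some (Literal.pos P a).name ∧ x = m (.pos P a) ∧ v (.pos P a)) ∨
      (∃ b, Literal.neg P b ∈ C.literals ∧ x = some (Literal.neg P b).name ∧ y = m (.neg P b) ∧
        ¬ v (.neg P b)) := by
  unfold adversary
  split_ifs with h <;> simp [h]

end Cirquent

theorem some_name_inj {L M : Literal} (h : some L.name = some M.name) : L = M :=
  Literal.name_injective (Option.some.inj h)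

open Cirquent in
/-- The set of states consists of those reached by the machine at some time against an environment
whose choices are made at prescribed times. The next choice of the environment is scheduled for a
time at which the machine has no more relevant moves to make if left alone. -/
theorem Cirquent.Valid.winnable {C : Cirquent} (hC : C.Valid) : C.Winnable := by
  classical
  obtain ⟨H, hH⟩ := hC
  refine ⟨{s | ∃ e T, (e.map fun x => x.2.1).Nodup ∧ (∀ x ∈ e, x.1 < T) ∧
    (∀ c i, s.σ c = some i ↔ ∃ t, (t, c, i) ∈ e) ∧
    (∀ c i, s.τ c = some i → chorLabmove c i ∈ (H.configAt (C.challenge e) T).position) ∧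
    ∀ x ∈ s.μ, C.MatchedAt (H.configAt (C.challenge e) T).position x.1 x.2.1 x.2.2}, ?_,
    [], 0, by simp, by simp, by simp [GameState.start], by simp [GameState.start],
    by simp [GameState.start]⟩
  rintro ⟨σ, τ, μ⟩ ⟨e, T, he, heT, hσ, hτ, hμ⟩
  set env := C.challenge e with henv
  -- From some time on nothing relevant is going to happen.
  obtain ⟨T', hTT', hchor, hmatch⟩ : ∃ T', T ≤ T' ∧
      (∀ c ∈ C.chors, ∀ i, (H.run env).Has (chorLabmove c i) →
        chorLabmove c i ∈ (H.configAt env T').position) ∧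
      ∀ K ∈ C.literals, ∀ β, (H.run env).firstMove K .machine = some β →
        ((H.configAt env T').position.filterMap (K.moveBy .machine))[0]? = some β := by
    have h1 : ∀ᶠ t in Filter.atTop, ∀ c ∈ C.chors, ∀ i, (H.run env).Has (chorLabmove c i) →
        chorLabmove c i ∈ (H.configAt env t).position := by
      rw [Filter.eventually_all_finset]
      intro c _
      rw [Filter.eventually_all]
      intro i
      by_cases h : (H.run env).Has (chorLabmove c i)
      · obtain ⟨t, ht⟩ := (H.run_has env).1 h
        filter_upwards [Filter.eventually_ge_atTop t] with s hs _
        exact (H.position_prefix env hs).subset ht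
      · exact Filter.Eventually.of_forall fun _ h' => absurd h' h
    have h2 : ∀ᶠ t in Filter.atTop, ∀ K ∈ C.literals, ∀ β,
        (H.run env).firstMove K .machine = some β →
        ((H.configAt env t).position.filterMap (K.moveBy .machine))[0]? = some β := by
      rw [Filter.eventually_all_finset]
      intro K _
      rcases h : (H.run env).firstMove K .machine with _ | β
      · exact Filter.Eventually.of_forall fun _ β h' => by simp at h'
      · obtain ⟨t, ht⟩ := H.exists_sift_get? env h
        filter_upwards [Filter.eventually_ge_atTop t] with s hs β' hβ'
        cases hβ'
        exact prefix_get ((H.position_prefix env hs).filterMap _) ht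
    obtain ⟨T', h1, h2, h3⟩ := ((Filter.eventually_ge_atTop T).and (h1.and h2)).exists
    exact ⟨T', h1, h2, h3⟩
  set Φ := (H.configAt env T').position with hΦ
  have hsub : (H.configAt env T).position <+: Φ := H.position_prefix env hTT'
  have hrunΦ : ∀ x ∈ Φ, (H.run env).Has x := fun x hx => (H.run_has env).2 ⟨T', hx⟩
  -- The machine makes no two choices in the same cluster.
  have hlegal : ∀ c, chorLabmove c false ∈ Φ → chorLabmove c true ∈ Φ → False := by
    intro c h1 h2
    let I₀ : Interpretation := ⟨fun _ => firstMoveGame fun _ _ => .machine,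
      fun _ => firstMoveGame_static _⟩
    obtain ⟨⟨-, -, -, h⟩, -⟩ := challenge_won hH he (I := I₀) fun _ => rfl
    obtain ⟨m, hm⟩ := hrunΦ _ h1
    obtain ⟨n, hn⟩ := hrunΦ _ h2
    have := h c false true m n hm hn
    subst this
    have := chorLabmove_inj (Option.some.inj (hm.symm.trans hn))
    simp at this
  let τ' : ℕ → Option Bool := fun c => if chorLabmove c false ∈ Φ then some false
    else if chorLabmove c true ∈ Φ then some true else none
  have hτ' : ∀ c i, τ' c = some i ↔ chorLabmove c i ∈ Φ := by
    intro c i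
    by_cases h1 : chorLabmove c false ∈ Φ <;> by_cases h2 : chorLabmove c true ∈ Φ
    · exact (hlegal c h1 h2).elim
    all_goals cases i <;> simp [τ', h1, h2]
  refine ⟨τ', {x | C.MatchedAt Φ x.1 x.2.1 x.2.2}, fun c i h => (hτ' c i).2 (hsub.subset (hτ c i h)),
    fun x hx => (hμ x hx).mono hsub, C.isMatching_matchedAt Φ, fun v hv => ?_, fun c i hc => ?_⟩
  · let I : Interpretation := ⟨fun P => firstMoveGame
      (C.adversary (fun L => (H.run env).firstMove L .machine) v P), fun _ => firstMoveGame_static _⟩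
    obtain ⟨-, hwon⟩ := challenge_won hH he (I := I) fun _ => rfl
    have hmat : ∀ P a b, Literal.pos P a ∈ C.literals → Literal.neg P b ∈ C.literals →
        (H.run env).firstMove (.pos P a) .machine = some (Literal.neg P b).name →
        (H.run env).firstMove (.neg P b) .machine = some (Literal.pos P a).name →
        v (.pos P a) ∨ v (.neg P b) := fun P a b ha hb h1 h2 =>
      hv P a b ⟨ha, hb, hmatch _ ha _ h1, hmatch _ hb _ h2⟩
    have key : ∀ X : Cirquent, X.literals ⊆ C.literals → X.chors ⊆ C.chors →
        X.Won I (H.run env) → X.eval σ τ' v := by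
      intro X
      induction X with
      | top => exact fun _ _ _ => trivial
      | bot => exact fun _ _ => id
      | lit L =>
        intro hL _ hw
        have hL : L ∈ C.literals := hL (by simp [literals])
        rw [Won] at hw
        cases L with
        | pos P a =>
          rw [win_pos (I := I) rfl, challenge_firstMove hL, adversary_eq_machine] at hw
          rcases hw with ⟨a', h1, -, h2⟩ | ⟨b, hb, h1, h2, h3⟩
          · rw [some_name_inj h1]; exact h2
          · exact (hmat P a b hL hb h1 h2.symm).resolve_right h3
        | neg P b =>
          rw [win_neg (I := I) rfl, challenge_firstMove hL] at hw
          by_contra hvb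
          have : C.adversary (fun L => (H.run env).firstMove L .machine) v P
              (some (Literal.neg P b).name) ((H.run env).firstMove (.neg P b) .machine) = .machine :=
            adversary_eq_machine.2 (Or.inr ⟨b, hL, rfl, rfl, hvb⟩)
          rw [this] at hw
          cases hw
      | or A B ihA ihB =>
        intro h1 h2
        simp only [literals, chors, Finset.union_subset_iff] at h1 h2
        exact Or.imp (ihA h1.1 h2.1) (ihB h1.2 h2.2)
      | and A B ihA ihB =>
        intro h1 h2
        simp only [literals, chors, Finset.union_subset_iff] at h1 h2
        exact And.imp (ihA h1.1 h2.1) (ihB h1.2 h2.2)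
      | chand c A B ihA ihB =>
        intro h1 h2 hw
        simp only [literals, chors, Finset.union_subset_iff] at h1 h2
        have hhas : ∀ i, (H.run env).Has (chandLabmove c i) ↔ σ c = some i := fun i =>
          challenge_has_chand.trans (hσ c i).symm
        simp only [Won, hhas] at hw
        refine ⟨fun hc => ?_, fun hc => ?_⟩
        · simp only [hc] at hw
          exact ihA h1.1 h2.1 (by simpa using hw)
        · simp only [hc] at hw
          exact ihB h1.2 h2.2 (by simpa using hw)
      | chor c A B ihA ihB =>
        intro h1 h2
        simp only [literals, chors, Finset.union_subset_iff, Finset.insert_subset_iff] at h1 h2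
        exact Or.imp (fun h => ⟨(hτ' _ _).2 (hchor c h2.1 _ h.1), ihA h1.1 h2.2.1 h.2⟩)
          (fun h => ⟨(hτ' _ _).2 (hchor c h2.1 _ h.1), ihB h1.2 h2.2.2 h.2⟩)
    exact key C subset_rfl subset_rfl hwon
  · have hnew : ∀ x ∈ e, x.2.1 ≠ c := by
      rintro ⟨t, d, j⟩ hx rfl
      have := (hσ d j).2 ⟨t, hx⟩
      rw [hc] at this
      cases this
    have hconf : H.configAt (C.challenge ((T', c, i) :: e)) T' = H.configAt env T' := by
      refine H.configAt_congr fun s hs => ?_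
      have : ¬ T' = s := by omega
      simp [henv, challenge, this]
    have hsub' : Φ <+: (H.configAt (C.challenge ((T', c, i) :: e)) (T' + 1)).position := by
      rw [hΦ, ← hconf]; exact H.position_prefix _ (by omega)
    refine ⟨(T', c, i) :: e, T' + 1, ?_, ?_, ?_, ?_, ?_⟩
    · rw [List.map_cons, List.nodup_cons]
      refine ⟨fun h => ?_, he⟩
      obtain ⟨x, hx, hxc⟩ := List.mem_map.1 h
      exact hnew x hx hxc
    · rintro x (_ | ⟨_, hx⟩)
      · simp
      · have := heT x hx; omega
    · intro d j
      by_cases hd : d = c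
      · subst hd
        simp only [Function.update_self, Option.some.injEq, List.mem_cons, Prod.mk.injEq]
        constructor
        · rintro rfl; exact ⟨T', Or.inl ⟨rfl, trivial, rfl⟩⟩
        · rintro ⟨t, ⟨-, -, h⟩ | h⟩
          · exact h.symm
          · exact absurd rfl (hnew _ h)
      · simp only [Function.update_of_ne hd, hσ, List.mem_cons, Prod.mk.injEq]
        simp [hd]
    · exact fun d j h => hsub'.subset ((hτ' d j).1 h)
    · exact fun x hx => hx.mono hsub'


/-! ### Copying moves -/

/-- The number of the moves made by `p`. -/
def Position.count (Φ : Position) (p : Player) : ℕ :=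
  (Φ.filter fun x : Labmove => decide (x.1 = p)).length

theorem Position.count_append (Φ Ψ : Position) (p : Player) :
    Position.count (Φ ++ Ψ) p = Position.count Φ p + Position.count Ψ p := by
  simp [Position.count]

theorem Position.count_le_of_prefix {Φ Ψ : Position} (h : Φ <+: Ψ) (p : Player) :
    Position.count Φ p ≤ Position.count Ψ p := (h.sublist.filter _).length_le

theorem Position.count_bar (Φ : Position) (p : Player) :
    Position.count (Φ.map fun x => (x.1.opp, x.2)) p = Position.count Φ p.opp := by
  rw [Position.count, Position.count, List.filter_map, List.length_map]
  congr 1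
  refine List.filter_congr fun x _ => ?_
  obtain ⟨q, α⟩ := x
  cases p <;> cases q <;> rfl

theorem take_succ_count {Γ : Run} {p : Player} {i n : ℕ} (h : Γ.NthAt p n i) (q : Player) :
    Position.count (Γ.take (i + 1)) q = Position.count (Γ.take i) q + if q = p then 1 else 0 := by
  obtain ⟨⟨α, hα⟩, -⟩ := h
  rw [take_succ_of_get? hα, Position.count_append]
  congr 1
  cases p <;> cases q <;> rfl

/-- A criterion for being a delay in terms of the numbers of moves made. -/
theorem isDelay_of_count {p : Player} {Υ Γ : Run} (hm : ∀ q, Υ.movesOf q = Γ.movesOf q)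
    (h : ∀ i, ∃ m, Position.count (Υ.take i) p ≤ Position.count (Γ.take m) p ∧
      Position.count (Γ.take m) p.opp ≤ Position.count (Υ.take i) p.opp) : IsDelay p Υ Γ := by
  refine ⟨hm, fun n k i j i' j' hi hj hji hi' hj' => ?_⟩
  have hne : p ≠ p.opp := by cases p <;> simp [Player.opp]
  by_contra hlt
  have hij : i' + 1 ≤ j' := by
    rcases Nat.lt_or_ge i' j' with h | h
    · exact h
    · have : i' = j' := by omega
      subst this
      obtain ⟨⟨α, hα⟩, -⟩ := hi'
      obtain ⟨⟨β, hβ⟩, -⟩ := hj'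
      rw [hα] at hβ
      exact absurd (congrArg Prod.fst (Option.some.inj hβ)) hne
  obtain ⟨m, h1, h2⟩ := h (i' + 1)
  have c1 : Position.count (Υ.take (i' + 1)) p = n + 1 := by
    rw [take_succ_count hi', if_pos rfl]; exact congrArg (· + 1) hi'.2
  have c2 : Position.count (Υ.take (i' + 1)) p.opp ≤ k :=
    (Position.count_le_of_prefix (take_prefix_take _ hij) _).trans_eq hj'.2
  have him : i < m := by
    by_contra hmi
    have := Position.count_le_of_prefix (take_prefix_take Γ (Nat.le_of_not_lt hmi)) p
    have h3 : Position.count (Γ.take i) p = n := hi.2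
    omega
  have h3 := Position.count_le_of_prefix (take_prefix_take Γ (show j + 1 ≤ m by omega)) p.opp
  rw [take_succ_count hj, if_pos rfl] at h3
  have h4 : Position.count (Γ.take j) p.opp = k := hj.2
  omega

theorem Player.opp_opp (p : Player) : p.opp.opp = p := by cases p <;> rfl

theorem Player.opp_injective : Function.Injective Player.opp := fun p q h => by
  rw [← p.opp_opp, h, q.opp_opp]

theorem nthAt_bar {Γ : Run} {p : Player} {n i : ℕ} : Γ.bar.NthAt p n i ↔ Γ.NthAt p.opp n i := by
  have h1 : ((Γ.bar.take i).filter fun x : Labmove => decide (x.1 = p)).length =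
      ((Γ.take i).filter fun x : Labmove => decide (x.1 = p.opp)).length := by
    rw [bar_take]; exact Position.count_bar _ _
  rw [Run.NthAt, Run.NthAt, h1]
  refine and_congr_left fun _ => exists_congr fun α => ?_
  rw [Run.bar, Stream'.Seq.map_get?, Option.map_eq_some_iff]
  constructor
  · rintro ⟨⟨q, β⟩, h, h'⟩
    rw [h]
    obtain ⟨rfl, rfl⟩ := Prod.mk.inj h'
    rw [Player.opp_opp]
  · intro h
    exact ⟨_, h, by rw [Player.opp_opp]⟩

theorem IsDelay.bar {p : Player} {Υ Γ : Run} (h : IsDelay p Υ Γ) : IsDelay p.opp Υ.bar Γ.bar := by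
  refine ⟨fun q => by rw [bar_movesOf, bar_movesOf, h.1], fun n k i j i' j' h1 h2 h3 h4 h5 => ?_⟩
  rw [nthAt_bar, Player.opp_opp] at h1 h2 h4 h5
  exact h.2 n k i j i' j' h1 h2 h3 h4 h5

theorem Game.neg_legalFor {G : Game} {p : Player} {Γ : Run} :
    G.neg.LegalFor p Γ ↔ G.LegalFor p.opp Γ.bar := by
  refine or_congr Iff.rfl (exists_congr fun n => exists_congr fun α => ?_)
  change (Run.bar _ ∈ G.legal ∧ Run.bar _ ∉ G.legal ∧ _) ↔ _
  rw [bar_ofList_take, bar_ofList_take, Run.bar, Stream'.Seq.map_get?, Option.map_eq_some_iff]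
  refine and_congr_right fun _ => and_congr_right fun _ => ?_
  constructor
  · intro h; exact ⟨_, h, rfl⟩
  · rintro ⟨⟨q, β⟩, h, h'⟩
    rw [h]
    obtain ⟨h1, rfl⟩ := Prod.mk.inj h'
    obtain rfl : q = p.opp := Player.opp_injective h1
    rfl

theorem Game.neg_wonBy {G : Game} {p : Player} {Γ : Run} :
    G.neg.WonBy p Γ ↔ G.WonBy p.opp Γ.bar := by
  rw [Game.WonBy, Game.WonBy, Game.neg_legalFor]
  refine or_congr_left (and_congr_right fun _ => ?_)
  change (G.win Γ.bar).opp = p ↔ _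
  rw [← Player.opp_injective.eq_iff, Player.opp_opp]

theorem Game.Static.neg {G : Game} (h : G.Static) : G.neg.Static := by
  intro p Υ Γ hd
  rw [Game.neg_legalFor, Game.neg_legalFor, Game.neg_wonBy, Game.neg_wonBy]
  exact h _ _ _ hd.bar

theorem Interpretation.lit_static (I : Interpretation) (L : Literal) : (I.lit L).Static := by
  cases L with
  | pos P a => exact I.isStatic P
  | neg P a => exact (I.isStatic P).neg

/-- Two literals of the same letter, exactly one of which is negative. -/
def Literal.Opposite (L M : Literal) : Prop :=
  ∃ P a b, (L = .pos P a ∧ M = .neg P b) ∨ (L = .neg P b ∧ M = .pos P a)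

theorem Literal.Opposite.legal {L M : Literal} (h : L.Opposite M) (I : Interpretation) (Γ : Run) :
    Γ.bar ∈ (I.lit M).legal ↔ Γ ∈ (I.lit L).legal := by
  obtain ⟨P, a, b, ⟨rfl, rfl⟩ | ⟨rfl, rfl⟩⟩ := h
  · change Γ.bar.bar ∈ (I.letter P).legal ↔ Γ ∈ (I.letter P).legal; rw [bar_bar]
  · exact Iff.rfl

theorem Literal.Opposite.win {L M : Literal} (h : L.Opposite M) (I : Interpretation) (Γ : Run) :
    (I.lit M).win Γ.bar = ((I.lit L).win Γ).opp := by
  obtain ⟨P, a, b, ⟨rfl, rfl⟩ | ⟨rfl, rfl⟩⟩ := h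
  · change Player.opp ((I.letter P).win Γ.bar.bar) = _; rw [bar_bar]; rfl
  · change _ = Player.opp (Player.opp _); rw [Player.opp_opp]; rfl

theorem count_filterMap_strip (L : Literal) (Φ : Position) (p : Player) :
    Position.count (Φ.filterMap L.strip) p = (Φ.filterMap (L.moveBy p)).length := by
  induction Φ with
  | nil => rfl
  | cons x Φ ih =>
    rw [Position.count] at ih ⊢
    rcases h : L.strip x with _ | ⟨q, α⟩
    · rw [List.filterMap_cons_none h, ih, List.filterMap_cons_none (by simp [Literal.moveBy, h])]
    · rw [List.filterMap_cons_some h, List.filter_cons]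
      by_cases hq : q = p
      · rw [List.filterMap_cons_some (b := α) (by simp [Literal.moveBy, h, hq])]
        simp [hq, ih]
      · rw [List.filterMap_cons_none (by simp [Literal.moveBy, h, hq])]
        simp [hq, ih]

theorem movesOf_ofList (Φ : Position) (p : Player) : Run.movesOf (Stream'.Seq.ofList Φ) p =
    Stream'.Seq.ofList (Φ.filterMap fun x : Labmove => if x.1 = p then some x.2 else none) := by
  rw [Run.movesOf, sift_ofList]

theorem exists_prefix_filterMap_take {α β : Type} (f : α → Option β) (l : List α) (i : ℕ) :
    ∃ l', l' <+: l ∧ (l.filterMap f).take i = l'.filterMap f := by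
  obtain ⟨l', hl', h⟩ := List.prefix_filterMap_iff.1 (List.take_prefix i (l.filterMap f))
  exact ⟨l', hl', h⟩

/-- If the machine keeps copying to `M` the moves made by the environment in `L`, and the other way
around, then it is legal to copy one more. -/
theorem legal_copy {I : Interpretation} {L M : Literal} (hLM : L.Opposite M) {Φ : Position}
    {α : Move} (hL : Stream'.Seq.ofList (Φ.filterMap L.strip) ∈ (I.lit L).legal)
    (hM : Stream'.Seq.ofList (Φ.filterMap M.strip) ∈ (I.lit M).legal)
    (h1 : ∀ Ψ, Ψ <+: Φ → Ψ.filterMap (M.moveBy .machine) <+: Ψ.filterMap (L.moveBy .environment))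
    (h2 : ∀ Ψ, Ψ <+: Φ → Ψ.filterMap (L.moveBy .machine) <+: Ψ.filterMap (M.moveBy .environment))
    (hα : Φ.filterMap (M.moveBy .machine) ++ [α] <+: Φ.filterMap (L.moveBy .environment)) :
    Stream'.Seq.ofList (Φ.filterMap M.strip ++ [(.machine, α)]) ∈ (I.lit M).legal := by
  obtain ⟨r₁, hr₁⟩ := hα
  obtain ⟨r₂, hr₂⟩ := h2 Φ List.prefix_rfl
  set A := Φ.filterMap M.strip with hA
  set B := (Φ.filterMap L.strip).map fun x => (x.1.opp, x.2) with hB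
  -- The pending moves are appended, so that both runs consist of the same moves.
  set Υ := A ++ (α :: r₁).map fun β => (Player.machine, β) with hΥ
  set Δ := B ++ r₂.map fun β => (Player.environment, β) with hΔ
  have hBl : (Stream'.Seq.ofList B : Run) ∈ (I.lit M).legal := by
    rw [hB, ← bar_ofList]; exact (hLM.legal I _).2 hL
  have strip_moves : ∀ (K : Literal) (p : Player), (Φ.filterMap K.strip).filterMap
      (fun x : Labmove => if x.1 = p then some x.2 else none) = Φ.filterMap (K.moveBy p) := by
    intro K p; rw [List.filterMap_filterMap]; rfl
  have strip_bar : ∀ (K : Literal) (p : Player),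
      ((Φ.filterMap K.strip).map fun x => (x.1.opp, x.2)).filterMap
      (fun x : Labmove => if x.1 = p then some x.2 else none) = Φ.filterMap (K.moveBy p.opp) := by
    intro K p
    rw [← strip_moves, List.filterMap_map]
    congr 1
    funext x
    obtain ⟨q, β⟩ := x
    cases p <;> cases q <;> simp [Player.opp]
  have map_moves : ∀ (r : List Move) (p q : Player), (r.map fun β => (p, β)).filterMap
      (fun x : Labmove => if x.1 = q then some x.2 else none) = if p = q then r else [] := by
    intro r p q
    rw [List.filterMap_map]
    split_ifs with h
    · simp [h]
    · simp [h]
  have hdelay : IsDelay .machine (Stream'.Seq.ofList Υ) (Stream'.Seq.ofList Δ) := by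
    refine isDelay_of_count (fun q => ?_) fun i => ?_
    · rw [movesOf_ofList, movesOf_ofList, hΥ, hΔ, List.filterMap_append, List.filterMap_append,
        hA, hB, strip_moves, strip_bar, map_moves, map_moves]
      cases q
      · simp [Player.opp, ← hr₁]
      · simp [Player.opp, hr₂]
    · rw [take_ofList]
      by_cases hi : i ≤ A.length
      · obtain ⟨Ψ, hΨ, he⟩ := exists_prefix_filterMap_take M.strip Φ i
        have hpre : ((Ψ.filterMap L.strip).map fun x => (x.1.opp, x.2)) <+: Δ :=
          ((hΨ.filterMap _).map _).trans (List.prefix_append _ _)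
        refine ⟨((Ψ.filterMap L.strip).map fun x => (x.1.opp, x.2)).length, ?_⟩
        rw [take_ofList, ← List.prefix_iff_eq_take.1 hpre, hΥ, List.take_append_of_le_length hi,
          he, Position.count_bar, Position.count_bar, count_filterMap_strip, count_filterMap_strip,
          count_filterMap_strip, count_filterMap_strip]
        exact ⟨(h1 Ψ hΨ).length_le, (h2 Ψ hΨ).length_le⟩
      · refine ⟨B.length, ?_⟩
        rw [take_ofList, hΔ, List.take_left]
        have hc : ∀ (r : List Move) (p q : Player), Position.count (r.map fun β => (p, β)) q =
            if p = q then r.length else 0 := by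
          intro r p q
          rw [Position.count, List.filter_map, List.length_map]
          split_ifs with h <;> simp [Function.comp_def, h]
        have h3 := Position.count_le_of_prefix (List.take_prefix i Υ) .machine
        have h4 := Position.count_le_of_prefix (Φ := A) (Ψ := Υ.take i)
          (List.prefix_of_prefix_length_le (List.prefix_append _ _) (List.take_prefix _ _)
            (by rw [List.length_take]
                have : A.length < Υ.length := by simp [hΥ]
                omega)) .environment
        have h5 := (h2 Φ List.prefix_rfl).length_le
        have h6 := congrArg List.length hr₁
        have h7 : Position.count Υ .machine = (Φ.filterMap (M.moveBy .machine)).length +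
            (α :: r₁).length := by
          rw [hΥ, Position.count_append, hc, hA, count_filterMap_strip, if_pos rfl]
        rw [h7] at h3
        rw [hA, count_filterMap_strip] at h4
        rw [hB, Position.count_bar, Position.count_bar, count_filterMap_strip,
          count_filterMap_strip]
        simp only [List.length_append, List.length_cons, List.length_nil] at h3 h6
        exact ⟨by simp only [Player.opp]; omega, by simp only [Player.opp]; omega⟩
  have hΔl : (I.lit M).LegalFor .machine (Stream'.Seq.ofList Δ) := by
    by_cases hl : (Stream'.Seq.ofList Δ : Run) ∈ (I.lit M).legal
    · exact Or.inl hl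
    · obtain ⟨n, ⟨p, β⟩, g1, g2, g3⟩ := (I.lit M).exists_first_illegal hl
      refine Or.inr ⟨n, β, g1, g2, ?_⟩
      rw [g3]
      by_cases hn : n < B.length
      · refine absurd ?_ g2
        have := (I.lit M).prefix_closed _ hBl (n + 1)
        rw [take_ofList] at this ⊢
        rwa [hΔ, List.take_append_of_le_length hn]
      · rw [Stream'.Seq.ofList_get?, hΔ, List.getElem?_append_right (by omega),
          List.getElem?_map, Option.map_eq_some_iff] at g3
        obtain ⟨_, _, h⟩ := g3
        rw [← (Prod.mk.inj h).1]; rfl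
  rcases ((I.lit_static M) _ _ _ hdelay).1 hΔl with h | ⟨n, β, g1, g2, g3⟩
  · have := (I.lit M).prefix_closed _ h (A.length + 1)
    rwa [take_ofList, hΥ, List.map_cons, ← List.singleton_append, ← List.append_assoc,
      List.take_left' (by simp)] at this
  · by_cases hn : n < A.length
    · refine absurd ?_ g2
      have := (I.lit M).prefix_closed _ hM (n + 1)
      rw [take_ofList] at this ⊢
      rwa [hΥ, List.take_append_of_le_length hn]
    · rw [Stream'.Seq.ofList_get?, hΥ, List.getElem?_append_right (by omega),
        List.getElem?_map, Option.map_eq_some_iff] at g3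
      obtain ⟨_, _, h⟩ := g3
      exact absurd (Prod.mk.inj h).1 (by simp [Player.opp])

/-- In the run `Γ` the machine copies to `M` the moves made by the environment in `L`, all of them,
and in the same order. -/
structure Copies (Γ : Run) (L M : Literal) : Prop where
  prefix_take : ∀ n, (Γ.take n).filterMap (M.moveBy .machine) <+:
    (Γ.take n).filterMap (L.moveBy .environment)
  fair : ∀ n, ∃ k, (Γ.take n).filterMap (L.moveBy .environment) <+:
    (Γ.take k).filterMap (M.moveBy .machine)

theorem Copies.sift_eq {Γ : Run} {L M : Literal} (h : Copies Γ L M) :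
    sift (M.moveBy .machine) Γ = sift (L.moveBy .environment) Γ := by
  ext n b
  rw [get?_sift_eq_some, get?_sift_eq_some]
  constructor
  · rintro ⟨t, ht⟩
    exact ⟨t, prefix_get (h.prefix_take t) ht⟩
  · rintro ⟨t, ht⟩
    obtain ⟨k, hk⟩ := h.fair t
    exact ⟨k, prefix_get hk ht⟩

theorem exists_take_eq {α β : Type} (f : α → Option β) (s : Stream'.Seq α) (i : ℕ) :
    ∃ n, (sift f s).take i = (s.take n).filterMap f := by
  obtain ⟨n, hn⟩ := exists_take_take f s i
  obtain ⟨l, hl, he⟩ := exists_prefix_filterMap_take f (s.take n) i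
  refine ⟨l.length, ?_⟩
  have h1 := List.prefix_iff_eq_take.1 (hl.trans (take_prefix_take s (le_max_left n l.length)))
  have h2 := List.prefix_iff_eq_take.1 (take_prefix_take s (le_max_right n l.length))
  have h3 : (s.take l.length).length = l.length := by
    refine le_antisymm Stream'.Seq.length_take_le ?_
    by_contra hlt
    push Not at hlt
    have h4 : (s.take l.length)[(s.take l.length).length]? = none := List.getElem?_eq_none le_rfl
    rw [get?_take, if_pos hlt] at h4
    have h5 : l[(s.take l.length).length]? = none := by
      have := prefix_get hl (List.getElem?_eq_getElem hlt)
      rw [get?_take] at this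
      split_ifs at this
      rw [h4] at this; cases this
    rw [List.getElem?_eq_getElem hlt] at h5
    cases h5
  rw [hn, he, h2, h3, ← h1]

/-- The machine wins at least one of two literals of the same letter if it copies its adversary's
moves from each of them to the other. -/
theorem Copies.win {I : Interpretation} {L M : Literal} {Γ : Run} (hLM : L.Opposite M)
    (h1 : Copies Γ L M) (h2 : Copies Γ M L) (hL : Γ.inLit L ∈ (I.lit L).legal)
    (hM : Γ.inLit M ∈ (I.lit M).legal) :
    (I.lit L).win (Γ.inLit L) = .machine ∨ (I.lit M).win (Γ.inLit M) = .machine := by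
  by_contra hcon
  push Not at hcon
  have hdelay : IsDelay .machine (Γ.inLit M) (Γ.inLit L).bar := by
    refine isDelay_of_count (fun q => ?_) fun i => ?_
    · rw [bar_movesOf, movesOf_inLit, movesOf_inLit]
      cases q
      · exact h1.sift_eq
      · exact h2.sift_eq.symm
    · obtain ⟨n, hn⟩ := exists_take_eq M.strip Γ i
      obtain ⟨m, hm⟩ := exists_take_sift L.strip Γ n
      refine ⟨m, ?_⟩
      rw [bar_take, Run.inLit, Run.inLit, hn, hm, Position.count_bar, Position.count_bar,
        count_filterMap_strip, count_filterMap_strip, count_filterMap_strip, count_filterMap_strip]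
      exact ⟨(h1.prefix_take n).length_le, (h2.prefix_take n).length_le⟩
  have hw : (I.lit M).WonBy .machine (Γ.inLit L).bar := by
    refine Or.inl ⟨(hLM.legal I _).2 hL, ?_⟩
    rw [hLM.win]
    rcases h : (I.lit L).win (Γ.inLit L)
    · exact absurd h hcon.1
    · rfl
  rcases ((I.lit_static M) _ _ _ hdelay).2 hw with ⟨_, h⟩ | h
  · exact hcon.2 h
  · exact h (Or.inl hM)

/-- A matched pair of literals. -/
def Pairs (μ : Set (ℕ × ℕ × ℕ)) (L M : Literal) : Prop :=
  ∃ P a b, (P, a, b) ∈ μ ∧ ((L = .pos P a ∧ M = .neg P b) ∨ (L = .neg P b ∧ M = .pos P a))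

theorem Pairs.opposite {μ : Set (ℕ × ℕ × ℕ)} {L M : Literal} (h : Pairs μ L M) : L.Opposite M := by
  obtain ⟨P, a, b, -, h⟩ := h
  exact ⟨P, a, b, h⟩

theorem Pairs.symm {μ : Set (ℕ × ℕ × ℕ)} {L M : Literal} (h : Pairs μ L M) : Pairs μ M L := by
  obtain ⟨P, a, b, hm, h⟩ := h
  exact ⟨P, a, b, hm, by tauto⟩

theorem Pairs.mono {μ ν : Set (ℕ × ℕ × ℕ)} {L M : Literal} (hμν : μ ⊆ ν) (h : Pairs μ L M) :
    Pairs ν L M := by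
  obtain ⟨P, a, b, hm, h⟩ := h
  exact ⟨P, a, b, hμν hm, h⟩

theorem Pairs.right_unique {μ : Set (ℕ × ℕ × ℕ)} {L M M' : Literal} (hμ : IsMatching μ)
    (h : Pairs μ L M) (h' : Pairs μ L M') : M = M' := by
  obtain ⟨P, a, b, hm, ⟨rfl, rfl⟩ | ⟨rfl, rfl⟩⟩ := h <;>
    obtain ⟨P', a', b', hm', ⟨h1, rfl⟩ | ⟨h1, rfl⟩⟩ := h'
  · obtain ⟨rfl, rfl⟩ := Literal.pos.inj h1
    rw [(hμ P a b a b' hm hm').1 rfl]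
  · cases h1
  · cases h1
  · obtain ⟨rfl, rfl⟩ := Literal.neg.inj h1
    rw [(hμ P a b a' b hm hm').2 rfl]

/-- The moves that the machine may make at a position while playing by copying. -/
def AllowedMove (Φ : Position) (α : Move) : Prop :=
  (∃ c i, α = (chorLabmove c i).2 ∧ ∀ j, chorLabmove c j ∉ Φ) ∨
  ∃ (L M : Literal) (β : Move), L.Opposite M ∧ α = M.move β ∧
    (∀ Ψ, Ψ <+: Φ → Ψ.filterMap (M.moveBy .machine) <+: Ψ.filterMap (L.moveBy .environment)) ∧
    (∀ Ψ, Ψ <+: Φ → Ψ.filterMap (L.moveBy .machine) <+: Ψ.filterMap (M.moveBy .environment)) ∧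
    Φ.filterMap (M.moveBy .machine) ++ [β] <+: Φ.filterMap (L.moveBy .environment)

theorem AllowedMove.legal {I : Interpretation} {Φ : Position} {α : Move} (h : AllowedMove Φ α)
    (hΦ : I.LegalRun (Stream'.Seq.ofList Φ)) :
    I.LegalRun (Stream'.Seq.ofList (Φ ++ [(.machine, α)])) := by
  rcases h with ⟨c, i, rfl, h⟩ | ⟨L, M, β, hLM, rfl, h1, h2, h3⟩
  · refine I.legalRun_append hΦ (Or.inr ⟨c, i, Or.inr rfl⟩) ?_ ?_ ?_
    · intro K y hy
      rw [Literal.strip_eq_some] at hy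
      exact absurd (Prod.mk.inj hy).2 (chorLabmove_ne_move _ _ _ _)
    · intro d j k hd
      rw [chandOf_machine] at hd; cases hd
    · intro d j k hd
      rw [chorOf_eq_some] at hd
      rw [← (chorLabmove_inj (c := c) (i := i) hd).1]
      exact h k
  · have hl := (I.legalRun_ofList Φ).1 hΦ
    refine I.legalRun_append hΦ (Or.inl ⟨M, β, rfl⟩) ?_ ?_ ?_
    · intro K y hy
      rw [Literal.strip_eq_some] at hy
      obtain ⟨hp, hy⟩ := Prod.mk.inj hy
      obtain ⟨rfl, rfl⟩ := Literal.move_inj hy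
      obtain ⟨p, γ⟩ := y
      cases hp
      exact legal_copy hLM (hl.2.1 L) (hl.2.1 M) h1 h2 h3
    · intro d j k hd
      rw [chandOf_machine] at hd; cases hd
    · intro d j k hd
      rw [chorOf_eq_some] at hd
      exact absurd (Prod.mk.inj hd).2.symm (chorLabmove_ne_move _ _ _ _)

/-- If the choices made in a legal run are those of a state in which `C` is true under all values
that respect the matches, and the machine copies between matched literals, then it wins. -/
theorem Cirquent.Won.of_eval {C : Cirquent} {I : Interpretation} {Γ : Run} {s : GameState}
    (hT : C.Taut s) (hl : I.LegalRun Γ)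
    (hσ : ∀ c ∈ C.chands, ∀ i, s.σ c = some i ↔ Γ.Has (chandLabmove c i))
    (hτ : ∀ c ∈ C.chors, ∀ i, s.τ c = some i → Γ.Has (chorLabmove c i))
    (hμ : ∀ L M, Pairs s.μ L M → Copies Γ L M) : C.Won I Γ := by
  have h := hT (fun L => (I.lit L).win (Γ.inLit L) = .machine) fun P a b hm =>
    have hp : Pairs s.μ (.pos P a) (.neg P b) := ⟨P, a, b, hm, Or.inl ⟨rfl, rfl⟩⟩
    (hμ _ _ hp).win hp.opposite (hμ _ _ hp.symm) (hl.2.1 _) (hl.2.1 _)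
  clear hT hμ
  induction C with
  | top => trivial
  | bot => exact h
  | lit L => exact h
  | or A B ihA ihB =>
    simp only [chands, chors, Finset.mem_union] at hσ hτ
    exact h.imp (ihA (fun c hc => hσ c (Or.inl hc)) fun c hc => hτ c (Or.inl hc))
      (ihB (fun c hc => hσ c (Or.inr hc)) fun c hc => hτ c (Or.inr hc))
  | and A B ihA ihB =>
    simp only [chands, chors, Finset.mem_union] at hσ hτ
    exact h.imp (ihA (fun c hc => hσ c (Or.inl hc)) fun c hc => hτ c (Or.inl hc))
      (ihB (fun c hc => hσ c (Or.inr hc)) fun c hc => hτ c (Or.inr hc))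
  | chand c A B ihA ihB =>
    simp only [chands, chors, Finset.mem_union, Finset.mem_insert] at hσ hτ
    have iA := ihA (fun c hc => hσ c (Or.inr (Or.inl hc))) fun c hc => hτ c (Or.inl hc)
    have iB := ihB (fun c hc => hσ c (Or.inr (Or.inr hc))) fun c hc => hτ c (Or.inr hc)
    have hc := hσ c (Or.inl rfl)
    simp only [Won, ← hc]
    rcases hs : s.σ c with _ | _ | _
    · simp
    · exact Or.inl ⟨rfl, iA (h.1 hs)⟩
    · exact Or.inr (Or.inl ⟨rfl, iB (h.2 hs)⟩)
  | chor c A B ihA ihB =>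
    simp only [chands, chors, Finset.mem_union, Finset.mem_insert] at hσ hτ
    have iA := ihA (fun c hc => hσ c (Or.inl hc)) fun c hc => hτ c (Or.inr (Or.inl hc))
    have iB := ihB (fun c hc => hσ c (Or.inr hc)) fun c hc => hτ c (Or.inr (Or.inr hc))
    have hc := hτ c (Or.inl rfl)
    exact h.imp (And.imp (hc _) iA) (And.imp (hc _) iB)


/-! ### Strategies -/

/-- A strategy for the machine, as a function of the history of the environment's choices, listed
with the latest choice first: the choices announced by the machine so far, in the order in which
they are made, and the literal with which a given literal is matched. -/
structure Cirquent.Strategy (C : Cirquent) where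
  announced : List (ℕ × Bool) → List (ℕ × Bool)
  partner : List (ℕ × Bool) → Literal → Option Literal
  announced_cons : ∀ x h, announced h <+: announced (x :: h)
  announced_nodup : ∀ h, ((announced h).map Prod.fst).Nodup
  partner_cons : ∀ x h L M, partner h L = some M → partner (x :: h) L = some M
  partner_symm : ∀ h L M, partner h L = some M → partner h M = some L
  partner_opposite : ∀ h L M, partner h L = some M → L.Opposite M
  partner_mem : ∀ h L M, partner h L = some M → L ∈ C.literals
  taut : ∀ h, (h.map Prod.fst).Nodup → ∃ s, C.Taut s ∧ (∀ c i, s.σ c = some i ↔ (c, i) ∈ h) ∧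
    (∀ c ∈ C.chors, ∀ i, s.τ c = some i → (c, i) ∈ announced h) ∧
    ∀ L M, Pairs s.μ L M → partner h L = some M

/-- The state of the play after the given history, when the machine responds to the state `s` with
`resp s`. -/
def historyState (resp : GameState → GameState) : List (ℕ × Bool) → GameState
  | [] => resp GameState.start
  | (c, i) :: h =>
    let s := historyState resp h
    if s.σ c = none then resp ⟨Function.update s.σ c (some i), s.τ, s.μ⟩ else s

/-- The choices of the machine listed in the order in which they become part of the state. -/
noncomputable def historyChoices (D : Finset ℕ) (resp : GameState → GameState) :
    List (ℕ × Bool) → List (ℕ × Bool)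
  | [] => D.toList.filterMap fun c => ((historyState resp []).τ c).map (Prod.mk c)
  | x :: h => historyChoices D resp h ++ D.toList.filterMap fun c =>
      if (historyState resp h).τ c = none then ((historyState resp (x :: h)).τ c).map (Prod.mk c)
      else none

theorem nodup_filterMap_toList (D : Finset ℕ) (f : ℕ → Option (ℕ × Bool))
    (hf : ∀ c y, f c = some y → y.1 = c) : ((D.toList.filterMap f).map Prod.fst).Nodup := by
  rw [List.Nodup, List.pairwise_map, List.pairwise_filterMap]
  refine D.nodup_toList.imp fun {c d} hcd y hy z hz => ?_
  rw [hf c y hy, hf d z hz]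
  exact hcd

theorem mem_historyChoices {D : Finset ℕ} {resp : GameState → GameState}
    (hτ : ∀ x h, ChoiceLE (historyState resp h).τ (historyState resp (x :: h)).τ)
    (h : List (ℕ × Bool)) {c : ℕ} {i : Bool} :
    (c, i) ∈ historyChoices D resp h ↔ c ∈ D ∧ (historyState resp h).τ c = some i := by
  induction h with
  | nil => simp [historyChoices, List.mem_filterMap]
  | cons x h ih =>
    simp only [historyChoices, List.mem_append, ih, List.mem_filterMap, Finset.mem_toList]
    constructor
    · rintro (⟨h1, h2⟩ | ⟨d, h1, h2⟩)
      · exact ⟨h1, hτ x h c i h2⟩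
      · split_ifs at h2
        rw [Option.map_eq_some_iff] at h2
        obtain ⟨j, h3, h4⟩ := h2
        obtain ⟨rfl, rfl⟩ := Prod.mk.inj h4
        exact ⟨h1, h3⟩
    · rintro ⟨h1, h2⟩
      rcases h3 : (historyState resp h).τ c with _ | j
      · exact Or.inr ⟨c, h1, by rw [if_pos h3, h2]; rfl⟩
      · have := hτ x h c j h3
        rw [h2] at this
        exact Or.inl ⟨h1, by rw [this]⟩

theorem nodup_historyChoices {D : Finset ℕ} {resp : GameState → GameState}
    (hτ : ∀ x h, ChoiceLE (historyState resp h).τ (historyState resp (x :: h)).τ)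
    (h : List (ℕ × Bool)) : ((historyChoices D resp h).map Prod.fst).Nodup := by
  induction h with
  | nil =>
    refine nodup_filterMap_toList D _ fun c y hy => ?_
    rw [Option.map_eq_some_iff] at hy
    obtain ⟨i, -, rfl⟩ := hy; rfl
  | cons x h ih =>
    rw [historyChoices, List.map_append, List.nodup_append]
    refine ⟨ih, nodup_filterMap_toList D _ fun c y hy => ?_, ?_⟩
    · split_ifs at hy
      rw [Option.map_eq_some_iff] at hy
      obtain ⟨i, -, rfl⟩ := hy; rfl
    · simp only [List.mem_map, List.mem_filterMap]
      rintro _ ⟨⟨c, i⟩, h1, rfl⟩ _ ⟨y, ⟨d, -, h2⟩, rfl⟩ h3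
      split_ifs at h2 with h4
      rw [Option.map_eq_some_iff] at h2
      obtain ⟨j, -, rfl⟩ := h2
      obtain rfl : c = d := h3
      rw [mem_historyChoices hτ, h4] at h1
      cases h1.2

/-- The choices and matches with which the machine responds to a state are fixed once and for all;
the state then depends on the history of the environment's choices only. -/
theorem Cirquent.Winnable.nonempty_strategy {C : Cirquent} (hC : C.Winnable) :
    Nonempty C.Strategy := by
  classical
  obtain ⟨W, hW, h0⟩ := hC
  have hresp : ∀ s, ∃ s' : GameState, s ∈ W → s'.σ = s.σ ∧ ChoiceLE s.τ s'.τ ∧ s.μ ⊆ s'.μ ∧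
      IsMatching s'.μ ∧ C.Taut s' ∧
      ∀ c i, s'.σ c = none → (⟨Function.update s'.σ c (some i), s'.τ, s'.μ⟩ : GameState) ∈ W := by
    intro s
    by_cases hs : s ∈ W
    · obtain ⟨τ', μ', h1, h2, h3, h4, h5⟩ := hW s hs
      exact ⟨⟨s.σ, τ', μ'⟩, fun _ => ⟨rfl, h1, h2, h3, h4, h5⟩⟩
    · exact ⟨s, fun h => absurd h hs⟩
  choose resp hresp using hresp
  set st := historyState resp with hst
  have hpos : ∀ c i h, (st h).σ c = none → st ((c, i) :: h) =
      resp ⟨Function.update (st h).σ c (some i), (st h).τ, (st h).μ⟩ := fun c i h hc => if_pos hc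
  have hneg : ∀ c i h, ¬ (st h).σ c = none → st ((c, i) :: h) = st h := fun c i h hc => if_neg hc
  have hgood : ∀ h, IsMatching (st h).μ ∧ C.Taut (st h) ∧ ∀ c i, (st h).σ c = none →
      (⟨Function.update (st h).σ c (some i), (st h).τ, (st h).μ⟩ : GameState) ∈ W := by
    intro h
    induction h with
    | nil => exact (hresp _ h0).2.2.2
    | cons x h ih =>
      obtain ⟨c, i⟩ := x
      by_cases hc : (st h).σ c = none
      · have := (hresp _ (ih.2.2 c i hc)).2.2.2
        rwa [hpos c i h hc]
      · rwa [hneg c i h hc]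
  have hcons : ∀ x h, ChoiceLE (st h).τ (st (x :: h)).τ ∧ (st h).μ ⊆ (st (x :: h)).μ := by
    rintro ⟨c, i⟩ h
    by_cases hc : (st h).σ c = none
    · have := hresp _ ((hgood h).2.2 c i hc)
      rw [hpos c i h hc]
      exact ⟨this.2.1, this.2.2.1⟩
    · rw [hneg c i h hc]
      exact ⟨ChoiceLE.refl _, subset_rfl⟩
  have hσ : ∀ h, (h.map Prod.fst).Nodup → ∀ c i, (st h).σ c = some i ↔ (c, i) ∈ h := by
    intro h
    induction h with
    | nil =>
      intro _ c i
      rw [show st [] = resp GameState.start from rfl, (hresp _ h0).1]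
      simp [GameState.start]
    | cons x h ih =>
      obtain ⟨d, j⟩ := x
      intro hn c i
      rw [List.map_cons, List.nodup_cons] at hn
      have hd : (st h).σ d = none := by
        rcases hd : (st h).σ d with _ | k
        · rfl
        · rw [ih hn.2] at hd
          exact absurd (List.mem_map.2 ⟨_, hd, rfl⟩) hn.1
      simp only [hpos d j h hd, (hresp _ ((hgood h).2.2 d j hd)).1, List.mem_cons, Prod.mk.injEq]
      by_cases hcd : c = d
      · subst hcd
        have : (c, i) ∉ h := fun h' => hn.1 (List.mem_map.2 ⟨_, h', rfl⟩)
        simp [this, eq_comm]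
      · simp [hcd, ih hn.2]
  let μ : List (ℕ × Bool) → Set (ℕ × ℕ × ℕ) := fun h => {t | t ∈ (st h).μ ∧
    C.HasLiteral (.pos t.1 t.2.1) ∧ C.HasLiteral (.neg t.1 t.2.2)}
  have hμm : ∀ h, IsMatching (μ h) := fun h P a b a' b' h1 h2 =>
    (hgood h).1 P a b a' b' h1.1 h2.1
  have hμc : ∀ x h, μ h ⊆ μ (x :: h) := fun x h t ht => ⟨(hcons x h).2 ht.1, ht.2⟩
  let partner : List (ℕ × Bool) → Literal → Option Literal := fun h L =>
    if hM : ∃ M, Pairs (μ h) L M then some hM.choose else none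
  have hp : ∀ h L M, partner h L = some M ↔ Pairs (μ h) L M := by
    intro h L M
    constructor
    · intro hM
      simp only [partner] at hM
      split_ifs at hM with hM'
      rw [← Option.some.inj hM]
      exact hM'.choose_spec
    · intro hM
      have hM' : ∃ M, Pairs (μ h) L M := ⟨M, hM⟩
      simp only [partner, dif_pos hM']
      rw [hM'.choose_spec.right_unique (hμm h) hM]
  refine ⟨⟨historyChoices C.chors resp, partner, fun x h => List.prefix_append _ _,
    nodup_historyChoices fun x h => (hcons x h).1, fun x h L M hM => ?_, fun h L M hM => ?_,
    fun h L M hM => ?_, fun h L M hM => ?_, fun h hn => ⟨⟨(st h).σ, (st h).τ, μ h⟩, ?_, hσ h hn,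
      fun c hc i hi => ?_, fun L M hM => (hp h L M).2 hM⟩⟩⟩
  · rw [hp] at hM ⊢; exact hM.mono (hμc x h)
  · rw [hp] at hM ⊢; exact hM.symm
  · rw [hp] at hM; exact hM.opposite
  · rw [hp] at hM
    obtain ⟨P, a, b, hm, ⟨rfl, -⟩ | ⟨rfl, -⟩⟩ := hM
    · exact mem_literals.2 hm.2.1
    · exact mem_literals.2 hm.2.2
  · exact fun v hv => (hgood h).2.1.of_occurring fun P a b hm h1 h2 => hv P a b ⟨hm, h1, h2⟩
  · exact (mem_historyChoices fun x h => (hcons x h).1) h |>.2 ⟨hc, hi⟩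


/-! ### The run tape -/

theorem spell_append (Φ Ψ : Position) : spell (Φ ++ Ψ) = spell Φ ++ spell Ψ := by
  simp [spell]

theorem spell_cons (x : Labmove) (Φ : Position) :
    spell (x :: Φ) = Sum.inl x.1 :: (x.2.map Sum.inr ++ spell Φ) := by
  simp [spell]

theorem spell_singleton (x : Labmove) : spell [x] = Sum.inl x.1 :: x.2.map Sum.inr := by
  simp [spell]

theorem spell_label {A Φ : Position} {x : Labmove} (h : A ++ [x] <+: Φ) :
    (spell Φ)[(spell A).length]? = some (Sum.inl x.1) := by
  obtain ⟨B, rfl⟩ := h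
  simp [spell_append, spell_cons]

theorem spell_key {A Φ : Position} {x : Labmove} {u v : Move} {k : Key} (h : A ++ [x] <+: Φ)
    (hx : x.2 = u ++ k :: v) :
    (spell Φ)[(spell A).length + 1 + u.length]? = some (Sum.inr k) := by
  obtain ⟨B, rfl⟩ := h
  rw [spell_append, spell_append, spell_singleton, hx, List.append_assoc, add_assoc,
    List.getElem?_append_right (by omega), Nat.add_sub_cancel_left, add_comm 1]
  simp

/-- The cell after the last key of a move does not contain a key. -/
theorem spell_end {A Φ : Position} {x : Labmove} (h : A ++ [x] <+: Φ) (k : Key) :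
    (spell Φ)[(spell A).length + 1 + x.2.length]? ≠ some (Sum.inr k) := by
  obtain ⟨B, rfl⟩ := h
  have hl : (spell A).length + 1 + x.2.length = (spell (A ++ [x])).length := by
    simp [spell_append, spell_singleton]; omega
  rw [hl, spell_append, List.getElem?_append_right le_rfl, Nat.sub_self]
  cases B with
  | nil => simp [spell]
  | cons y B => simp [spell_cons]

theorem spell_length_append_singleton (A : Position) (x : Labmove) :
    (spell (A ++ [x])).length = (spell A).length + 1 + x.2.length := by
  simp [spell_append, spell_singleton]; omega

/-! ### The copying machine -/

/-- The activities of the machine. Keys and submissions to be made are listed with `some k` for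
typing the key `k`, and `none` for making the move typed so far. -/
inductive Activity
  | init
  | label
  | skip
  | read (w : Move)
  | emit (acts : List (Option Key)) (rewind : Bool)
  | copy
  | back

/-- Whether the activity is that of marking the leftmost cell at the beginning. -/
def Activity.isInit : Activity → Bool
  | .init => true
  | _ => false

/-- The control states of the machine. While `rescan` holds, it is reading the part of the run that
precedes the environment's latest choice for the sake of the literals that have been matched since
then. -/
structure Control where
  hist : List (ℕ × Bool)
  rescan : Bool
  act : Activity

namespace Cirquent.Strategy

variable {C : Cirquent} (S : C.Strategy)

/-- The literal to which the moves made in `L` have to be copied at the moment. -/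
def active (h : List (ℕ × Bool)) (f : Bool) (L : Literal) : Option Literal :=
  if f = true ∧ (S.partner h.tail L).isSome then none else S.partner h L

open Classical in
/-- The literal to which a move beginning with `w` has to be copied, if `w` is just long enough to
tell that. -/
noncomputable def target (h : List (ℕ × Bool)) (f : Bool) (w : Move) : Option Literal :=
  if hw : ∃ p : Literal × Literal, w = p.1.name ++ [Key.dot] ∧ S.active h f p.1 = some p.2 then
    some hw.choose.2
  else none

theorem target_eq_some {h : List (ℕ × Bool)} {f : Bool} {w : Move} {M : Literal} :
    S.target h f w = some M ↔ ∃ L : Literal, w = L.name ++ [Key.dot] ∧ S.active h f L = some M := by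
  unfold target
  constructor
  · intro hM
    split_ifs at hM with hw
    obtain ⟨h1, h2⟩ := hw.choose_spec
    exact ⟨_, h1, by rw [h2, Option.some.inj hM]⟩
  · rintro ⟨L, rfl, hL⟩
    have hw : ∃ p : Literal × Literal, L.name ++ [Key.dot] = p.1.name ++ [Key.dot] ∧
        S.active h f p.1 = some p.2 := ⟨(L, M), rfl, hL⟩
    rw [dif_pos hw]
    obtain ⟨h1, h2⟩ := hw.choose_spec
    have h3 : L = hw.choose.1 := Literal.name_injective (List.append_cancel_right h1)
    rw [← h3, hL] at h2
    exact h2.symm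

/-- The keys and submissions by which choices are announced. -/
def announcement (l : List (ℕ × Bool)) : List (Option Key) :=
  l.flatMap fun y => (chorLabmove y.1 y.2).2.map some ++ [none]

/-- The choices that the machine makes in response to the choice `x`. -/
def response (x : ℕ × Bool) (h : List (ℕ × Bool)) : List (ℕ × Bool) :=
  (S.announced (x :: h)).drop (S.announced h).length

theorem announced_append_response (x : ℕ × Bool) (h : List (ℕ × Bool)) :
    S.announced h ++ S.response x h = S.announced (x :: h) := by
  obtain ⟨l, hl⟩ := S.announced_cons x h
  rw [response, ← hl, List.drop_left]

open Classical in
/-- What the machine does when it has read the move `w` and has not found a reason to copy it. -/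
noncomputable def finish (h : List (ℕ × Bool)) (f : Bool) (w : Move) : Control :=
  if f then ⟨h, decide (chandOf (.environment, w) ≠ h.head?), .label⟩
  else
    match chandOf (.environment, w) with
    | none => ⟨h, f, .label⟩
    | some x =>
      if x.1 ∈ C.chands ∧ x.1 ∉ h.map Prod.fst then
        ⟨x :: h, true, .emit (announcement (S.response x h)) true⟩
      else ⟨h, f, .label⟩

/-- The transition function, where `n` bounds the number of the keys that are memorized, `o` is the
scanned symbol of the run tape, and `mark` tells whether its leftmost cell is scanned. -/
noncomputable def step (n : ℕ) (s : Control) (o : Option RunSymbol) (mark : Bool) :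
    Control × Option Turing.Dir × MoveAction :=
  match s.act with
  | .init => (⟨s.hist, s.rescan, .emit (announcement (S.announced [])) true⟩, none, .idle)
  | .label =>
    match o with
    | some (.inl .environment) => (⟨s.hist, s.rescan, .read []⟩, some .right, .idle)
    | some (.inl .machine) => (⟨s.hist, s.rescan, .skip⟩, some .right, .idle)
    | _ => (s, none, .idle)
  | .skip =>
    match o with
    | some (.inr _) => (s, some .right, .idle)
    | _ => (⟨s.hist, s.rescan, .label⟩, none, .idle)
  | .read w =>
    match o with
    | some (.inr k) =>
      match S.target s.hist s.rescan (w ++ [k]) with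
      | some M => (⟨s.hist, s.rescan, .emit ((M.name ++ [Key.dot]).map some) false⟩, some .right,
          .idle)
      | none =>
        if (w ++ [k]).length ≤ n then (⟨s.hist, s.rescan, .read (w ++ [k])⟩, some .right, .idle)
        else (⟨s.hist, s.rescan, .skip⟩, some .right, .idle)
    | _ => (S.finish s.hist s.rescan w, none, .idle)
  | .emit (some k :: l) r => (⟨s.hist, s.rescan, .emit l r⟩, none, .type k)
  | .emit (none :: l) r => (⟨s.hist, s.rescan, .emit l r⟩, none, .submit)
  | .emit [] r => (⟨s.hist, s.rescan, if r then .back else .copy⟩, none, .idle)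
  | .copy =>
    match o with
    | some (.inr k) => (s, some .right, .type k)
    | _ => (⟨s.hist, s.rescan, .label⟩, none, .submit)
  | .back =>
    if mark then (⟨s.hist, s.rescan, .label⟩, none, .idle) else (s, some .left, .idle)

/-- Histories of choices that can arise when the environment plays legally. -/
def IsHistory (C : Cirquent) (h : List (ℕ × Bool)) : Prop :=
  (h.map Prod.fst).Nodup ∧ ∀ x ∈ h, x.1 ∈ C.chands

theorem IsHistory.length_le {h : List (ℕ × Bool)} (hh : IsHistory C h) :
    h.length ≤ C.chands.card := by
  rw [← List.length_map (f := Prod.fst), ← List.toFinset_card_of_nodup hh.1]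
  refine Finset.card_le_card fun c hc => ?_
  obtain ⟨x, hx, rfl⟩ := List.mem_map.1 (List.mem_toFinset.1 hc)
  exact hh.2 x hx

theorem finite_histories (C : Cirquent) : {h | IsHistory C h}.Finite := by
  have : Finite {x : ℕ × Bool // x ∈ C.chands ×ˢ Finset.univ} := Finset.finite_toSet _
  refine ((List.finite_length_le {x : ℕ × Bool // x ∈ C.chands ×ˢ Finset.univ}
    C.chands.card).image (List.map Subtype.val)).subset fun h hh => ?_
  refine ⟨h.attach.map fun x => ⟨x.1, by simpa using hh.2 x.1 x.2⟩, ?_, ?_⟩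
  · change List.length _ ≤ _
    simpa using hh.length_le
  · rw [List.map_map]
    exact List.attach_map_subtype_val h

/-- `n` bounds the lengths of all strings that the machine has to store in its control state. -/
structure Bounded (n : ℕ) : Prop where
  name : ∀ L ∈ C.literals, L.name.length + 1 ≤ n
  choice : ∀ c ∈ C.chands, ∀ i, (chandLabmove c i).2.length ≤ n
  start : (announcement (S.announced [])).length ≤ n
  response : ∀ x h, IsHistory C (x :: h) → (announcement (S.response x h)).length ≤ n

theorem exists_bounded : ∃ n, S.Bounded n := by
  obtain ⟨a, ha⟩ := (C.literals.finite_toSet.image fun L => L.name.length + 1).bddAbove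
  obtain ⟨b, hb⟩ := ((C.chands ×ˢ (Finset.univ : Finset Bool)).finite_toSet.image
    fun x => (chandLabmove x.1 x.2).2.length).bddAbove
  obtain ⟨d, hd⟩ := ((finite_histories C).image fun h =>
    (announcement ((S.announced h).drop (S.announced h.tail).length)).length).bddAbove
  refine ⟨max (max a b) (max (announcement (S.announced [])).length d), fun L hL => ?_,
    fun c hc i => ?_, by simp, fun x h hh => ?_⟩
  · exact (ha ⟨L, hL, rfl⟩).trans (by simp)
  · exact (hb ⟨(c, i), by simpa using hc, rfl⟩).trans (by simp)
  · exact (hd ⟨x :: h, hh, rfl⟩).trans (by simp)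

/-- The control states that are used by the machine. -/
def IsControl (C : Cirquent) (n : ℕ) (s : Control) : Prop :=
  IsHistory C s.hist ∧ match s.act with
    | .read w => w.length ≤ n
    | .emit l _ => l.length ≤ n
    | _ => True

instance : Finite Key := by
  let g : Key → Fin 10 ⊕ Fin 26 ⊕ Fin 5 := fun
    | .digit d => .inl d
    | .latin l => .inr (.inl l)
    | .dot => .inr (.inr 0)
    | .caret => .inr (.inr 1)
    | .neg => .inr (.inr 2)
    | .chand => .inr (.inr 3)
    | .chor => .inr (.inr 4)
  refine Finite.of_injective g fun k l h => ?_
  cases k <;> cases l <;> simp [g] at h ⊢ <;> exact h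

theorem finite_controls (C : Cirquent) (n : ℕ) : {s | IsControl C n s}.Finite := by
  have hA : ({.init, .label, .skip, .copy, .back} ∪ Activity.read '' {w | w.length ≤ n} ∪
      (fun p : List (Option Key) × Bool => Activity.emit p.1 p.2) ''
        ({l | l.length ≤ n} ×ˢ Set.univ) : Set Activity).Finite :=
    ((Set.toFinite _).union ((List.finite_length_le _ n).image _)).union
      (((List.finite_length_le _ n).prod Set.finite_univ).image _)
  refine (((finite_histories C).prod (Set.finite_univ.prod hA)).image
    fun p : List (ℕ × Bool) × Bool × Activity => Control.mk p.1 p.2.1 p.2.2).subset ?_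
  rintro ⟨h, f, a⟩ ⟨h1, h2⟩
  refine ⟨(h, f, a), ⟨h1, Set.mem_univ _, ?_⟩, rfl⟩
  cases a with
  | read w => exact Or.inl (Or.inr ⟨w, h2, rfl⟩)
  | emit l r => exact Or.inr ⟨(l, r), ⟨h2, Set.mem_univ _⟩, rfl⟩
  | _ => simp

theorem active_partner {h : List (ℕ × Bool)} {f : Bool} {L M : Literal}
    (hL : S.active h f L = some M) : S.partner h L = some M := by
  unfold active at hL
  split_ifs at hL
  exact hL

theorem isControl_finish {n : ℕ} (hn : S.Bounded n) {h : List (ℕ × Bool)} (hh : IsHistory C h)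
    (f : Bool) (w : Move) : IsControl C n (S.finish h f w) := by
  unfold finish
  split
  · exact ⟨hh, trivial⟩
  · split
    · exact ⟨hh, trivial⟩
    · rename_i x _
      split_ifs with hx
      · have : IsHistory C (x :: h) := by
          refine ⟨List.nodup_cons.2 ⟨hx.2, hh.1⟩, fun y hy => ?_⟩
          rcases List.mem_cons.1 hy with rfl | hy
          · exact hx.1
          · exact hh.2 y hy
        exact ⟨this, hn.response x h this⟩
      · exact ⟨hh, trivial⟩

theorem isControl_step {n : ℕ} (hn : S.Bounded n) {s : Control} (hs : IsControl C n s)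
    (o : Option RunSymbol) (mark : Bool) : IsControl C n (S.step n s o mark).1 := by
  obtain ⟨h, f, a⟩ := s
  obtain ⟨hh, ha⟩ := hs
  unfold step
  split
  · exact ⟨hh, hn.start⟩
  · split
    · exact ⟨hh, Nat.zero_le _⟩
    · exact ⟨hh, trivial⟩
    · exact ⟨hh, ha⟩
  · split
    · exact ⟨hh, ha⟩
    · exact ⟨hh, trivial⟩
  · split
    · split
      · rename_i M hM
        obtain ⟨L, -, hL⟩ := S.target_eq_some.1 hM
        refine ⟨hh, ?_⟩
        simpa using hn.name M (S.partner_mem _ _ _ (S.partner_symm _ _ _ (S.active_partner hL)))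
      · split_ifs with hw
        · exact ⟨hh, hw⟩
        · exact ⟨hh, trivial⟩
    · exact S.isControl_finish hn hh _ _
  · rename_i k l r hact
    simp only at hact
    subst hact
    exact ⟨hh, (Nat.le_succ _).trans ha⟩
  · rename_i l r hact
    simp only at hact
    subst hact
    exact ⟨hh, (Nat.le_succ _).trans ha⟩
  · rename_i r _
    cases r <;> exact ⟨hh, trivial⟩
  · split
    · exact ⟨hh, ha⟩
    · exact ⟨hh, trivial⟩
  · split
    · exact ⟨hh, trivial⟩
    · exact ⟨hh, ha⟩

/-- The machine. The head of its only work tape moves along with that of the run tape, so that a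
mark made at the beginning shows the leftmost cell of the run tape. -/
noncomputable def machine {n : ℕ} (hn : S.Bounded n) : HPM where
  State := {s // IsControl C n s}
  stateFinite := finite_controls C n
  start := ⟨⟨[], false, .init⟩, ⟨by simp, by simp⟩, trivial⟩
  WorkSymbol := Bool
  tapes := 1
  program s o b :=
    let r := S.step n s.1 o (b 0)
    (⟨r.1, S.isControl_step hn s.2 o (b 0)⟩, r.2.1,
      fun i => (s.1.act.isInit || b i, r.2.1), r.2.2)

end Cirquent.Strategy


/-! ### What the machine has copied -/

theorem moveBy_move (L M : Literal) (p q : Player) (α : Move) :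
    L.moveBy p (q, M.move α) = if L = M ∧ p = q then some α else none := by
  split_ifs with h
  · rw [Literal.moveBy_eq_some, h.1, h.2]
  · by_contra hne
    obtain ⟨β, hβ⟩ := Option.ne_none_iff_exists'.1 hne
    rw [Literal.moveBy_eq_some] at hβ
    obtain ⟨h1, h2⟩ := Prod.mk.inj hβ
    exact h ⟨(Literal.move_inj h2).1.symm, h1.symm⟩

theorem moveBy_chandLabmove (L : Literal) (p : Player) (c : ℕ) (i : Bool) :
    L.moveBy p (chandLabmove c i) = none := by
  by_contra hne
  obtain ⟨β, hβ⟩ := Option.ne_none_iff_exists'.1 hne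
  rw [Literal.moveBy_eq_some] at hβ
  exact chandLabmove_ne_move c i L β (congrArg Prod.snd hβ)

theorem moveBy_chorLabmove (L : Literal) (p : Player) (c : ℕ) (i : Bool) :
    L.moveBy p (chorLabmove c i) = none := by
  by_contra hne
  obtain ⟨β, hβ⟩ := Option.ne_none_iff_exists'.1 hne
  rw [Literal.moveBy_eq_some] at hβ
  exact chorLabmove_ne_move c i L β (congrArg Prod.snd hβ)

theorem prefix_append_cases {α : Type} {l a b : List α} (h : l <+: a ++ b) :
    l <+: a ∨ ∃ b', b' <+: b ∧ l = a ++ b' := by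
  rcases List.prefix_or_prefix_of_prefix h (List.prefix_append a b) with h' | ⟨b', rfl⟩
  · exact Or.inl h'
  · exact Or.inr ⟨b', (List.prefix_append_right_inj a).1 h, rfl⟩

/-- In the position `Φ` no two choices are made by the environment in the same cluster. -/
def ChoicesDistinct (Φ : Position) : Prop := ((Φ.filterMap chandOf).map Prod.fst).Nodup

theorem ChoicesDistinct.notMem {Φ A : Position} {c : ℕ} {i : Bool} (h : ChoicesDistinct Φ)
    (hA : A ++ [chandLabmove c i] <+: Φ) (j : Bool) : chandLabmove c j ∉ A := by
  intro hj
  have h1 := ((hA.sublist.filterMap chandOf).map Prod.fst).nodup h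
  rw [List.filterMap_append, List.filterMap_cons_some (chandOf_eq_some.2 rfl), List.map_append,
    List.nodup_append] at h1
  exact h1.2.2 c (List.mem_map.2 ⟨(c, j), List.mem_filterMap.2 ⟨_, hj, chandOf_eq_some.2 rfl⟩, rfl⟩)
    c (by simp) rfl

namespace Cirquent.Strategy

variable {C : Cirquent} {S : C.Strategy} {h : List (ℕ × Bool)} {f : Bool} {A B Φ : Position}

/-- The main invariant of the machine at the position `Φ`. The labmoves in `B` have been processed;
if `B` is being rescanned, then `A` is the part of it that has already been rescanned. -/
structure Progress (S : C.Strategy) (h : List (ℕ × Bool)) (f : Bool) (A B Φ : Position) : Prop where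
  prefix_processed : A <+: B
  prefix_position : B <+: Φ
  isHistory : IsHistory C h
  mem_hist : ∀ c ∈ C.chands, ∀ i, (c, i) ∈ h ↔ chandLabmove c i ∈ B
  eq_of_not_rescan : f = false → A = B
  eq_of_rescan : f = true → ∃ x t B', h = x :: t ∧ B = B' ++ [chandLabmove x.1 x.2] ∧ A <+: B'
  copied : ∀ L M, S.partner h L = some M → Φ.filterMap (M.moveBy .machine) =
    (if S.active h f L = some M then A else B).filterMap (L.moveBy .environment)
  unmatched : ∀ M, S.partner h M = none → Φ.filterMap (M.moveBy .machine) = []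
  lag : ∀ Ψ, Ψ <+: Φ → ∀ L M, S.partner h L = some M →
    Ψ.filterMap (M.moveBy .machine) <+: Ψ.filterMap (L.moveBy .environment)

/-- The environment's moves, and announcements of choices, do not affect what has been copied. -/
theorem Progress.append (hp : S.Progress h f A B Φ) {E : Position}
    (hE : ∀ M : Literal, E.filterMap (M.moveBy .machine) = []) :
    S.Progress h f A B (Φ ++ E) where
  prefix_processed := hp.prefix_processed
  prefix_position := hp.prefix_position.trans (List.prefix_append _ _)
  isHistory := hp.isHistory
  mem_hist := hp.mem_hist
  eq_of_not_rescan := hp.eq_of_not_rescan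
  eq_of_rescan := hp.eq_of_rescan
  copied L M hLM := by rw [List.filterMap_append, hE, List.append_nil, hp.copied L M hLM]
  unmatched M hM := by rw [List.filterMap_append, hE, List.append_nil, hp.unmatched M hM]
  lag Ψ hΨ L M hLM := by
    rcases prefix_append_cases hΨ with hΨ | ⟨E', hE', rfl⟩
    · exact hp.lag Ψ hΨ L M hLM
    · have : E'.filterMap (M.moveBy .machine) = [] :=
        List.prefix_nil.1 (hE M ▸ hE'.filterMap _)
      rw [List.filterMap_append, this, List.append_nil, List.filterMap_append]
      exact (hp.lag Φ List.prefix_rfl L M hLM).trans (List.prefix_append _ _)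

theorem active_of_not_rescan (S : C.Strategy) (h : List (ℕ × Bool)) (L : Literal) :
    S.active h false L = S.partner h L := by simp [active]

/-- The machine turns to the next labmove, after making the moves `E` in response to `x`. -/
theorem Progress.advance (hp : S.Progress h f A B Φ) (hΦ : ChoicesDistinct Φ) {x : Labmove}
    (hx : A ++ [x] <+: Φ) {E : Position}
    (hE : ∀ L M, S.partner h L = some M → E.filterMap (M.moveBy .machine) =
      if S.active h f L = some M then [x].filterMap (L.moveBy .environment) else [])
    (hE' : ∀ M, S.partner h M = none → E.filterMap (M.moveBy .machine) = [])
    (hf : f = true → ∀ y, h.head? = some y → x ≠ chandLabmove y.1 y.2)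
    (hf' : f = false → ∀ c i, x = chandLabmove c i → c ∈ C.chands → c ∈ h.map Prod.fst) :
    ∃ B', S.Progress h f (A ++ [x]) B' (Φ ++ E) ∧ (f = true → B' = B) := by
  have lag : ∀ B' : Position, A ++ [x] <+: B' → B' <+: Φ →
      (∀ L M, S.partner h L = some M → (Φ ++ E).filterMap (M.moveBy .machine) =
        (if S.active h f L = some M then A ++ [x] else B').filterMap (L.moveBy .environment)) →
      ∀ Ψ, Ψ <+: Φ ++ E → ∀ L M, S.partner h L = some M →
      Ψ.filterMap (M.moveBy .machine) <+: Ψ.filterMap (L.moveBy .environment) := by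
    intro B' h1 h2 h3 Ψ hΨ L M hLM
    rcases prefix_append_cases hΨ with hΨ' | ⟨E', hE', rfl⟩
    · exact hp.lag Ψ hΨ' L M hLM
    · refine (hΨ.filterMap _).trans ?_
      rw [h3 L M hLM, List.filterMap_append]
      refine List.IsPrefix.trans ?_ (List.prefix_append _ _)
      split_ifs
      · exact hx.filterMap _
      · exact h2.filterMap _
  have unm : ∀ M, S.partner h M = none → (Φ ++ E).filterMap (M.moveBy .machine) = [] := by
    intro M hM
    rw [List.filterMap_append, hp.unmatched M hM, hE' M hM]; rfl
  cases f with
  | false =>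
    obtain rfl := hp.eq_of_not_rescan rfl
    have hcop : ∀ L M, S.partner h L = some M → (Φ ++ E).filterMap (M.moveBy .machine) =
        (if S.active h false L = some M then A ++ [x] else A ++ [x]).filterMap
          (L.moveBy .environment) := by
      intro L M hLM
      rw [List.filterMap_append, hp.copied L M hLM, hE L M hLM, active_of_not_rescan, if_pos hLM,
        if_pos hLM, if_pos hLM, List.filterMap_append]
    refine ⟨A ++ [x], ⟨List.prefix_rfl, hx.trans (List.prefix_append _ _), hp.isHistory,
      fun c hc i => ?_, fun _ => rfl, fun h => (Bool.false_ne_true h).elim, hcop, unm,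
      lag _ List.prefix_rfl hx hcop⟩, fun h => (Bool.false_ne_true h).elim⟩
    rw [hp.mem_hist c hc, List.mem_append, List.mem_singleton]
    refine ⟨Or.inl, fun hi => hi.resolve_right fun hi => ?_⟩
    obtain ⟨⟨d, j⟩, hy, rfl⟩ := List.mem_map.1 (hf' rfl c i hi.symm hc)
    rw [hp.mem_hist _ hc] at hy
    subst hi
    exact hΦ.notMem hx j hy
  | true =>
    obtain ⟨y, t, B₀, rfl, rfl, hA⟩ := hp.eq_of_rescan rfl
    have hAB : A ++ [x] <+: B₀ := by
      rcases Nat.lt_or_ge A.length B₀.length with hl | hl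
      · exact List.prefix_of_prefix_length_le hx
          ((List.prefix_append _ _).trans hp.prefix_position) (by simpa using hl)
      · obtain rfl := hA.eq_of_length_le hl
        have := List.prefix_of_prefix_length_le hx hp.prefix_position (by simp)
        have := this.eq_of_length (by simp)
        exact absurd (by simpa using this) (hf rfl y rfl)
    have hcop : ∀ L M, S.partner (y :: t) L = some M → (Φ ++ E).filterMap (M.moveBy .machine) =
        (if S.active (y :: t) true L = some M then A ++ [x] else B₀ ++ [chandLabmove y.1 y.2]).filterMap
          (L.moveBy .environment) := by
      intro L M hLM
      rw [List.filterMap_append, hp.copied L M hLM, hE L M hLM]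
      split_ifs <;> simp
    exact ⟨_, ⟨hAB.trans (List.prefix_append _ _),
      hp.prefix_position.trans (List.prefix_append _ _), hp.isHistory, hp.mem_hist,
      fun h => (Bool.false_ne_true h.symm).elim, fun _ => ⟨y, t, B₀, rfl, rfl, hAB⟩, hcop, unm,
      lag _ (hAB.trans (List.prefix_append _ _)) hp.prefix_position hcop⟩, fun _ => rfl⟩

theorem Progress.skip (hp : S.Progress h f A B Φ) (hΦ : ChoicesDistinct Φ) {x : Labmove}
    (hx : A ++ [x] <+: Φ)
    (hL : ∀ L M, S.active h f L = some M → L.moveBy .environment x = none)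
    (hf : f = true → ∀ y, h.head? = some y → x ≠ chandLabmove y.1 y.2)
    (hf' : f = false → ∀ c i, x = chandLabmove c i → c ∈ C.chands → c ∈ h.map Prod.fst) :
    ∃ B', S.Progress h f (A ++ [x]) B' Φ ∧ (f = true → B' = B) := by
  obtain ⟨B', h1, h2⟩ := hp.advance hΦ hx (E := []) (fun L M _ => by
    split_ifs with h
    · simp [hL L M h]
    · rfl) (fun M _ => rfl) hf hf'
  exact ⟨B', by simpa using h1, h2⟩

theorem Progress.allowedMove (hp : S.Progress h f A B Φ) {L M : Literal}
    (hL : S.active h f L = some M) {β : Move} (hx : A ++ [(.environment, L.move β)] <+: Φ) :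
    AllowedMove Φ (M.move β) := by
  have hLM := S.active_partner hL
  refine Or.inr ⟨L, M, β, S.partner_opposite _ _ _ hLM, rfl, fun Ψ hΨ => hp.lag Ψ hΨ L M hLM,
    fun Ψ hΨ => hp.lag Ψ hΨ M L (S.partner_symm _ _ _ hLM), ?_⟩
  rw [hp.copied L M hLM, if_pos hL]
  simpa [moveBy_move] using hx.filterMap (L.moveBy .environment)

/-- The machine copies the move that it has just read. -/
theorem Progress.copy (hp : S.Progress h f A B Φ) (hΦ : ChoicesDistinct Φ) {L M : Literal}
    (hL : S.active h f L = some M) {β : Move} (hx : A ++ [(.environment, L.move β)] <+: Φ) :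
    ∃ B', S.Progress h f (A ++ [(.environment, L.move β)]) B' (Φ ++ [(.machine, M.move β)]) ∧
      (f = true → B' = B) := by
  have hLM := S.active_partner hL
  refine hp.advance hΦ hx (fun K N hKN => ?_) (fun N hN => ?_) (fun _ y _ => ?_)
    (fun _ c i hc _ => ?_)
  · by_cases hN : N = M
    · subst hN
      obtain rfl : L = K := by
        have := S.partner_symm _ _ _ hKN
        rw [S.partner_symm _ _ _ hLM] at this
        exact Option.some.inj this
      rw [if_pos hL]
      simp [moveBy_move]
    · have hKL : S.active h f K = some N → K ≠ L := by
        rintro h1 rfl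
        rw [hL] at h1
        exact hN (Option.some.inj h1).symm
      split_ifs with h1
      · simp [moveBy_move, hN, hKL h1]
      · simp [moveBy_move, hN]
  · have : N ≠ M := by
      rintro rfl
      rw [S.partner_symm _ _ _ hLM] at hN
      cases hN
    simp [moveBy_move, this]
  · exact fun h => chandLabmove_ne_move y.1 y.2 L β (congrArg Prod.snd h).symm
  · exact absurd (congrArg Prod.snd hc).symm (chandLabmove_ne_move c i L β)

/-- A new choice of the environment is met, and the machine responds to it. -/
theorem Progress.push (hp : S.Progress h false A B Φ) {c : ℕ} {i : Bool}
    (hx : A ++ [chandLabmove c i] <+: Φ) (hc : c ∈ C.chands) (hch : c ∉ h.map Prod.fst) :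
    S.Progress ((c, i) :: h) true [] (A ++ [chandLabmove c i]) Φ := by
  obtain rfl := hp.eq_of_not_rescan rfl
  have hist : IsHistory C ((c, i) :: h) := by
    refine ⟨List.nodup_cons.2 ⟨hch, hp.isHistory.1⟩, fun y hy => ?_⟩
    rcases List.mem_cons.1 hy with rfl | hy
    · exact hc
    · exact hp.isHistory.2 y hy
  have hnone : ∀ L M, S.partner ((c, i) :: h) L = some M → S.partner h L = none →
      Φ.filterMap (M.moveBy .machine) = [] := by
    intro L M hLM hL
    apply hp.unmatched
    by_contra hne
    obtain ⟨K, hK⟩ := Option.ne_none_iff_exists'.1 hne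
    have h1 := S.partner_cons (c, i) h M K hK
    rw [S.partner_symm _ _ _ hLM] at h1
    obtain rfl := Option.some.inj h1
    rw [S.partner_symm _ _ _ hK] at hL
    cases hL
  have hsome : ∀ L M N, S.partner ((c, i) :: h) L = some M → S.partner h L = some N → N = M := by
    intro L M N hLM hL
    have h1 := S.partner_cons (c, i) h L N hL
    rw [hLM] at h1
    exact (Option.some.inj h1).symm
  refine ⟨List.nil_prefix, hx, hist, fun d hd j => ?_,
    fun h => (Bool.false_ne_true h.symm).elim, fun _ => ⟨_, _, _, rfl, rfl, List.nil_prefix⟩,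
    fun L M hLM => ?_, fun M hM => ?_, fun Ψ hΨ L M hLM => ?_⟩
  · rw [List.mem_cons, List.mem_append, hp.mem_hist d hd, List.mem_singleton, or_comm]
    refine or_congr_right ⟨fun h => ?_, fun h => ?_⟩
    · obtain ⟨rfl, rfl⟩ := Prod.mk.inj h; rfl
    · obtain ⟨rfl, rfl⟩ := chandLabmove_inj h; rfl
  · rcases hL : S.partner h L with _ | N
    · rw [hnone L M hLM hL, if_pos]
      · rfl
      · simpa [active, hL] using hLM
    · obtain rfl := hsome L M N hLM hL
      rw [hp.copied L N hL, ite_self, if_neg (by simp [active, hL]), List.filterMap_append]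
      simp [moveBy_chandLabmove]
  · apply hp.unmatched
    by_contra hne
    obtain ⟨K, hK⟩ := Option.ne_none_iff_exists'.1 hne
    rw [S.partner_cons (c, i) h M K hK] at hM
    cases hM
  · rcases hL : S.partner h L with _ | N
    · have : Ψ.filterMap (M.moveBy .machine) <+: [] := hnone L M hLM hL ▸ hΨ.filterMap _
      rw [List.prefix_nil.1 this]
      exact List.nil_prefix
    · obtain rfl := hsome L M N hLM hL
      exact hp.lag Ψ hΨ L N hL

/-- The latest choice of the environment is met again, so rescanning is over. -/
theorem Progress.pop {x : ℕ × Bool} {t : List (ℕ × Bool)} (hp : S.Progress (x :: t) true A B Φ)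
    (hΦ : ChoicesDistinct Φ) (hx : A ++ [chandLabmove x.1 x.2] <+: Φ) :
    S.Progress (x :: t) false (A ++ [chandLabmove x.1 x.2]) (A ++ [chandLabmove x.1 x.2]) Φ := by
  obtain ⟨y, t', B₀, h1, rfl, hA⟩ := hp.eq_of_rescan rfl
  obtain ⟨rfl, rfl⟩ := List.cons.inj h1
  have hl : B₀.length ≤ A.length := by
    by_contra hl
    push Not at hl
    have h2 : A ++ [chandLabmove x.1 x.2] <+: B₀ := List.prefix_of_prefix_length_le hx
      ((List.prefix_append _ _).trans hp.prefix_position) (by simpa using hl)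
    exact hΦ.notMem hp.prefix_position x.2 (h2.subset (by simp))
  obtain rfl := hA.eq_of_length_le hl
  refine ⟨List.prefix_rfl, hx, hp.isHistory, hp.mem_hist, fun _ => rfl,
    fun h => (Bool.false_ne_true h).elim, fun L M hLM => ?_, hp.unmatched, hp.lag⟩
  rw [hp.copied L M hLM, ite_self]
  split_ifs
  · simp [List.filterMap_append, moveBy_chandLabmove]
  · rfl

theorem Progress.init {Φ : Position} (hΦ : ∀ x ∈ Φ, x.1 = Player.environment) :
    S.Progress [] false [] [] Φ := by
  have h : ∀ Ψ, Ψ <+: Φ → ∀ M : Literal, Ψ.filterMap (M.moveBy .machine) = [] := by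
    intro Ψ hΨ M
    rw [List.filterMap_eq_nil_iff]
    intro x hx
    by_contra hne
    obtain ⟨β, hβ⟩ := Option.ne_none_iff_exists'.1 hne
    rw [Literal.moveBy_eq_some] at hβ
    have := hΦ x (hΨ.subset hx)
    rw [hβ] at this
    cases this
  refine ⟨List.prefix_rfl, List.nil_prefix, ⟨by simp, by simp⟩, by simp, fun _ => rfl,
    fun h => (Bool.false_ne_true h).elim, fun L M _ => ?_, fun M _ => h Φ List.prefix_rfl M,
    fun Ψ hΨ L M _ => ?_⟩
  · rw [h Φ List.prefix_rfl, ite_self]; rfl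
  · rw [h Ψ hΨ]; exact List.nil_prefix

end Cirquent.Strategy


/-! ### The invariant of the machine -/

theorem append_none_inj {u v : Move} {l l' : List (Option Key)}
    (h : u.map some ++ none :: l = v.map some ++ none :: l') : u = v ∧ l = l' := by
  induction u generalizing v with
  | nil =>
    cases v with
    | nil => simpa using h
    | cons k v => simp at h
  | cons k u ih =>
    cases v with
    | nil => simp at h
    | cons k' v =>
      simp only [List.map_cons, List.cons_append, List.cons.injEq, Option.some.injEq] at h
      obtain ⟨h1, h2⟩ := ih h.2
      exact ⟨by rw [h.1, h1], h2⟩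

theorem chorOf_machine_move (M : Literal) (β : Move) : chorOf (.machine, M.move β) = none := by
  by_contra hne
  obtain ⟨⟨c, i⟩, hc⟩ := Option.ne_none_iff_exists'.1 hne
  rw [chorOf_eq_some] at hc
  exact chorLabmove_ne_move c i M β (congrArg Prod.snd hc).symm

namespace Cirquent.Strategy

variable {C : Cirquent} (S : C.Strategy)

/-- The invariant of the machine at the position `Φ`, the head of the run tape being at the cell
with the given number, and the given move being under construction. The last argument decreases
until the machine turns to the next labmove. -/
inductive Invariant (n : ℕ) :
    Control → ℕ → Move → Position → Position → Position → ℕ ×ₗ ℕ → Prop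
  | init (Φ : Position) (hΦ : ∀ x ∈ Φ, x.1 = Player.environment) :
      Invariant n ⟨[], false, .init⟩ 0 [] Φ [] [] (toLex (7, 0))
  | label (h : List (ℕ × Bool)) (f : Bool) (A B Φ : Position) (hp : S.Progress h f A B Φ)
      (hch : Φ.filterMap chorOf = S.announced h) :
      Invariant n ⟨h, f, .label⟩ (spell A).length [] Φ A B (toLex (4, 0))
  | skip (h : List (ℕ × Bool)) (f : Bool) (A B Φ : Position) (x : Labmove) (u v : Move)
      (hp : S.Progress h f (A ++ [x]) B Φ) (hch : Φ.filterMap chorOf = S.announced h)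
      (hx : x.2 = u ++ v) :
      Invariant n ⟨h, f, .skip⟩ ((spell A).length + 1 + u.length) [] Φ (A ++ [x]) B
        (toLex (5, v.length))
  | read (h : List (ℕ × Bool)) (f : Bool) (A B Φ : Position) (w v : Move)
      (hp : S.Progress h f A B Φ) (hch : Φ.filterMap chorOf = S.announced h)
      (hx : A ++ [(.environment, w ++ v)] <+: Φ)
      (ht : ∀ w', w' <+: w → S.target h f w' = none) :
      Invariant n ⟨h, f, .read w⟩ ((spell A).length + 1 + w.length) [] Φ A B (toLex (3, v.length))
  | name (h : List (ℕ × Bool)) (f : Bool) (A B Φ : Position) (L M : Literal) (u v β : Move)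
      (hp : S.Progress h f A B Φ) (hch : Φ.filterMap chorOf = S.announced h)
      (hx : A ++ [(.environment, L.move β)] <+: Φ) (hL : S.active h f L = some M)
      (hu : M.name ++ [Key.dot] = u ++ v) :
      Invariant n ⟨h, f, .emit (v.map some) false⟩
        ((spell A).length + 1 + (L.name ++ [Key.dot]).length) u Φ A B (toLex (2, v.length))
  | copy (h : List (ℕ × Bool)) (f : Bool) (A B Φ : Position) (L M : Literal) (β γ : Move)
      (hp : S.Progress h f A B Φ) (hch : Φ.filterMap chorOf = S.announced h)
      (hx : A ++ [(.environment, L.move (β ++ γ))] <+: Φ) (hL : S.active h f L = some M) :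
      Invariant n ⟨h, f, .copy⟩ ((spell A).length + 1 + (L.move β).length) (M.move β) Φ A B
        (toLex (1, γ.length))
  | announce (h : List (ℕ × Bool)) (f : Bool) (B Φ : Position) (k : ℕ) (u : Move)
      (l : List (ℕ × Bool)) (acts : List (Option Key)) (hp : S.Progress h f [] B Φ)
      (hch : Φ.filterMap chorOf ++ l = S.announced h)
      (hu : announcement l = u.map some ++ acts) :
      Invariant n ⟨h, f, .emit acts true⟩ k u Φ [] B (toLex (6, acts.length))
  | back (h : List (ℕ × Bool)) (f : Bool) (B Φ : Position) (k : ℕ) (hp : S.Progress h f [] B Φ)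
      (hch : Φ.filterMap chorOf = S.announced h) :
      Invariant n ⟨h, f, .back⟩ k [] Φ [] B (toLex (5, k))

variable {S} {n : ℕ} {s : Control} {k : ℕ} {u : Move} {Φ A B : Position} {r : ℕ ×ₗ ℕ}

/-- The environment's moves do not affect the invariant. -/
theorem Invariant.append_environment (hI : S.Invariant n s k u Φ A B r) {E : Position}
    (hE : ∀ x ∈ E, x.1 = Player.environment) : S.Invariant n s k u (Φ ++ E) A B r := by
  have h1 : ∀ M : Literal, E.filterMap (M.moveBy .machine) = [] := by
    intro M
    rw [List.filterMap_eq_nil_iff]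
    intro x hx
    by_contra hne
    obtain ⟨β, hβ⟩ := Option.ne_none_iff_exists'.1 hne
    rw [Literal.moveBy_eq_some] at hβ
    have := hE x hx
    rw [hβ] at this
    cases this
  have h2 : E.filterMap chorOf = [] := by
    rw [List.filterMap_eq_nil_iff]
    intro x hx
    by_contra hne
    obtain ⟨⟨c, i⟩, hc⟩ := Option.ne_none_iff_exists'.1 hne
    rw [chorOf_eq_some] at hc
    have := hE x hx
    rw [hc] at this
    cases this
  have h3 : (Φ ++ E).filterMap chorOf = Φ.filterMap chorOf := by
    rw [List.filterMap_append, h2, List.append_nil]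
  cases hI with
  | init _ hΦ => exact .init _ fun x hx => (List.mem_append.1 hx).elim (hΦ x) (hE x)
  | label h f _ _ _ hp hch => exact .label h f _ _ _ (hp.append h1) (h3.trans hch)
  | skip h f A _ _ x u v hp hch hx => exact .skip h f A _ _ x u v (hp.append h1) (h3.trans hch) hx
  | read h f _ _ _ w v hp hch hx ht =>
    exact .read h f _ _ _ w v (hp.append h1) (h3.trans hch) (hx.trans (List.prefix_append _ _)) ht
  | name h f _ _ _ L M _ v β hp hch hx hL hu =>
    exact .name h f _ _ _ L M _ v β (hp.append h1) (h3.trans hch)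
      (hx.trans (List.prefix_append _ _)) hL hu
  | copy h f _ _ _ L M β γ hp hch hx hL =>
    exact .copy h f _ _ _ L M β γ (hp.append h1) (h3.trans hch)
      (hx.trans (List.prefix_append _ _)) hL
  | announce h f _ _ _ _ l acts hp hch hu =>
    exact .announce h f _ _ _ _ l acts (hp.append h1) (by rw [h3, hch]) hu
  | back h f _ _ _ hp hch => exact .back h f _ _ _ (hp.append h1) (h3.trans hch)

/-- The move under construction after a transition. -/
def nextMove (u : Move) : MoveAction → Move
  | .idle => u
  | .type k => u ++ [k]
  | .submit => []

/-- The position after a transition. -/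
def nextPosition (u : Move) (Φ : Position) : MoveAction → Position
  | .submit => Φ ++ [(Player.machine, u)]
  | _ => Φ

/-- This number does not increase in the course of the play. -/
def phase (C : Cirquent) (s : Control) : ℕ :=
  2 * (C.chands.card - s.hist.length) + if s.rescan then 1 else 0

/-- What a transition from `s` to `s'` amounts to: a new phase of the play begins; or the machine
turns to the next labmove; or it comes closer to that; or it has processed the whole position. -/
def Advances (C : Cirquent) (s s' : Control) (Φ A A' B B' : Position) (r r' : ℕ ×ₗ ℕ) : Prop :=
  phase C s' < phase C s ∨ (s'.hist = s.hist ∧ s'.rescan = s.rescan ∧ (s.rescan = true → B' = B) ∧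
    (A.length < A'.length ∨ (A' = A ∧ (r' < r ∨ A = Φ))))

theorem advances_of_lt {C : Cirquent} {h : List (ℕ × Bool)} {f : Bool} {a a' : Activity}
    {Φ A B : Position} {r r' : ℕ ×ₗ ℕ} (hr : r' < r) :
    Advances C ⟨h, f, a⟩ ⟨h, f, a'⟩ Φ A A B B r r' :=
  Or.inr ⟨rfl, rfl, fun _ => rfl, Or.inr ⟨rfl, Or.inl hr⟩⟩

theorem target_of_prefix {h : List (ℕ × Bool)} {f : Bool} {w : Move}
    (ht : ∀ w', w' <+: w → S.target h f w' = none) {L M : Literal} (hL : S.active h f L = some M)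
    (p q : Player) : L.moveBy p (q, w) = none := by
  by_contra hne
  obtain ⟨β, hβ⟩ := Option.ne_none_iff_exists'.1 hne
  rw [Literal.moveBy_eq_some] at hβ
  have h1 := ht (L.name ++ [Key.dot]) ⟨β, by simp [(Prod.mk.inj hβ).2, Literal.move]⟩
  rw [S.target_eq_some.2 ⟨L, rfl, hL⟩] at h1
  cases h1

/-- The same for the transition at the end of an environment's move that has not been copied: such a
move is skipped, or ends the rescan, or is a new choice to be responded to. -/
theorem Invariant.finish (hI : S.Invariant n s k u Φ A B r) (hΦ : ChoicesDistinct Φ) {w : Move}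
    (hs : s.act = .read w) (ho : ∀ k', (spell Φ)[k]? ≠ some (Sum.inr k')) :
    ∃ A' B' r', S.Invariant n (S.finish s.hist s.rescan w) k u Φ A' B' r' ∧
      Advances C s (S.finish s.hist s.rescan w) Φ A A' B B' r r' := by
  cases hI with
  | read h f _ _ _ w' v hp hch hx ht =>
    obtain rfl := Activity.read.inj hs
    obtain rfl : v = [] := by
      cases v with
      | nil => rfl
      | cons k' v => exact absurd (spell_key hx rfl) (ho k')
    rw [List.append_nil] at hx
    have hlen : (spell A).length + 1 + w'.length = (spell (A ++ [(.environment, w')])).length :=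
      (spell_length_append_singleton A (.environment, w')).symm
    simp only
    rw [hlen]
    unfold finish
    cases f with
    | true =>
      obtain ⟨x, t, B₀, rfl, hB, -⟩ := hp.eq_of_rescan rfl
      by_cases hc : chandOf (.environment, w') = some x
      · rw [if_pos rfl]
        simp only [List.head?_cons, hc, ne_eq, not_true_eq_false, decide_false]
        rw [chandOf_eq_some] at hc
        rw [hc] at hx ⊢
        exact ⟨_, _, _, .label _ _ _ _ _ (hp.pop hΦ hx) hch, Or.inl (by simp [phase])⟩
      · rw [if_pos rfl]
        simp only [List.head?_cons, ne_eq, hc, not_false_eq_true, decide_true]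
        obtain ⟨B', h1, h2⟩ := hp.skip hΦ hx
          (fun L M hL => target_of_prefix ht hL _ _)
          (fun _ y hy h => hc (by
            rw [List.head?_cons, Option.some.injEq] at hy
            rw [hy]; exact chandOf_eq_some.2 h))
          (fun h => (Bool.false_ne_true h.symm).elim)
        exact ⟨_, _, _, .label _ _ _ _ _ h1 hch, Or.inr ⟨rfl, rfl, h2, Or.inl (by simp)⟩⟩
    | false =>
      rw [if_neg (by simp)]
      have hskip : (∀ c i, (Player.environment, w') = chandLabmove c i → c ∈ C.chands →
          c ∈ h.map Prod.fst) → ∃ A' B' r',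
          S.Invariant n ⟨h, false, .label⟩ (spell (A ++ [(.environment, w')])).length [] Φ A' B' r' ∧
          Advances C ⟨h, false, .read w'⟩ ⟨h, false, .label⟩ Φ A A' B B' (toLex (3, ([] : Move).length)) r' := by
        intro hc
        obtain ⟨B', h1, h2⟩ := hp.skip hΦ hx (fun L M hL => target_of_prefix ht hL _ _)
          (fun h => (Bool.false_ne_true h).elim) (fun _ => hc)
        exact ⟨_, _, _, .label _ _ _ _ _ h1 hch, Or.inr ⟨rfl, rfl, h2, Or.inl (by simp)⟩⟩
      rcases hc : chandOf (.environment, w') with _ | ⟨c, i⟩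
      · refine hskip fun c i hi => ?_
        rw [chandOf_eq_some.2 hi] at hc
        cases hc
      · rw [chandOf_eq_some] at hc
        simp only
        split_ifs with hci
        · have h1 := hp.push (hc ▸ hx) hci.1 hci.2
          refine ⟨_, _, _, .announce _ _ _ _ _ [] (S.response (c, i) h) _ h1
            (by rw [hch, announced_append_response]) rfl, Or.inl ?_⟩
          have h2 := h1.isHistory.length_le
          simp only [List.length_cons] at h2
          simp only [phase, List.length_cons, if_true, Bool.false_eq_true, if_false]
          omega
        · refine hskip fun d j hd hdc => ?_
          rw [hc] at hd
          obtain ⟨rfl, rfl⟩ := chandLabmove_inj hd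
          by_contra hdh
          exact hci ⟨hdc, hdh⟩
  | _ => cases hs

/-- A transition preserves the invariant, makes allowed moves only, and advances the play. The flag
`mark` tells whether the head is at the leftmost cell, but need not do so at the very beginning. -/
theorem Invariant.step (hn : S.Bounded n) (hI : S.Invariant n s k u Φ A B r)
    (hΦ : ChoicesDistinct Φ) {mark : Bool} (hm : s.act ≠ .init → mark = decide (k = 0)) :
    ((S.step n s (spell Φ)[k]? mark).2.2 = .submit → AllowedMove Φ u) ∧
    ∃ A' B' r', S.Invariant n (S.step n s (spell Φ)[k]? mark).1
      (moveRunHead (S.step n s (spell Φ)[k]? mark).2.1 k)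
      (nextMove u (S.step n s (spell Φ)[k]? mark).2.2)
      (nextPosition u Φ (S.step n s (spell Φ)[k]? mark).2.2) A' B' r' ∧
      Advances C s (S.step n s (spell Φ)[k]? mark).1 Φ A A' B B' r r' := by
  have hI' := hI
  cases hI with
  | init _ hE =>
    refine ⟨fun h => by simp [Strategy.step] at h, _, _, _, .announce _ _ _ _ _ [] (S.announced []) _
      (Progress.init hE) ?_ rfl, advances_of_lt ?_⟩
    · simp only [nextPosition, Strategy.step]
      rw [show Φ.filterMap chorOf = [] from ?_]; rfl
      rw [List.filterMap_eq_nil_iff]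
      intro x hx
      by_contra hne
      obtain ⟨⟨c, i⟩, hc⟩ := Option.ne_none_iff_exists'.1 hne
      rw [chorOf_eq_some] at hc
      have := hE x hx
      rw [hc] at this
      cases this
    · exact Prod.Lex.toLex_lt_toLex.2 (Or.inl (by norm_num))
  | label h f _ _ _ hp hch =>
    have hA : A <+: Φ := hp.prefix_processed.trans hp.prefix_position
    obtain ⟨E, rfl⟩ := hA
    cases E with
    | nil =>
      rw [List.append_nil] at hp hch hΦ ⊢
      rw [List.getElem?_eq_none le_rfl]
      refine ⟨fun h => by simp [Strategy.step] at h, _, _, _, .label h f _ _ _ hp hch, ?_⟩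
      exact Or.inr ⟨rfl, rfl, fun _ => rfl, Or.inr ⟨rfl, Or.inr rfl⟩⟩
    | cons x E =>
      have hx : A ++ [x] <+: A ++ x :: E := ⟨E, by simp⟩
      rw [spell_label hx]
      obtain ⟨p, α⟩ := x
      cases p with
      | environment =>
        refine ⟨fun h => by simp [Strategy.step] at h, _, _, _,
          .read h f A B _ [] α hp hch hx fun w' hw => ?_,
          advances_of_lt (Prod.Lex.toLex_lt_toLex.2 (Or.inl (by norm_num)))⟩
        rw [List.prefix_nil.1 hw]
        by_contra hne
        obtain ⟨M, hM⟩ := Option.ne_none_iff_exists'.1 hne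
        obtain ⟨L, hL, -⟩ := S.target_eq_some.1 hM
        simp at hL
      | machine =>
        obtain ⟨B', h1, h2⟩ := hp.skip hΦ hx (fun L M _ => by
          by_contra hne
          obtain ⟨β, hβ⟩ := Option.ne_none_iff_exists'.1 hne
          rw [Literal.moveBy_eq_some] at hβ
          cases hβ) (fun _ y _ h => by cases h) (fun _ c i h => by cases h)
        exact ⟨fun h => by simp [Strategy.step] at h, _, _, _,
          .skip h f A B' _ (.machine, α) [] α h1 hch rfl,
          Or.inr ⟨rfl, rfl, h2, Or.inl (by simp)⟩⟩
  | skip h f A _ _ x u v hp hch hx =>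
    have hA : A ++ [x] <+: Φ := hp.prefix_processed.trans hp.prefix_position
    cases v with
    | nil =>
      rw [List.append_nil] at hx
      have hend := spell_end hA
      rw [← hx] at *
      have hstep : S.step n ⟨h, f, .skip⟩ (spell Φ)[(spell A).length + 1 + x.2.length]? mark =
          (⟨h, f, .label⟩, none, .idle) := by
        rcases ho : (spell Φ)[(spell A).length + 1 + x.2.length]? with _ | q | k
        · rfl
        · rfl
        · exact absurd ho (hend k)
      rw [hstep]
      refine ⟨fun h => by simp at h, _, _, _, ?_,
        advances_of_lt (r' := toLex (4, 0)) (Prod.Lex.toLex_lt_toLex.2 (Or.inl (by norm_num)))⟩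
      simp only [moveRunHead]
      rw [← spell_length_append_singleton]
      exact .label h f _ _ _ hp hch
    | cons k v =>
      rw [spell_key hA hx]
      refine ⟨fun h => by simp [Strategy.step] at h, _, _, _, ?_,
        advances_of_lt (r' := toLex (5, v.length))
          (Prod.Lex.toLex_lt_toLex.2 (Or.inr ⟨rfl, by simp⟩))⟩
      have := Invariant.skip (n := n) h f A B _ x (u ++ [k]) v hp hch (by simp [hx])
      simpa [Strategy.step, moveRunHead, nextMove, nextPosition, add_assoc] using this
  | read h f _ _ _ w v hp hch hx ht =>
    cases v with
    | nil =>
      rw [List.append_nil] at hx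
      have hend := spell_end hx
      simp only at hend
      have hstep : S.step n ⟨h, f, .read w⟩ (spell Φ)[(spell A).length + 1 + w.length]? mark =
          (S.finish h f w, none, .idle) := by
        rcases ho : (spell Φ)[(spell A).length + 1 + w.length]? with _ | q | k
        · rfl
        · rfl
        · exact absurd ho (hend k)
      rw [hstep]
      exact ⟨fun h => by simp at h, hI'.finish hΦ rfl hend⟩
    | cons k v =>
      rw [spell_key hx rfl]
      rcases hM : S.target h f (w ++ [k]) with _ | M
      · by_cases hw : (w ++ [k]).length ≤ n
        · have hstep : S.step n ⟨h, f, .read w⟩ (some (.inr k)) mark =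
              (⟨h, f, .read (w ++ [k])⟩, some .right, .idle) := by
            simp only [Strategy.step, hM, if_pos hw]
          rw [hstep]
          refine ⟨fun h => by simp at h, _, _, _, ?_, advances_of_lt (r' := toLex (3, v.length))
            (Prod.Lex.toLex_lt_toLex.2 (Or.inr ⟨rfl, by simp⟩))⟩
          have := Invariant.read (n := n) h f A B Φ (w ++ [k]) v hp hch (by simpa using hx)
            (fun w' hw' => by
              rcases List.prefix_concat_iff.1 hw' with rfl | hw'
              · exact hM
              · exact ht w' hw')
          simpa [moveRunHead, nextMove, nextPosition, add_assoc] using this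
        · have hstep : S.step n ⟨h, f, .read w⟩ (some (.inr k)) mark =
              (⟨h, f, .skip⟩, some .right, .idle) := by
            simp only [Strategy.step, hM, if_neg hw]
          rw [hstep]
          -- The move is too long to be a choice in a cluster of `C`.
          have hlong : ∀ c i, (Player.environment, w ++ k :: v) = chandLabmove c i →
              c ∉ C.chands := by
            intro c i hc hcC
            have h1 := hn.choice c hcC i
            rw [← hc] at h1
            simp at hw h1
            omega
          obtain ⟨B', h1, h2⟩ := hp.skip hΦ hx (fun L M hL => by
              by_contra hne
              obtain ⟨β, hβ⟩ := Option.ne_none_iff_exists'.1 hne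
              rw [Literal.moveBy_eq_some] at hβ
              have hβ := (Prod.mk.inj hβ).2
              have h2 := hn.name L (S.partner_mem _ _ _ (S.active_partner hL))
              have h3 : L.name ++ [Key.dot] <+: w ++ [k] := by
                refine List.prefix_of_prefix_length_le (l₃ := w ++ k :: v)
                  ⟨β, by simp [hβ, Literal.move]⟩ ⟨v, by simp⟩ ?_
                simp at hw ⊢
                omega
              have h4 : S.target h f (L.name ++ [Key.dot]) = none := by
                rcases List.prefix_concat_iff.1 h3 with h5 | h5
                · rw [h5, hM]
                · exact ht _ h5
              rw [S.target_eq_some.2 ⟨L, rfl, hL⟩] at h4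
              cases h4)
            (fun hf y hy he => by
              obtain ⟨x, t, B', rfl, -, -⟩ := hp.eq_of_rescan hf
              rw [List.head?_cons, Option.some.injEq] at hy
              subst hy
              exact hlong _ _ he (hp.isHistory.2 x (by simp)))
            (fun _ c i hc hcC => absurd hcC (hlong c i hc))
          refine ⟨fun h => by simp at h, A ++ [(.environment, w ++ k :: v)], B', toLex (5, v.length), ?_,
            Or.inr ⟨rfl, rfl, h2, Or.inl (by simp)⟩⟩
          have := Invariant.skip (n := n) h f A B' Φ _ (w ++ [k]) v h1 hch (by simp)
          simpa [moveRunHead, nextMove, nextPosition, add_assoc] using this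
      · have hstep : S.step n ⟨h, f, .read w⟩ (some (.inr k)) mark =
            (⟨h, f, .emit ((M.name ++ [Key.dot]).map some) false⟩, some .right, .idle) := by
          simp only [Strategy.step, hM]
        rw [hstep]
        obtain ⟨L, hwL, hL⟩ := S.target_eq_some.1 hM
        refine ⟨fun h => by simp at h, _, _, _, ?_,
          advances_of_lt (r' := toLex (2, (M.name ++ [Key.dot]).length))
            (Prod.Lex.toLex_lt_toLex.2 (Or.inl (by norm_num)))⟩
        have hmove : w ++ k :: v = L.move v := by
          rw [show w ++ k :: v = (w ++ [k]) ++ v by simp, hwL]; simp [Literal.move]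
        have := Invariant.name (n := n) h f A B Φ L M [] _ v hp hch (by rwa [← hmove]) hL rfl
        rw [← hwL] at this
        simpa [moveRunHead, nextMove, nextPosition, add_assoc] using this
  | name h f _ _ _ L M _ v β hp hch hx hL hu =>
    cases v with
    | nil =>
      refine ⟨fun h => by simp [Strategy.step] at h, _, _, _, ?_,
        advances_of_lt (r' := toLex (1, β.length))
          (Prod.Lex.toLex_lt_toLex.2 (Or.inl (by norm_num)))⟩
      have := Invariant.copy (n := n) h f A B Φ L M [] β hp hch hx hL
      rw [List.append_nil] at hu
      rw [← hu]
      exact this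
    | cons k v =>
      refine ⟨fun h => by simp [Strategy.step] at h, _, _, _,
        .name h f A B Φ L M (u ++ [k]) v β hp hch hx hL (by simp [hu]),
        advances_of_lt (Prod.Lex.toLex_lt_toLex.2 (Or.inr ⟨rfl, by simp⟩))⟩
  | copy h f _ _ _ L M β γ hp hch hx hL =>
    cases γ with
    | nil =>
      rw [List.append_nil] at hx
      have hend := spell_end hx
      simp only at hend
      have hstep : S.step n ⟨h, f, .copy⟩ (spell Φ)[(spell A).length + 1 + (L.move β).length]? mark =
          (⟨h, f, .label⟩, none, .submit) := by
        rcases ho : (spell Φ)[(spell A).length + 1 + (L.move β).length]? with _ | q | k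
        · rfl
        · rfl
        · exact absurd ho (hend k)
      rw [hstep]
      obtain ⟨B', h1, h2⟩ := hp.copy hΦ hL hx
      refine ⟨fun _ => hp.allowedMove hL hx, A ++ [(.environment, L.move β)], B', toLex (4, 0), ?_,
        Or.inr ⟨rfl, rfl, h2, Or.inl (by simp)⟩⟩
      have := Invariant.label (n := n) h f _ _ _ h1
        (by rw [List.filterMap_append, hch]; simp [chorOf_machine_move])
      rw [spell_length_append_singleton] at this
      exact this
    | cons k γ =>
      rw [spell_key (u := L.move β) (k := k) (v := γ) hx (by simp [Literal.move])]
      refine ⟨fun h => by simp [Strategy.step] at h, _, _, _, ?_,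
        advances_of_lt (r' := toLex (1, γ.length))
          (Prod.Lex.toLex_lt_toLex.2 (Or.inr ⟨rfl, by simp⟩))⟩
      have := Invariant.copy (n := n) h f A B Φ L M (β ++ [k]) γ hp hch (by simpa using hx) hL
      simpa [Strategy.step, moveRunHead, nextMove, nextPosition, Literal.move, add_assoc] using this
  | announce h f _ _ _ _ l acts hp hch hu =>
    rcases acts with _ | ⟨_ | k, acts⟩
    · obtain ⟨rfl, rfl⟩ : l = [] ∧ u = [] := by
        cases l with
        | nil => simpa [announcement] using hu
        | cons y l =>
          have : none ∈ u.map some ++ ([] : List (Option Key)) := by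
            rw [← hu]; simp [announcement]
          simp at this
      rw [List.append_nil] at hch
      exact ⟨fun h => by simp [Strategy.step] at h, _, _, _, .back h f B Φ _ hp hch,
        advances_of_lt (Prod.Lex.toLex_lt_toLex.2 (Or.inl (by norm_num)))⟩
    · obtain ⟨⟨c, i⟩, l', rfl, rfl, rfl⟩ : ∃ y l', l = y :: l' ∧ u = (chorLabmove y.1 y.2).2 ∧
          acts = announcement l' := by
        cases l with
        | nil => simp [announcement] at hu
        | cons y l =>
          rw [announcement, List.flatMap_cons, List.append_assoc, List.singleton_append] at hu
          obtain ⟨h1, h2⟩ := append_none_inj hu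
          exact ⟨y, l, rfl, h1.symm, h2.symm⟩
      have hnew : ∀ j, chorLabmove c j ∉ Φ := by
        intro j hj
        have := S.announced_nodup h
        rw [← hch, List.map_append, List.nodup_append] at this
        exact this.2.2 c (List.mem_map.2 ⟨(c, j), List.mem_filterMap.2
          ⟨_, hj, chorOf_eq_some.2 rfl⟩, rfl⟩) c (by simp) rfl
      refine ⟨fun _ => Or.inl ⟨c, i, rfl, hnew⟩, _, _, _,
        .announce h f B _ _ [] l' _ (hp.append (E := [chorLabmove c i]) fun M => ?_) ?_ rfl,
        advances_of_lt (Prod.Lex.toLex_lt_toLex.2 (Or.inr ⟨rfl, by simp⟩))⟩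
      · simp [moveBy_chorLabmove]
      · change (Φ ++ [chorLabmove c i]).filterMap chorOf ++ l' = _
        rw [List.filterMap_append, List.filterMap_cons_some (chorOf_eq_some.2 rfl)]
        simpa using hch
    · exact ⟨fun h => by simp [Strategy.step] at h, _, _, _,
        .announce h f B Φ _ (u ++ [k]) l acts hp hch (by simp [hu]),
        advances_of_lt (Prod.Lex.toLex_lt_toLex.2 (Or.inr ⟨rfl, by simp⟩))⟩
  | back h f _ _ _ hp hch =>
    rw [hm (by simp)]
    by_cases hk : k = 0
    · subst hk
      exact ⟨fun h => by simp [Strategy.step] at h, _, _, _, .label h f [] B Φ hp hch,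
        advances_of_lt (Prod.Lex.toLex_lt_toLex.2 (Or.inl (by norm_num)))⟩
    · have hstep : S.step n ⟨h, f, .back⟩ (spell Φ)[k]? (decide (k = 0)) =
          (⟨h, f, .back⟩, some .left, .idle) := by
        simp [Strategy.step, hk]
      rw [hstep]
      exact ⟨fun h => by simp at h, _, _, _, .back h f B Φ _ hp hch,
        advances_of_lt (Prod.Lex.toLex_lt_toLex.2 (Or.inr ⟨rfl, by simp [moveRunHead]; omega⟩))⟩

end Cirquent.Strategy


/-! ### The play of the machine -/

/-- A tape whose only marked cell is the one at distance `k` to the left of the head. -/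
def MarkedAt (k : ℕ) (T : Turing.Tape Bool) : Prop := ∀ i : ℤ, T.nth i = decide (i + k = 0)

theorem MarkedAt.head {k : ℕ} {T : Turing.Tape Bool} (h : MarkedAt k T) :
    T.head = decide (k = 0) := by
  have := h 0
  rw [Turing.Tape.nth_zero] at this
  rw [this]
  simp

theorem MarkedAt.move {k : ℕ} {T : Turing.Tape Bool} (h : MarkedAt k T) (d : Option Turing.Dir)
    (hd : d = some .left → k ≠ 0) : MarkedAt (moveRunHead d k) (moveWorkHead d T) := by
  intro i
  rcases d with _ | _ | _
  · exact h i
  · rw [moveWorkHead, Turing.Tape.move_left_nth, h, moveRunHead]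
    have := hd rfl
    congr 1
    rw [eq_iff_iff]
    omega
  · rw [moveWorkHead, Turing.Tape.move_right_nth, h, moveRunHead]
    congr 1
    rw [eq_iff_iff]
    push_cast
    constructor <;> intro h <;> omega

theorem MarkedAt.write_move {k : ℕ} {T : Turing.Tape Bool} {b : Bool} {d : Option Turing.Dir}
    (h : MarkedAt k T) (hb : b = T.head) (hd : d = some .left → k ≠ 0) :
    MarkedAt (moveRunHead d k) (moveWorkHead d (T.write b)) := by
  subst hb
  rw [Turing.Tape.write_self]
  exact h.move d hd

theorem markedAt_write : MarkedAt 0 ((default : Turing.Tape Bool).write true) := by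
  intro i
  rw [Turing.Tape.write_nth]
  by_cases hi : i = 0
  · simp [hi]
  · rw [if_neg hi]
    rcases i with (_ | i) | i
    · exact absurd rfl hi
    · simp only [Int.ofNat_eq_natCast]
      rw [show ((default : Turing.Tape Bool).nth ((i + 1 : ℕ) : ℤ)) = false from rfl]
      symm
      rw [decide_eq_false_iff_not]
      omega
    · rw [show ((default : Turing.Tape Bool).nth (Int.negSucc i)) = false from rfl]
      symm
      rw [decide_eq_false_iff_not]
      omega

theorem ChoicesDistinct.mono {Φ Ψ : Position} (h : ChoicesDistinct Ψ) (hΦ : Φ <+: Ψ) :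
    ChoicesDistinct Φ := ((hΦ.sublist.filterMap chandOf).map Prod.fst).nodup h

theorem exists_sequence {X : Type} {P : ℕ → X → Prop} {R : ℕ → X → X → Prop} (h0 : ∃ x, P 0 x)
    (hs : ∀ t x, P t x → ∃ y, P (t + 1) y ∧ R t x y) :
    ∃ f : ℕ → X, ∀ t, P t (f t) ∧ R t (f t) (f (t + 1)) := by
  choose! g hg using hs
  obtain ⟨x, hx⟩ := h0
  let f : ℕ → X := fun t => Nat.rec x g t
  have hf : ∀ t, P t (f t) := by
    intro t
    induction t with
    | zero => exact hx
    | succ t ih => exact (hg t _ ih).1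
  exact ⟨f, fun t => ⟨hf t, (hg t _ (hf t)).2⟩⟩

/-- If `a` grows whenever it stays below `len`, except that growing may be put off while `r`
decreases, then `a` exceeds every number that `len` exceeds. -/
theorem exists_lt_of_advances {a len : ℕ → ℕ} {r : ℕ → ℕ ×ₗ ℕ} {t₀ : ℕ}
    (h : ∀ t, t₀ ≤ t → a t < a (t + 1) ∨ (a (t + 1) = a t ∧ (r (t + 1) < r t ∨ len t ≤ a t)))
    (hlen : Monotone len) {k t₁ : ℕ} (hk : k < len t₁) : ∃ t, t₀ ≤ t ∧ k < a t := by
  by_contra hcon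
  push Not at hcon
  have key : ∀ (x : ℕ ×ₗ (ℕ ×ₗ ℕ)) (t : ℕ), max t₀ t₁ ≤ t → toLex (k - a t, r t) = x → False := by
    intro x
    induction x using WellFoundedLT.induction with
    | ind x ih =>
      rintro t ht rfl
      have ht₀ := le_of_max_le_left ht
      have h1 := hcon t ht₀
      have h2 := hcon (t + 1) (ht₀.trans (Nat.le_succ t))
      have h3 := hlen (le_of_max_le_right ht)
      refine ih _ ?_ (t + 1) (ht.trans (Nat.le_succ t)) rfl
      rw [Prod.Lex.toLex_lt_toLex]
      rcases h t ht₀ with h4 | ⟨h4, h5 | h5⟩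
      · exact Or.inl (by simp only; omega)
      · exact Or.inr ⟨by simp only; rw [h4], h5⟩
      · omega
  exact key _ _ le_rfl rfl

namespace Cirquent.Strategy

variable {C : Cirquent} {S : C.Strategy} {n : ℕ}

theorem Invariant.progress {s : Control} {k : ℕ} {u : Move} {Φ A B : Position} {r : ℕ ×ₗ ℕ}
    (hI : S.Invariant n s k u Φ A B r) : S.Progress s.hist s.rescan A B Φ := by
  cases hI with
  | init _ hΦ => exact Progress.init hΦ
  | _ => assumption

theorem Invariant.announced {s : Control} {k : ℕ} {u : Move} {Φ A B : Position} {r : ℕ ×ₗ ℕ}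
    (hI : S.Invariant n s k u Φ A B r) (hs : s.act ≠ .init) (hs' : ∀ l, s.act ≠ .emit l true) :
    Φ.filterMap chorOf = S.announced s.hist := by
  cases hI with
  | init => exact absurd rfl hs
  | announce => exact absurd rfl (hs' _)
  | _ => assumption

theorem step_init {s : Control} (hs : s.act = .init) (o : Option RunSymbol) (mark : Bool) :
    (S.step n s o mark).2.1 = none := by
  obtain ⟨h, f, a⟩ := s
  cases hs
  rfl

theorem step_emit_cons {s : Control} {a : Option Key} {l : List (Option Key)} {b : Bool}
    (hs : s.act = .emit (a :: l) b) (o : Option RunSymbol) (mark : Bool) :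
    (S.step n s o mark).1.act = .emit l b := by
  obtain ⟨h, f, a⟩ := s
  cases hs
  cases a <;> rfl

theorem step_emit_nil {s : Control} (hs : s.act = .emit [] true) (o : Option RunSymbol)
    (mark : Bool) : (S.step n s o mark).1.act = .back := by
  obtain ⟨h, f, a⟩ := s
  cases hs
  rfl

theorem step_left {s : Control} {o : Option RunSymbol} {mark : Bool}
    (h : (S.step n s o mark).2.1 = some .left) : s.act ≠ .init ∧ mark = false := by
  obtain ⟨hi, f, a⟩ := s
  unfold step at h
  split at h
  · cases h
  · split at h <;> cases h
  · split at h <;> cases h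
  · split at h
    · split at h
      · cases h
      · split_ifs at h <;> cases h
    · cases h
  · cases h
  · cases h
  · cases h
  · split at h <;> cases h
  · rename_i hact
    split_ifs at h with hm
    exact ⟨by rw [hact]; simp, by simpa using hm⟩

theorem finish_act_ne_init (h : List (ℕ × Bool)) (f : Bool) (w : Move) :
    (S.finish h f w).act ≠ .init := by
  unfold finish
  split
  · simp
  · split
    · simp
    · split_ifs <;> simp

theorem step_act_ne_init (s : Control) (o : Option RunSymbol) (mark : Bool) :
    (S.step n s o mark).1.act ≠ .init := by
  obtain ⟨hi, f, a⟩ := s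
  unfold step
  split
  · simp
  · split <;> simp_all
  · split <;> simp_all
  · split
    · split
      · simp
      · split_ifs <;> simp
    · exact S.finish_act_ne_init _ _ _
  · simp
  · simp
  · split_ifs <;> simp
  · split <;> simp_all
  · split_ifs <;> simp_all

variable {hn : S.Bounded n}

/-- The invariant of the machine, including the content of its work tape. -/
def ConfigInvariant (hn : S.Bounded n) (c : (S.machine hn).Config)
    (x : Position × Position × (ℕ ×ₗ ℕ)) : Prop :=
  S.Invariant n c.state.1 c.runHead c.buffer c.position x.1 x.2.1 x.2.2 ∧
    (c.state.1.act = .init → c.runHead = 0 ∧ c.work (0 : Fin 1) = (default : Turing.Tape Bool)) ∧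
    (c.state.1.act ≠ .init → MarkedAt c.runHead (c.work (0 : Fin 1)))

theorem configInvariant_init :
    ConfigInvariant hn (S.machine hn).init ([], [], toLex (7, 0)) :=
  ⟨.init [] (by simp), fun _ => ⟨rfl, rfl⟩, fun h => absurd rfl h⟩

/-- A clock cycle, in which the environment makes the moves `e`, preserves the invariant. -/
theorem configInvariant_step {c : (S.machine hn).Config} {x : Position × Position × (ℕ ×ₗ ℕ)}
    (hc : ConfigInvariant hn c x) (e : List Move)
    (hΦ : ChoicesDistinct (c.position ++ e.map fun α => (Player.environment, α))) :
    (((S.machine hn).step e c).position = c.position ++ e.map (fun α => (Player.environment, α)) ∨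
      ∃ α, AllowedMove (c.position ++ e.map fun α => (Player.environment, α)) α ∧
        ((S.machine hn).step e c).position =
          c.position ++ e.map (fun α => (Player.environment, α)) ++ [(.machine, α)]) ∧
    ∃ y, ConfigInvariant hn ((S.machine hn).step e c) y ∧
      Advances C c.state.1 ((S.machine hn).step e c).state.1
        (c.position ++ e.map fun α => (Player.environment, α)) x.1 y.1 x.2.1 y.2.1 x.2.2 y.2.2 := by
  obtain ⟨hI, h0, h1⟩ := hc
  set Φ := c.position ++ e.map fun α => (Player.environment, α) with hΦ'
  have hI' := hI.append_environment (E := e.map fun α => (Player.environment, α)) (by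
    intro y hy
    obtain ⟨α, -, rfl⟩ := List.mem_map.1 hy
    rfl)
  set mark : Bool := (c.work (0 : Fin 1)).head with hmark
  have hm : c.state.1.act ≠ .init → mark = decide (c.runHead = 0) := fun h => (h1 h).head
  obtain ⟨hallowed, A', B', r', hI'', hadv⟩ := hI'.step hn hΦ hm
  rw [← hΦ'] at hallowed hI'' hadv
  set R := S.step n c.state.1 (spell Φ)[c.runHead]? mark with hR
  have hstate : ((S.machine hn).step e c).state.1 = R.1 := rfl
  have hhead : ((S.machine hn).step e c).runHead = moveRunHead R.2.1 c.runHead := rfl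
  have hbuffer : ((S.machine hn).step e c).buffer = nextMove c.buffer R.2.2 := rfl
  have hposition : ((S.machine hn).step e c).position = nextPosition c.buffer Φ R.2.2 := rfl
  have hwork : ∀ b, b = (c.state.1.act.isInit || mark) →
      (((S.machine hn).step e c).work (0 : Fin 1) : Turing.Tape Bool) =
        moveWorkHead (Γ := Bool) R.2.1 (Turing.Tape.write (Γ := Bool) b (c.work (0 : Fin 1))) := by
    rintro _ rfl; rfl
  refine ⟨?_, (A', B', r'), ⟨?_, fun h => ?_, fun _ => ?_⟩, ?_⟩
  · rw [hposition]
    rcases hact : R.2.2 with _ | k | _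
    · exact Or.inl rfl
    · exact Or.inl rfl
    · exact Or.inr ⟨_, hallowed hact, rfl⟩
  · rw [hstate, hhead, hbuffer, hposition]
    exact hI''
  · rw [hstate] at h
    exact absurd h (S.step_act_ne_init _ _ _)
  · rw [hhead]
    by_cases hinit : c.state.1.act = .init
    · rw [hwork true (by rw [hinit]; rfl), S.step_init hinit, (h0 hinit).1, (h0 hinit).2]
      exact markedAt_write
    · rw [hwork mark (by
        rcases h : c.state.1.act <;> first | exact absurd h hinit | rfl)]
      refine (h1 hinit).write_move hmark fun hd => ?_
      have h2 := (S.step_left hd).2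
      rw [hm hinit] at h2
      simpa using h2
  · rw [hstate]
    exact hadv

theorem exists_configInvariant (env : ℕ → List Move) (t : ℕ)
    (ht : ChoicesDistinct ((S.machine hn).configAt env t).position) :
    ∃ x, ConfigInvariant hn ((S.machine hn).configAt env t) x := by
  induction t with
  | zero => exact ⟨_, configInvariant_init⟩
  | succ t ih =>
    obtain ⟨l, hl⟩ := (S.machine hn).position_step (env t) ((S.machine hn).configAt env t)
    rw [HPM.configAt, hl] at ht
    have h1 := ht.mono (List.prefix_append _ _)
    obtain ⟨x, hx⟩ := ih (h1.mono (List.prefix_append _ _))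
    obtain ⟨-, y, hy, -⟩ := configInvariant_step hx (env t) h1
    exact ⟨y, hy⟩

/-- The machine does not make illegal moves. -/
theorem legalRun_take_succ {I : Interpretation} {env : ℕ → List Move} {m : ℕ} {α : Move}
    (hl : I.LegalRun (Stream'.Seq.ofList (((S.machine hn).run env).take m)))
    (hm : ((S.machine hn).run env).get? m = some (.machine, α)) :
    I.LegalRun (Stream'.Seq.ofList (((S.machine hn).run env).take (m + 1))) := by
  classical
  set H := S.machine hn with hH
  have hex := (H.get?_run env).1 hm
  have hfind := Nat.find_spec hex
  rcases ht : Nat.find hex with _ | t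
  · rw [ht] at hfind
    simp [HPM.configAt, HPM.init] at hfind
  · rw [ht] at hfind
    have hmin : ((H.configAt env t).position)[m]? ≠ some (.machine, α) :=
      Nat.find_min hex (by omega)
    set Φ := (H.configAt env t).position ++ (env t).map fun α => (Player.environment, α) with hΦ
    have hpre : Φ <+: (H.configAt env (t + 1)).position := by
      obtain ⟨l, h2⟩ := H.position_step (env t) (H.configAt env t)
      rw [HPM.configAt, h2]
      exact List.prefix_append _ _
    have hΦm : Φ.length ≤ m := by
      by_contra hlt
      push Not at hlt
      have h1 := prefix_get hpre (List.getElem?_eq_getElem hlt)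
      rw [hfind, Option.some.injEq] at h1
      have h2 : Φ[m]? = some (.machine, α) := by rw [List.getElem?_eq_getElem hlt, h1]
      rw [hΦ, List.getElem?_append] at h2
      split_ifs at h2
      · exact hmin h2
      · rw [List.getElem?_map, Option.map_eq_some_iff] at h2
        obtain ⟨_, _, h3⟩ := h2
        cases h3
    have htake : Φ = (H.run env).take Φ.length := by
      have h1 := H.take_run env (t + 1)
      have h2 := List.prefix_iff_eq_take.1 hpre
      rw [← h1] at h2
      conv_lhs => rw [h2]
      apply List.ext_getElem?
      intro i
      rw [List.getElem?_take, get?_take, get?_take]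
      have := hpre.length_le
      split_ifs <;> first | rfl | omega
    have hlm : I.LegalRun (Stream'.Seq.ofList Φ) := by
      have h1 : (H.run env).take Φ.length <+: (H.run env).take m := take_prefix_take _ hΦm
      rw [← htake] at h1
      have h2 := (Cirquent.top.game I).prefix_closed _ hl Φ.length
      rwa [take_ofList, ← List.prefix_iff_eq_take.1 h1] at h2
    have hd : ChoicesDistinct Φ := ((I.legalRun_ofList Φ).1 hlm).2.2.1
    obtain ⟨x, hx⟩ := exists_configInvariant (hn := hn) env t (hd.mono (List.prefix_append _ _))
    obtain ⟨h1 | ⟨β, h1, h2⟩, -⟩ := configInvariant_step hx (env t) hd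
    · have h3 : (H.configAt env (t + 1)).position = Φ := h1
      rw [h3, List.getElem?_eq_none hΦm] at hfind
      cases hfind
    · have h3 : (H.configAt env (t + 1)).position = Φ ++ [(.machine, β)] := h2
      have h4 := H.take_run env (t + 1)
      rw [h3] at h4 hfind
      have h5 : Φ.length = m := by
        have := (List.getElem?_eq_some_iff.1 hfind).1
        simp at this
        omega
      rw [List.length_append, List.length_singleton, h5] at h4
      rw [h4]
      exact h1.legal hlm

/-- In a legal run the machine wins. -/
theorem won_of_legalRun {I : Interpretation} {env : ℕ → List Move}
    (hl : I.LegalRun ((S.machine hn).run env)) : C.Won I ((S.machine hn).run env) := by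
  set H := S.machine hn with hH
  set Γ := H.run env with hΓ
  have hd : ∀ t, ChoicesDistinct (H.configAt env t).position := by
    intro t
    have := (Cirquent.top.game I).prefix_closed _ hl (H.configAt env t).position.length
    rw [hΓ, H.take_run] at this
    exact ((I.legalRun_ofList _).1 this).2.2.1
  obtain ⟨x, hx⟩ := exists_sequence
    (P := fun t x => ConfigInvariant hn (H.configAt env t) x)
    (R := fun t x y => Advances C (H.configAt env t).state.1 (H.configAt env (t + 1)).state.1
      ((H.configAt env t).position ++ (env t).map fun α => (Player.environment, α))
      x.1 y.1 x.2.1 y.2.1 x.2.2 y.2.2) ⟨_, configInvariant_init⟩ (by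
    intro t x hx
    obtain ⟨l, hl⟩ := H.position_step (env t) (H.configAt env t)
    have h1 := hd (t + 1)
    rw [HPM.configAt, hl] at h1
    exact (configInvariant_step hx (env t) (h1.mono (List.prefix_append _ _))).2)
  set s : ℕ → Control := fun t => (H.configAt env t).state.1 with hs
  have hprog : ∀ t, S.Progress (s t).hist (s t).rescan (x t).1 (x t).2.1
      (H.configAt env t).position := fun t => (hx t).1.1.progress
  -- From some time on the phase does not change.
  obtain ⟨t₀, ht₀⟩ : ∃ t₀, ∀ t, phase C (s t₀) ≤ phase C (s t) := by
    obtain ⟨_, ⟨t₀, rfl⟩, h⟩ := wellFounded_lt.has_min (Set.range fun t => phase C (s t))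
      ⟨_, 0, rfl⟩
    exact ⟨t₀, fun t => not_lt.1 (h _ ⟨t, rfl⟩)⟩
  have hanti : Antitone fun t => phase C (s t) := by
    refine antitone_nat_of_succ_le fun t => ?_
    rcases (hx t).2 with h | ⟨h1, h2, -⟩
    · exact h.le
    · exact le_of_eq (by simp only [phase]; rw [h1, h2])
  have hadv : ∀ t, t₀ ≤ t → (s (t + 1)).hist = (s t).hist ∧ (s (t + 1)).rescan = (s t).rescan ∧
      ((s t).rescan = true → (x (t + 1)).2.1 = (x t).2.1) ∧
      ((x t).1.length < (x (t + 1)).1.length ∨ ((x (t + 1)).1.length = (x t).1.length ∧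
        ((x (t + 1)).2.2 < (x t).2.2 ∨ (H.configAt env t).position.length ≤ (x t).1.length))) := by
    intro t ht
    rcases (hx t).2 with h | ⟨h1, h2, h3, h4⟩
    · exact absurd h (not_lt.2 ((hanti ht).trans (ht₀ _)))
    · refine ⟨h1, h2, h3, h4.imp id fun h => ⟨by rw [h.1], h.2.imp id fun h5 => ?_⟩⟩
      rw [h5]; simp
  have hlen : Monotone fun t => (H.configAt env t).position.length :=
    fun _ _ h => (H.position_prefix env h).length_le
  have hpass : ∀ k t₁, k < (H.configAt env t₁).position.length →
      ∃ t, t₀ ≤ t ∧ k < (x t).1.length := fun k t₁ hk =>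
    exists_lt_of_advances (r := fun t => (x t).2.2) (fun t ht => (hadv t ht).2.2.2) hlen hk
  have hconst : ∀ t, t₀ ≤ t → (s t).hist = (s t₀).hist ∧ (s t).rescan = (s t₀).rescan ∧
      ((s t₀).rescan = true → (x t).2.1 = (x t₀).2.1) := by
    intro t ht
    induction t, ht using Nat.le_induction with
    | base => exact ⟨rfl, rfl, fun _ => rfl⟩
    | succ t ht ih =>
      obtain ⟨h1, h2, h3, -⟩ := hadv t ht
      exact ⟨h1.trans ih.1, h2.trans ih.2.1, fun h => (h3 (ih.2.1.trans h)).trans (ih.2.2 h)⟩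
  have hrescan : (s t₀).rescan = false := by
    by_contra hr
    rw [Bool.not_eq_false] at hr
    have hlt : ∀ t, t₀ ≤ t → (x t).1.length < (x t₀).2.1.length := by
      intro t ht
      obtain ⟨y, u, B, -, hB, hA⟩ := (hprog t).eq_of_rescan ((hconst t ht).2.1.trans hr)
      rw [← (hconst t ht).2.2 hr, hB, List.length_append]
      exact Nat.lt_succ_of_le hA.length_le
    have hpos := (hprog t₀).prefix_position.length_le
    have h0 := hlt t₀ le_rfl
    obtain ⟨t, ht, h1⟩ := hpass ((x t₀).2.1.length - 1) t₀ (by omega)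
    have := hlt t ht
    omega
  have hAB : ∀ t, t₀ ≤ t → (x t).1 = (x t).2.1 := fun t ht =>
    (hprog t).eq_of_not_rescan ((hconst t ht).2.1.trans hrescan)
  have hpos : ∀ t, (x t).1 <+: (H.configAt env t).position := fun t =>
    (hprog t).prefix_processed.trans (hprog t).prefix_position
  -- Every labmove of the run is eventually processed.
  have htake : ∀ m, ∃ t, t₀ ≤ t ∧ Γ.take m <+: (x t).1 := by
    intro m
    obtain ⟨t₁, ht₁⟩ := H.exists_take_run env m
    rcases Nat.eq_zero_or_pos (Γ.take m).length with h | h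
    · exact ⟨t₀, le_rfl, by rw [List.length_eq_zero_iff.1 h]; exact List.nil_prefix⟩
    · have h1 : (Γ.take m).length ≤ _ := ht₁.length_le
      obtain ⟨t, ht, h2⟩ := hpass ((Γ.take m).length - 1) t₁ (by omega)
      refine ⟨t, ht, List.prefix_of_prefix_length_le
        (ht₁.trans (H.position_prefix env (le_max_left t₁ t)))
        ((hpos t).trans (H.position_prefix env (le_max_right t₁ t))) (by omega)⟩
  obtain ⟨g, hg1, hg2, hg3, hg4⟩ := S.taut _ (hprog t₀).isHistory.1
  refine Cirquent.Won.of_eval hg1 hl (fun c hc i => ?_) (fun c hc i hi => ?_) fun L M hLM => ?_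
  · rw [hg2, hΓ, H.run_has]
    constructor
    · intro h
      rw [(hprog t₀).mem_hist c hc] at h
      exact ⟨t₀, (hprog t₀).prefix_position.subset h⟩
    · rintro ⟨t₁, h⟩
      rw [← H.take_run env t₁] at h
      obtain ⟨t, ht, h1⟩ := htake (H.configAt env t₁).position.length
      have h2 := h1.subset h
      rw [hAB t ht, ← (hprog t).mem_hist c hc, (hconst t ht).1] at h2
      exact h2
  · -- At some time the machine has finished announcing its choices.
    have hemit : ∀ (l : List (Option Key)) (t : ℕ), t₀ ≤ t → (s t).act = .emit l true →
        ∃ t', t₀ ≤ t' ∧ (s t').act = .back := by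
      intro l
      induction l with
      | nil =>
        intro t ht hact
        refine ⟨t + 1, ht.trans (Nat.le_succ t), ?_⟩
        exact S.step_emit_nil hact _ _
      | cons a l ih =>
        intro t ht hact
        refine ih (t + 1) (ht.trans (Nat.le_succ t)) ?_
        exact S.step_emit_cons hact _ _
    have hdone : ∃ t, t₀ ≤ t ∧
        (H.configAt env t).position.filterMap chorOf = S.announced (s t₀).hist := by
      by_contra hcon
      push Not at hcon
      have hinit : ∀ t, t₀ ≤ t → (s t).act = .init := by
        intro t ht
        have h1 := hcon t ht
        rw [← (hconst t ht).1] at h1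
        by_contra hne
        obtain ⟨l, hl⟩ : ∃ l, (s t).act = .emit l true := by
          by_contra hl
          push Not at hl
          exact h1 ((hx t).1.1.announced hne hl)
        obtain ⟨t', ht', hb⟩ := hemit l t ht hl
        refine hcon t' ht' ?_
        rw [← (hconst t' ht').1]
        exact (hx t').1.1.announced (by rw [hb]; simp) (by rw [hb]; simp)
      exact S.step_act_ne_init _ _ _ (hinit (t₀ + 1) (Nat.le_succ t₀))
    obtain ⟨t, -, hdone⟩ := hdone
    have h1 := hg3 c hc i hi
    rw [← hdone, List.mem_filterMap] at h1
    obtain ⟨y, hy, h2⟩ := h1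
    rw [chorOf_eq_some] at h2
    subst h2
    exact (H.run_has env).2 ⟨t, hy⟩
  · have hp := hg4 L M hLM
    refine ⟨fun m => ?_, fun m => ?_⟩
    · obtain ⟨t, ht, h1⟩ := htake m
      exact (hprog t).lag _ (h1.trans (hpos t)) L M (by rw [(hconst t ht).1]; exact hp)
    · obtain ⟨t, ht, h1⟩ := htake m
      refine ⟨(H.configAt env t).position.length, ?_⟩
      rw [hΓ, H.take_run, (hprog t).copied L M (by rw [(hconst t ht).1]; exact hp), ← hAB t ht,
        ite_self]
      exact h1.filterMap _

end Cirquent.Strategy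

theorem Cirquent.Winnable.valid {C : Cirquent} (hC : C.Winnable) : C.Valid := by
  classical
  obtain ⟨S⟩ := hC.nonempty_strategy
  obtain ⟨n, hn⟩ := S.exists_bounded
  refine ⟨S.machine hn, fun I env => (C.game I).wonBy_machine
    (fun m α h1 h2 => Strategy.legalRun_take_succ h1 h2) fun hl => ?_⟩
  exact if_pos (Strategy.won_of_legalRun hl)

end CL18

theorem theorem7p4 (C : CL18.Cirquent) : C.Valid ↔ CL18.Provable C :=
  ⟨fun h => h.winnable.provable, fun h => h.winnable.valid⟩
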